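/- Let $G$ be a finite-dimensional Lie group with Lie algebra $\mathfrak g$, let $LG$ be its loop group of smooth maps $S^1=\mathbb R/2\pi\mathbb Z\to G$, let $\pi\colon\mathsf Q\to M$ be a smooth principal $LG$-bundle over a finite-dimensional manifold $M$, and let $f$ be an invariant polynomial of degree $k\ge 1$ on $\mathfrak g$ (a symmetric, $\mathrm{Ad}(G)$-invariant $k$-linear map $\mathfrak g^k\to\mathbb R$). A Higgs field on $\mathsf Q$ is a smooth map $\Phi\colon\mathsf Q\to L\mathfrak g$ with $\Phi(q\gamma)=\mathrm{Ad}(\gamma^{-1})\Phi(q)+\gamma^{-1}\partial\gamma$, where $\partial$ is differentiation along $S^1$. For an $LG$-connection $\mathsf A$ and a Higgs field $\Phi$ put $\mathsf F=d\mathsf A+\tfrac12[\mathsf A,\mathsf A]$ and $\nabla\Phi=d\Phi+[\mathsf A,\Phi]-\partial\mathsf A$. The caloron transform of $\mathsf Q$ is the $G$-bundle $Q=(\mathsf Q\times S^1\times G)/LG\to M\times S^1$, where $(q,\theta,g)\cdot\gamma=(q\gamma,\theta,\gamma(\theta)^{-1}g)$; the pair $(\mathsf A,\Phi)$ determines on $Q$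 the connection $A$ to which the form $\mathrm{Ad}(g^{-1})(\mathsf A_q(\theta)+\Phi(q)(\theta)\,d\theta)+\Theta_g$ descends, $\Theta$ being the Maurer–Cartan form of $G$. Write $\widehat{\int_{S^1}}$ for integration over the fibre of $M\times S^1\to M$, normalised by $h\,\omega\wedge d\theta\mapsto(\int_{S^1}h\,d\theta)\,\omega$ for $\omega$ pulled back from $M$. The string form $s_f(\mathsf A,\Phi)\in\Omega^{2k-1}(M)$ is $\widehat{\int_{S^1}}f(F,\dots,F)$, where $F$ is the curvature of $A$ and the Chern–Weil form $f(F,\dots,F)$ is regarded as a form on $M\times S^1$. Let $\gamma\colon t\mapsto(\mathsf A_t,\Phi_t)$, $t\in[0,1]$, be a smooth path of $LG$-connections and Higgs fields on $\mathsf Q$, that is, the family of slices of an $LG$-connection on $\mathsf Q\times[0,1]$ that annihilates the vectors tangent to $[0,1]$ and of a Higgs field on $\mathsf Q\times[0,1]$. Let $\mathsf B_t$ and $\varphi_t$ be the time derivatives of $\mathsf A_t$ and $\Phi_t$, let $\mathsf F_t$ be the curvature of $\mathsf A_t$ and let $\nabla_t\Phi$ be the covariant derivative of $\Phi_t$ with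 respect to $\mathsf A_t$. Define the relative string potential $$S_f(\gamma)=k\int_0^1\int_{S^1}\Big((k-1)\,f(\mathsf B_t,\underbrace{\mathsf F_t,\dots,\mathsf F_t}_{k-2},\nabla_t\Phi)+f(\underbrace{\mathsf F_t,\dots,\mathsf F_t}_{k-1},\varphi_t)\Big)\,dt\in\Omega^{2k-2}(\mathsf Q),$$ where the first term is absent if $k=1$. Then: 1. $S_f(\gamma)$ descends to $M$: it is the pullback along $\pi$ of a unique differential form on $M$, also denoted $S_f(\gamma)$. 2. On $M$ one has $dS_f(\gamma)=s_f(\mathsf A_1,\Phi_1)-s_f(\mathsf A_0,\Phi_0)$ (in particular, both string forms are well defined). 3. The connections $A_t$ on $Q$ determined by $(\mathsf A_t,\Phi_t)$ form a smooth path, with curvatures $F_t$ and time derivatives $B_t$, whose relative Chern–Simons form $CS_f=k\int_0^1 f(B_t,\underbrace{F_t,\dots,F_t}_{k-1})\,dt$ descends to $M\times S^1$, and on $M$ one has $S_f(\gamma)=\widehat{\int_{S^1}}CS_f$. -/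

import Mathlib

open scoped Manifold ContDiff Topology RightActions
open Diffeology

noncomputable section

namespace LoopBundles

/-! ## Diffeologies

Fréchet manifolds (loop groups, total spaces of loop group bundles) and finite-dimensional manifolds
are both handled as diffeological spaces, i.e. through their smooth maps from cartesian spaces.
This loses nothing: a map between Fréchet manifolds is smooth if and only if it sends smooth maps
from cartesian spaces to such maps, and a smooth form on a Fréchet manifold amounts to the compatible
family of its pullbacks along the smooth maps from cartesian spaces. -/

/-- The cartesian space `ℝⁿ`. -/
abbrev Euc (n : ℕ) : Type := EuclideanSpace ℝ (Fin n)

/-- Every point of an open set `u` has a smooth map into `u` that is the identity near the point. -/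
theorem exists_smooth_retraction {n : ℕ} {u : Set (Euc n)} (hu : IsOpen u) {x : Euc n}
    (hx : x ∈ u) :
    ∃ r : Euc n → Euc n, ContDiff ℝ ∞ r ∧ (∀ y, r y ∈ u) ∧ ∀ᶠ y in 𝓝 x, r y = y := by
  obtain ⟨ε, hε, hb⟩ := Metric.isOpen_iff.1 hu x hx
  let φ : ContDiffBump x := ⟨ε / 4, ε / 2, by positivity, by linarith⟩
  refine ⟨fun y => x + φ y • (y - x), ?_, ?_, ?_⟩
  · exact contDiff_const.add (φ.contDiff.smul (contDiff_id.sub contDiff_const))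
  · intro y
    apply hb
    rw [Metric.mem_ball, dist_eq_norm, add_sub_cancel_left, norm_smul, Real.norm_eq_abs,
      abs_of_nonneg φ.nonneg]
    by_cases h : dist y x < ε
    · rw [dist_eq_norm] at h
      exact lt_of_le_of_lt (mul_le_of_le_one_left (norm_nonneg _) φ.le_one) h
    · rw [φ.zero_of_le_dist (le_trans (by change ε / 2 ≤ ε; linarith) (not_lt.1 h)), zero_mul]
      exact hε
  · filter_upwards [φ.eventuallyEq_one] with y hy
    rw [hy]
    simp

/-- `IsManifoldDiffeology E M`: the diffeology on the manifold `M` (modelled on `E`) is the standard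
one, whose plots are the smooth maps from cartesian spaces. -/
class IsManifoldDiffeology (E M : Type*) [NormedAddCommGroup E] [NormedSpace ℝ E]
    [TopologicalSpace M] [ChartedSpace E M] [DiffeologicalSpace M] : Prop where
  isPlot_iff : ∀ {n : ℕ} {p : Euc n → M}, IsPlot p ↔ ContMDiff 𝓘(ℝ, Euc n) 𝓘(ℝ, E) ∞ p

/-- The standard diffeology of a manifold. -/
@[reducible]
def manifoldDiffeology (E M : Type*) [NormedAddCommGroup E] [NormedSpace ℝ E]
    [TopologicalSpace M] [ChartedSpace E M] : DiffeologicalSpace M where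
  plots n := {p | ContMDiff 𝓘(ℝ, Euc n) 𝓘(ℝ, E) ∞ p}
  constant_plots _ := contMDiff_const
  plot_reparam hp hf := ContMDiff.comp hp hf.contMDiff
  locality {n p} hp x := by
    obtain ⟨u, hu, hx, h⟩ := hp x
    obtain ⟨r, hr, hru, hrx⟩ := exists_smooth_retraction hu hx
    refine ((h hru hr) x).congr_of_eventuallyEq ?_
    filter_upwards [hrx] with y hy
    rw [Function.comp_apply, hy]

/-- Every manifold carries its standard diffeology. -/
theorem isManifoldDiffeology_manifoldDiffeology (E M : Type*) [NormedAddCommGroup E]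
    [NormedSpace ℝ E] [TopologicalSpace M] [ChartedSpace E M] :
    @IsManifoldDiffeology E M _ _ _ _ (manifoldDiffeology E M) :=
  @IsManifoldDiffeology.mk E M _ _ _ _ (manifoldDiffeology E M) Iff.rfl

/-- The product diffeology. -/
instance instProdDiffeology {X Y : Type*} [DiffeologicalSpace X] [DiffeologicalSpace Y] :
    DiffeologicalSpace (X × Y) where
  plots n := {p | IsPlot (fun x => (p x).1) ∧ IsPlot (fun x => (p x).2)}
  constant_plots _ := ⟨isPlot_const, isPlot_const⟩
  plot_reparam hp hf := ⟨isPlot_reparam hp.1 hf, isPlot_reparam hp.2 hf⟩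
  locality hp := by
    refine ⟨DiffeologicalSpace.locality fun x => ?_, DiffeologicalSpace.locality fun x => ?_⟩
    · obtain ⟨u, hu, hx, h⟩ := hp x
      exact ⟨u, hu, hx, fun hf hs => (h hf hs).1⟩
    · obtain ⟨u, hu, hx, h⟩ := hp x
      exact ⟨u, hu, hx, fun hf hs => (h hf hs).2⟩

/-- The quotient diffeology along a surjection: plots are the maps that locally lift to plots. -/
@[reducible]
def quotientDiffeology {X Y : Type*} [DiffeologicalSpace X] (f : X → Y)
    (hf : Function.Surjective f) : DiffeologicalSpace Y where
  plots n := {p | ∀ x, ∃ q : Euc n → X, IsPlot q ∧ ∀ᶠ y in 𝓝 x, p y = f (q y)}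
  constant_plots y x := by
    obtain ⟨z, rfl⟩ := hf y
    exact ⟨fun _ => z, isPlot_const, Filter.Eventually.of_forall fun _ => rfl⟩
  plot_reparam {n m p g} hp hg x := by
    obtain ⟨q, hq, h⟩ := hp (g x)
    exact ⟨q ∘ g, isPlot_reparam hq hg, hg.continuous.continuousAt.eventually h⟩
  locality {n p} hp x := by
    obtain ⟨u, hu, hx, h⟩ := hp x
    obtain ⟨r, hr, hru, hrx⟩ := exists_smooth_retraction hu hx
    obtain ⟨q, hq, hqx⟩ := h hru hr x
    refine ⟨q, hq, ?_⟩
    filter_upwards [hrx, hqx] with y hy hy'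
    rw [← hy', Function.comp_apply, hy]

/-- The circle `S¹ = ℝ / 2πℤ`, with the quotient diffeology. -/
instance instAngleDiffeology : DiffeologicalSpace Real.Angle :=
  quotientDiffeology (fun t : ℝ => (t : Real.Angle)) fun θ => ⟨θ.toReal, θ.coe_toReal⟩

/-! ## Differential forms on diffeological spaces -/

/-- The `n`-dimensional plots of `X`. -/
abbrev Plot (X : Type*) [DiffeologicalSpace X] (n : ℕ) : Type _ := {p : Euc n → X // IsPlot p}

/-- The image of a plot under a smooth map. -/
def Plot.map {X Y : Type*} [DiffeologicalSpace X] [DiffeologicalSpace Y] {n : ℕ} (φ : X → Y)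
    (hφ : DSmooth φ) (p : Plot X n) : Plot Y n := ⟨φ ∘ p.1, hφ n p.1 p.2⟩

/-- A smooth reparametrisation of a plot. -/
def Plot.reparam {X : Type*} [DiffeologicalSpace X] {n m : ℕ} (p : Plot X m) (f : Euc n → Euc m)
    (hf : ContDiff ℝ ∞ f) : Plot X n := ⟨p.1 ∘ f, isPlot_reparam p.2 hf⟩

/-- A family of alternating `k`-linear maps on the domains of all plots of `X`, to be read as the
family of the pullbacks of a `k`-form to the domains of the plots; see `IsForm`. -/
abbrev FormData (X : Type*) [DiffeologicalSpace X] (V : Type*) [NormedAddCommGroup V]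
    [NormedSpace ℝ V] (k : ℕ) : Type _ :=
  ∀ n : ℕ, Plot X n → Euc n → (Euc n) [⋀^Fin k]→L[ℝ] V

section Forms

variable {X Y : Type*} [DiffeologicalSpace X] [DiffeologicalSpace Y]
  {V W : Type*} [NormedAddCommGroup V] [NormedSpace ℝ V] [NormedAddCommGroup W] [NormedSpace ℝ W]

/-- Differential `k`-forms on `X` with values in `V`: smooth forms on the domains of the plots that
are compatible with pullback along reparametrisations. -/
structure IsForm {k : ℕ} (η : FormData X V k) : Prop where
  smooth : ∀ (n : ℕ) (p : Plot X n), ContDiff ℝ ∞ (η n p)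
  reparam : ∀ (n m : ℕ) (p : Plot X m) (f : Euc n → Euc m) (hf : ContDiff ℝ ∞ f) (x : Euc n),
    η n (p.reparam f hf) x = (η m p (f x)).compContinuousLinearMap (fderiv ℝ f x)

/-- Pullback of forms along a smooth map. -/
def pullback {k : ℕ} (φ : X → Y) (hφ : DSmooth φ) (η : FormData Y V k) : FormData X V k :=
  fun n p => η n (p.map φ hφ)

/-- The exterior derivative. -/
def extd {k : ℕ} (η : FormData X V k) : FormData X V (k + 1) :=
  fun n p => extDeriv (η n p)

/-- A linear map as an alternating map of degree one. -/
def oneForm (L : V →L[ℝ] W) : V [⋀^Fin 1]→L[ℝ] W :=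
  ContinuousAlternatingMap.ofSubsingleton ℝ V W (0 : Fin 1) L

/-- The multilinear map `(vᵢⱼ) ↦ f (η₁(v₁₁, …), …, η_k(v_k1, …))`. -/
def sigmaComp {r : ℕ} (f : ContinuousMultilinearMap ℝ (fun _ : Fin r => V) W) {U : Type*}
    [NormedAddCommGroup U] [NormedSpace ℝ U] (deg : Fin r → ℕ)
    (η : ∀ i, U [⋀^Fin (deg i)]→L[ℝ] V) :
    ContinuousMultilinearMap ℝ (fun _ : (Σ i, Fin (deg i)) => U) W where
  toMultilinearMap := MultilinearMap.compMultilinearMap f.toMultilinearMap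
    (fun i => (η i).toMultilinearMap)
  cont := f.cont.comp (continuous_pi fun i =>
    (η i).cont.comp (continuous_pi fun j => continuous_apply (⟨i, j⟩ : Σ i, Fin (deg i))))

/-- The `W`-valued form `f(η₁, …, η_r) = f(η₁ ∧ ⋯ ∧ η_r)` of total degree `N` for a multilinear map
`f` and `V`-valued forms `η₁, …, η_r` of arbitrary degrees `pᵢ`. The wedge product is the usual one:
`f(η₁, …, η_r)(v₁, …, v_N)` is `1 / (p₁! ⋯ p_r!)` times the sum over all permutations `σ` of
`sign σ • f(η₁(v_σ(1), …, v_σ(p₁)), …, η_r(…, v_σ(N)))`. -/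
def wedge {r : ℕ} (f : ContinuousMultilinearMap ℝ (fun _ : Fin r => V) W)
    (η : Fin r → Σ p : ℕ, FormData X V p) (N : ℕ) (hN : ∑ i, (η i).1 = N) : FormData X W N :=
  fun n p x => (∏ i, ((η i).1.factorial : ℝ))⁻¹ •
    ContinuousMultilinearMap.alternatization
      ((sigmaComp f (fun i => (η i).1) (fun i => (η i).2 n p x)).domDomCongr
        (finSigmaFinEquiv.trans (finCongr hN)))

/-- Forgetting the last coordinate, `ℝⁿ⁺¹ → ℝⁿ`. -/
def initL (n : ℕ) : Euc (n + 1) →L[ℝ] Euc n :=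
  LinearMap.toContinuousLinearMap
    { toFun := fun y => WithLp.toLp 2 fun i => y i.castSucc
      map_add' := fun _ _ => rfl
      map_smul' := fun _ _ => rfl }

/-- The inclusion `ℝⁿ → ℝⁿ⁺¹`, `x ↦ (x, 0)`. -/
def inclL (n : ℕ) : Euc n →L[ℝ] Euc (n + 1) :=
  LinearMap.toContinuousLinearMap
    { toFun := fun x => WithLp.toLp 2 (Fin.snoc (α := fun _ => ℝ) (fun i => x i) 0)
      map_add' := fun x y => by
        ext i
        refine Fin.lastCases ?_ (fun j => ?_) i <;> simp
      map_smul' := fun c x => by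
        ext i
        refine Fin.lastCases ?_ (fun j => ?_) i <;> simp }

/-- The last basis vector of `ℝⁿ⁺¹`. -/
def lastVec (n : ℕ) : Euc (n + 1) := EuclideanSpace.single (Fin.last n) 1

/-- For a plot `p` of `X`, the plot `(x, s) ↦ (p x, s mod 2π)` of `X × S¹`. -/
def Plot.timesCircle {n : ℕ} (p : Plot X n) : Plot (X × Real.Angle) (n + 1) :=
  ⟨fun y => (p.1 (initL n y), ((y (Fin.last n) : ℝ) : Real.Angle)),
    isPlot_reparam p.2 (initL n).contDiff,
    fun _ => ⟨fun y => y (Fin.last n), ContDiff.isPlot (by fun_prop),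
      Filter.Eventually.of_forall fun _ => rfl⟩⟩

/-- Integration over the fibre `X × S¹ → X` of a `(k+1)`-form: at `v₁, …, v_k` it is the integral over
`s ∈ [0, 2π]` of `η(v₁, …, v_k, ∂_θ)`, so that `g · η_X ∧ dθ` goes to `(∫ g dθ) · η_X`. Contraction
with `∂_θ` in the last slot is `(-1)ᵏ` times contraction in the first slot. -/
def fibreInt {k : ℕ} (η : FormData (X × Real.Angle) V (k + 1)) : FormData X V k :=
  fun n p x => ∫ s in (0 : ℝ)..(2 * Real.pi), (-1 : ℝ) ^ k •
    ((η (n + 1) p.timesCircle (inclL n x + s • lastVec n)).curryLeft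
      (lastVec n)).compContinuousLinearMap (inclL n)

/-- The derivative at `t ∈ [0,1]` of a path of forms; for the path of slices of a form on
`X × [0,1]` it is the slice at `t` of its Lie derivative along `∂_t`. -/
def timeDeriv {k : ℕ} (a : ℝ → FormData X V k) (t : ℝ) : FormData X V k :=
  fun n p x => derivWithin (fun r => a r n p x) (Set.Icc 0 1) t

end Forms

/-! ## Lie groups and their loop groups -/

section Loops

variable (E : Type*) [NormedAddCommGroup E] [NormedSpace ℝ E]
  (G : Type*) [TopologicalSpace G] [ChartedSpace E G]

/-- The loop group `LG` of smooth maps `S¹ → G`. -/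
structure Loop where
  toFun : Real.Angle → G
  smooth : ContMDiff 𝓘(ℝ, ℝ) 𝓘(ℝ, E) ∞ fun s : ℝ => toFun (s : Real.Angle)

instance : CoeFun (Loop E G) fun _ => Real.Angle → G := ⟨Loop.toFun⟩

@[ext]
theorem Loop.ext {γ δ : Loop E G} (h : ∀ θ, γ θ = δ θ) : γ = δ := by
  cases γ
  cases δ
  congr
  exact funext h

end Loops

section LieGroups

variable (E : Type*) [NormedAddCommGroup E] [NormedSpace ℝ E]
  {G : Type*} [TopologicalSpace G] [ChartedSpace E G] [Group G]

/-- The adjoint action on the Lie algebra `T₁G = E`. -/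
def Ad (g : G) : E →L[ℝ] E :=
  (mfderiv 𝓘(ℝ, E) 𝓘(ℝ, E) (fun h : G => g * h * g⁻¹) 1 :)

/-- The logarithmic derivative `f⁻¹ df` at `x`, with values in the Lie algebra `T₁G = E`; it is the
pullback by `f` of the left-invariant Maurer-Cartan form. -/
def leftLogDeriv {U : Type*} [NormedAddCommGroup U] [NormedSpace ℝ U] (f : U → G) (x : U) :
    U →L[ℝ] E :=
  (mfderiv 𝓘(ℝ, U) 𝓘(ℝ, E) (fun y => (f x)⁻¹ * f y) x :)

variable (G) in
/-- The Lie bracket of `T₁G = E` as a function of two arguments. -/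
def brk (v w : E) : E :=
  Bracket.bracket (L := GroupLieAlgebra 𝓘(ℝ, E) G) (M := GroupLieAlgebra 𝓘(ℝ, E) G) v w

variable (G) in
/-- The Lie bracket of `T₁G = E` as a bilinear map. -/
def brkL [FiniteDimensional ℝ E] [LieGroup 𝓘(ℝ, E) ∞ G] : E →ₗ[ℝ] E →ₗ[ℝ] E :=
  haveI : CompleteSpace E := FiniteDimensional.complete ℝ E
  haveI : LieGroup 𝓘(ℝ, E) (minSmoothness ℝ 3) G :=
    LieGroup.of_le (n := ∞) (by
      rw [minSmoothness_of_isRCLikeNormedField]; exact ENat.LEInfty.out)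
  LinearMap.mk₂ ℝ (brk E G)
    (add_lie (L := GroupLieAlgebra 𝓘(ℝ, E) G) (M := GroupLieAlgebra 𝓘(ℝ, E) G))
    (smul_lie (R := ℝ) (L := GroupLieAlgebra 𝓘(ℝ, E) G) (M := GroupLieAlgebra 𝓘(ℝ, E) G))
    (lie_add (L := GroupLieAlgebra 𝓘(ℝ, E) G) (M := GroupLieAlgebra 𝓘(ℝ, E) G))
    (lie_smul (R := ℝ) (L := GroupLieAlgebra 𝓘(ℝ, E) G) (M := GroupLieAlgebra 𝓘(ℝ, E) G))

variable (G) in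
/-- The Lie bracket of `T₁G = E`. -/
def lieBr [FiniteDimensional ℝ E] [LieGroup 𝓘(ℝ, E) ∞ G] :
    ContinuousMultilinearMap ℝ (fun _ : Fin 2 => E) E where
  toFun v := brkL E G (v 0) (v 1)
  map_update_add' := by
    intro inst v i x y
    obtain rfl : inst = instDecidableEqFin 2 := Subsingleton.elim _ _
    fin_cases i <;> simp
  map_update_smul' := by
    intro inst v i c x
    obtain rfl : inst = instDecidableEqFin 2 := Subsingleton.elim _ _
    fin_cases i <;> simp
  cont := by
    have h : Continuous fun z : E × E => brkL E G z.1 z.2 :=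
      (brkL E G).toContinuousBilinearMap.isBoundedBilinearMap.continuous
    have h' : Continuous fun v : Fin 2 → E => (v 0, v 1) := by fun_prop
    exact h.comp h'

variable (G) in
/-- An invariant polynomial of degree `k`: a symmetric multilinear map on the Lie algebra of `G` that
is invariant under the adjoint action. -/
structure InvariantPolynomial (k : ℕ) where
  toMap : ContinuousMultilinearMap ℝ (fun _ : Fin k => E) ℝ
  symm : ∀ (σ : Equiv.Perm (Fin k)) (v : Fin k → E), toMap (v ∘ σ) = toMap v
  inv : ∀ (g : G) (v : Fin k → E), toMap (fun i => Ad E g (v i)) = toMap v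

/-- The pointwise group structure. -/
instance [LieGroup 𝓘(ℝ, E) ∞ G] : Group (Loop E G) where
  mul γ δ := ⟨fun θ => γ θ * δ θ, γ.smooth.mul δ.smooth⟩
  one := ⟨fun _ => 1, contMDiff_const⟩
  inv γ := ⟨fun θ => (γ θ)⁻¹, γ.smooth.inv⟩
  mul_assoc _ _ _ := Loop.ext E G fun _ => mul_assoc _ _ _
  one_mul _ := Loop.ext E G fun _ => one_mul _
  mul_one _ := Loop.ext E G fun _ => mul_one _
  inv_mul_cancel _ := Loop.ext E G fun _ => inv_mul_cancel _

/-- The smooth structure of the loop group: a map `c` from a cartesian space to `LG` is smooth if and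
only if `(x, θ) ↦ c(x)(θ)` is smooth. -/
instance : DiffeologicalSpace (Loop E G) where
  plots n := {c | ContMDiff 𝓘(ℝ, Euc n × ℝ) 𝓘(ℝ, E) ∞
    fun z : Euc n × ℝ => c z.1 (z.2 : Real.Angle)}
  constant_plots γ := γ.smooth.comp contDiff_snd.contMDiff
  plot_reparam {n m c f} hc hf := by
    have h : ContDiff ℝ ∞ fun z : Euc n × ℝ => (f z.1, z.2) := by fun_prop
    exact ContMDiff.comp hc h.contMDiff
  locality {n c} hc z := by
    obtain ⟨u, hu, hx, h⟩ := hc z.1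
    obtain ⟨r, hr, hru, hrx⟩ := exists_smooth_retraction hu hx
    refine ((h hru hr) z).congr_of_eventuallyEq ?_
    filter_upwards [continuous_fst.continuousAt.eventually hrx] with y hy
    rw [Function.comp_apply, hy]

end LieGroups

/-! ## Connections and Higgs fields -/

section Connections

variable (E : Type*) [NormedAddCommGroup E] [NormedSpace ℝ E]
  (G : Type*) [TopologicalSpace G] [ChartedSpace E G] [Group G]
  {X : Type*} [DiffeologicalSpace X]

/-- Families of forms on `X` indexed by the circle, to be read as forms with values in the loop
algebra `L𝔤` of smooth maps `S¹ → 𝔤`; see `IsLoopForm`. -/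
abbrev LoopFormData (X : Type*) [DiffeologicalSpace X] (k : ℕ) : Type _ :=
  Real.Angle → FormData X E k

/-- Differential forms on `X` with values in `L𝔤`: forms that depend smoothly on `θ ∈ S¹` as well,
jointly with the point. -/
structure IsLoopForm {k : ℕ} (A : LoopFormData E X k) : Prop where
  isForm : ∀ θ, IsForm (A θ)
  smooth : ∀ (n : ℕ) (p : Plot X n),
    ContDiff ℝ ∞ fun z : Euc n × ℝ => A (z.2 : Real.Angle) n p z.1

/-- `a` is a connection form for the right action `act` of `G` on `X`: a `𝔤`-valued one-form with
`R_g^* a = Ad(g⁻¹) a`, and whose pullback along each orbit map `G → X` is the Maurer-Cartan form,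
i.e. which reproduces the generators of the fundamental vector fields. -/
structure IsConnection (act : X → G → X) (a : FormData X E 1) : Prop where
  isForm : IsForm a
  equivariant : ∀ (g : G) (n : ℕ) (p p' : Plot X n), (∀ x, p'.1 x = act (p.1 x) g) →
    ∀ x, a n p' x = (Ad E g⁻¹).compContinuousAlternatingMap (a n p x)
  vertical : ∀ (y : X) (n : ℕ) (c : Euc n → G), ContMDiff 𝓘(ℝ, Euc n) 𝓘(ℝ, E) ∞ c →
    ∀ p : Plot X n, (∀ x, p.1 x = act y (c x)) → ∀ x, a n p x = oneForm (leftLogDeriv E c x)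

/-- `A` is a connection form for the right action `act` of the loop group `LG` on `X`: an `L𝔤`-valued
one-form with `R_γ^* A = Ad(γ⁻¹) A`, and whose pullback along each orbit map `LG → X` is the
Maurer-Cartan form of `LG`, which is that of `G` for each value of the loop parameter. -/
structure IsLoopConnection (act : X → Loop E G → X) (A : LoopFormData E X 1) : Prop where
  isLoopForm : IsLoopForm E A
  equivariant : ∀ (γ : Loop E G) (n : ℕ) (p p' : Plot X n), (∀ x, p'.1 x = act (p.1 x) γ) →
    ∀ θ x, A θ n p' x = (Ad E (γ θ)⁻¹).compContinuousAlternatingMap (A θ n p x)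
  vertical : ∀ (y : X) (n : ℕ) (c : Plot (Loop E G) n) (p : Plot X n),
    (∀ x, p.1 x = act y (c.1 x)) →
    ∀ θ x, A θ n p x = oneForm (leftLogDeriv E (fun z => c.1 z θ) x)

/-- `Φ` is a Higgs field for the right action `act` of `LG` on `X`: a smooth map `X → L𝔤` with
`Φ(qγ) = Ad(γ⁻¹) Φ(q) + γ⁻¹ ∂γ`. -/
structure IsHiggs (act : X → Loop E G → X) (Φ : X → Real.Angle → E) : Prop where
  smooth : ∀ (n : ℕ) (p : Plot X n),
    ContDiff ℝ ∞ fun z : Euc n × ℝ => Φ (p.1 z.1) (z.2 : Real.Angle)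
  equivariant : ∀ (q : X) (γ : Loop E G) (s : ℝ),
    Φ (act q γ) (s : Real.Angle) = Ad E (γ (s : Real.Angle))⁻¹ (Φ q (s : Real.Angle)) +
      leftLogDeriv E (fun r : ℝ => γ (r : Real.Angle)) s 1

/-- A smooth path `t ↦ a t`, `t ∈ [0,1]`, of connections, i.e. the family of slices of a connection
on `X × [0,1]` that annihilates the vectors tangent to `[0,1]`. Smoothness is that of the
coefficients, jointly in the point and in `t`, up to the boundary. -/
structure IsConnectionPath (act : X → G → X) (a : ℝ → FormData X E 1) : Prop where
  isConnection : ∀ t ∈ Set.Icc (0 : ℝ) 1, IsConnection E G act (a t)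
  smooth : ∀ (n : ℕ) (p : Plot X n),
    ContDiffOn ℝ ∞ (fun z : Euc n × ℝ => a z.2 n p z.1) {z | z.2 ∈ Set.Icc (0 : ℝ) 1}

/-- A smooth path `t ↦ A t`, `t ∈ [0,1]`, of `LG`-connections, i.e. the family of slices of an
`LG`-connection on `X × [0,1]` that annihilates the vectors tangent to `[0,1]`. -/
structure IsLoopConnectionPath (act : X → Loop E G → X) (A : ℝ → LoopFormData E X 1) : Prop where
  isLoopConnection : ∀ t ∈ Set.Icc (0 : ℝ) 1, IsLoopConnection E G act (A t)
  smooth : ∀ (n : ℕ) (p : Plot X n),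
    ContDiffOn ℝ ∞ (fun z : Euc n × ℝ × ℝ => A z.2.2 (z.2.1 : Real.Angle) n p z.1)
      {z | z.2.2 ∈ Set.Icc (0 : ℝ) 1}

/-- A smooth path `t ↦ Φ t`, `t ∈ [0,1]`, of Higgs fields, i.e. the family of slices of a Higgs field
on `X × [0,1]`. -/
structure IsHiggsPath (act : X → Loop E G → X) (Φ : ℝ → X → Real.Angle → E) : Prop where
  isHiggs : ∀ t ∈ Set.Icc (0 : ℝ) 1, IsHiggs E G act (Φ t)
  smooth : ∀ (n : ℕ) (p : Plot X n),
    ContDiffOn ℝ ∞ (fun z : Euc n × ℝ × ℝ => Φ z.2.2 (p.1 z.1) (z.2.1 : Real.Angle))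
      {z | z.2.2 ∈ Set.Icc (0 : ℝ) 1}

variable {E}

/-- A function as a form of degree zero. -/
def zeroForm (h : X → E) : FormData X E 0 :=
  fun _ p x => ContinuousAlternatingMap.constOfIsEmpty ℝ _ (Fin 0) (h (p.1 x))

/-- The derivative of an `L𝔤`-valued form in the direction of the loop parameter. -/
def loopDeriv {k : ℕ} (A : LoopFormData E X k) : LoopFormData E X k :=
  fun θ n p x => deriv (fun s : ℝ => A (θ + (s : Real.Angle)) n p x) 0

variable [FiniteDimensional ℝ E] [LieGroup 𝓘(ℝ, E) ∞ G]

/-- The bracket `[α, β]` of `𝔤`-valued forms. -/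
def bracketForm {j k : ℕ} (α : FormData X E j) (β : FormData X E k) : FormData X E (j + k) :=
  wedge (lieBr E G) ![⟨j, α⟩, ⟨k, β⟩] (j + k) (by simp)

/-- The curvature `da + ½[a, a]`. -/
def curvature (a : FormData X E 1) : FormData X E 2 :=
  extd a + (1 / 2 : ℝ) • bracketForm G a a

/-- The covariant derivative `∇Φ = dΦ + [A, Φ] - ∂A` of a Higgs field. -/
def higgsDeriv (A : LoopFormData E X 1) (Φ : X → Real.Angle → E) : LoopFormData E X 1 :=
  fun θ => (extd (zeroForm fun q => Φ q θ) : FormData X E 1) +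
    (bracketForm G (A θ) (zeroForm fun q => Φ q θ) : FormData X E 1) - loopDeriv A θ

/-- `(k-1) f(B, F, …, F, D)` with `k-2` entries `F`, for `f` of degree `k = m + 1`. It is zero when
`k = 1`. -/
def stringIntegrandAux (B : FormData X E 1) (F : FormData X E 2) (D : FormData X E 1) :
    ∀ (m : ℕ) (_ : ContinuousMultilinearMap ℝ (fun _ : Fin (m + 1) => E) ℝ), FormData X ℝ (2 * m)
  | 0, _ => 0
  | l + 1, f => ((l + 1 : ℕ) : ℝ) •
      wedge f (Fin.cons ⟨1, B⟩ (Fin.snoc (fun _ : Fin l => ⟨2, F⟩) ⟨1, D⟩)) (2 * (l + 1)) (by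
        rw [Fin.sum_univ_succ]
        simp [Fin.sum_univ_castSucc]
        ring)

/-- The relative string potential of a path of connections and Higgs fields, for an invariant
polynomial of degree `k = m + 1`: the form
`k ∫₀¹ ∫_{S¹} ((k-1) f(B_t, F_t, …, F_t, ∇Φ_t) + f(F_t, …, F_t, φ_t)) dt` of degree `2k - 2`, where
`F_t` is the curvature of `A_t` and `B_t`, `φ_t` are the time derivatives of `A_t`, `Φ_t`. -/
def stringPotential {m : ℕ} (f : InvariantPolynomial E G (m + 1)) (A : ℝ → LoopFormData E X 1)
    (Φ : ℝ → X → Real.Angle → E) : FormData X ℝ (2 * m) :=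
  fun n p x => ((m + 1 : ℕ) : ℝ) • ∫ t in (0 : ℝ)..1, ∫ s in (0 : ℝ)..(2 * Real.pi),
    (stringIntegrandAux (timeDeriv (fun r => A r (s : Real.Angle)) t)
        (curvature G (A t (s : Real.Angle))) (higgsDeriv G (A t) (Φ t) (s : Real.Angle)) m f.toMap +
      wedge f.toMap
        (Fin.snoc (fun _ : Fin m => ⟨2, curvature G (A t (s : Real.Angle))⟩)
          ⟨0, zeroForm fun q => derivWithin (fun r => Φ r q (s : Real.Angle)) (Set.Icc 0 1) t⟩)
        (2 * m) (by simp [Fin.sum_univ_castSucc]; ring)) n p x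

/-- The Chern-Weil form `f(F, …, F)` of a connection with curvature `F`, for an invariant polynomial
of degree `m + 1`. -/
def chernWeil {m : ℕ} (f : InvariantPolynomial E G (m + 1)) (a : FormData X E 1) :
    FormData X ℝ (2 * m + 1 + 1) :=
  wedge f.toMap (fun _ => ⟨2, curvature G a⟩) (2 * m + 1 + 1) (by simp; ring)

/-- The relative Chern-Simons form `k ∫₀¹ f(B_t, F_t, …, F_t) dt` of a path of connections, for an
invariant polynomial of degree `k = m + 1`, where `F_t` is the curvature and `B_t` the time
derivative of the connection. -/
def chernSimons {m : ℕ} (f : InvariantPolynomial E G (m + 1)) (a : ℝ → FormData X E 1) :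
    FormData X ℝ (2 * m + 1) :=
  fun n p x => ((m + 1 : ℕ) : ℝ) • ∫ t in (0 : ℝ)..1,
    wedge f.toMap (Fin.cons ⟨1, timeDeriv a t⟩ fun _ : Fin m => ⟨2, curvature G (a t)⟩)
      (2 * m + 1) (by simp [Fin.sum_univ_succ]; ring) n p x

end Connections

/-! ## Loop group bundles and the caloron transform -/

section Bundles

variable (E : Type*) [NormedAddCommGroup E] [NormedSpace ℝ E]
  (G : Type*) [TopologicalSpace G] [ChartedSpace E G] [Group G] [LieGroup 𝓘(ℝ, E) ∞ G]
  (Q : Type*) [DiffeologicalSpace Q] [MulAction (Loop E G)ᵐᵒᵖ Q]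

/-- Principal `LG`-bundles `Q → M`: a smooth right action of `LG` on `Q` and a smooth invariant map
`proj : Q → M` such that each point of `M` has an open neighbourhood `U` over which there is an
equivariant diffeomorphism `U × LG → proj ⁻¹ U`, `(m, γ) ↦ s(m) γ`, with inverse
`q ↦ (proj q, φ q)`. -/
structure LoopBundle (M : Type*) [TopologicalSpace M] [DiffeologicalSpace M] where
  proj : Q → M
  proj_smooth : DSmooth proj
  act_smooth : ∀ (n : ℕ) (p : Plot Q n) (c : Plot (Loop E G) n), IsPlot fun x => p.1 x <• c.1 x
  proj_act : ∀ (q : Q) (γ : Loop E G), proj (q <• γ) = proj q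
  locally_trivial : ∀ m₀ : M, ∃ U : Set M, IsOpen U ∧ m₀ ∈ U ∧
    ∃ (s : M → Q) (φ : Q → Loop E G),
      (∀ m ∈ U, proj (s m) = m) ∧
      (∀ m ∈ U, ∀ γ, φ (s m <• γ) = γ) ∧
      (∀ q, proj q ∈ U → s (proj q) <• φ q = q) ∧
      (∀ (n : ℕ) (p : Plot M n), (∀ x, p.1 x ∈ U) → IsPlot fun x => s (p.1 x)) ∧
      (∀ (n : ℕ) (p : Plot Q n), (∀ x, proj (p.1 x) ∈ U) → IsPlot fun x => φ (p.1 x))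

/-- `b = a · γ` for some `γ ∈ LG`, for the action `(q, θ, g) · γ = (qγ, θ, γ(θ)⁻¹ g)`. -/
def caloronRel (a b : Q × Real.Angle × G) : Prop :=
  ∃ γ : Loop E G, b = (a.1 <• γ, a.2.1, (γ a.2.1)⁻¹ * a.2.2)

/-- The total space `(Q × S¹ × G) / LG` of the caloron transform of `Q`. -/
def Caloron : Type _ := Quot (caloronRel E G Q)

/-- The quotient map `(q, θ, g) ↦ [q, θ, g]`. -/
def caloronMk (a : Q × Real.Angle × G) : Caloron E G Q := Quot.mk _ a

/-- The total space of the caloron transform carries the quotient smooth structure. -/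
instance [DiffeologicalSpace G] : DiffeologicalSpace (Caloron E G Q) :=
  quotientDiffeology (caloronMk E G Q) Quot.exists_rep

theorem caloronMk_smooth [DiffeologicalSpace G] : DSmooth (caloronMk E G Q) :=
  fun _ p hp _ => ⟨p, hp, Filter.Eventually.of_forall fun _ => rfl⟩

/-- The right action `[q, θ, g] · h = [q, θ, gh]` of `G` on the caloron transform. -/
def caloronAct (c : Caloron E G Q) (h : G) : Caloron E G Q :=
  Quot.map (fun a : Q × Real.Angle × G => (a.1, a.2.1, a.2.2 * h)) (by
    rintro a _ ⟨γ, rfl⟩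
    exact ⟨γ, by simp only [mul_assoc]⟩) c

variable {E G Q}

/-- The projection `[q, θ, g] ↦ (proj q, θ)` of the caloron transform to `M × S¹`. -/
def LoopBundle.caloronProj {M : Type*} [TopologicalSpace M] [DiffeologicalSpace M]
    (P : LoopBundle E G Q M) (c : Caloron E G Q) : M × Real.Angle :=
  Quot.lift (fun a : Q × Real.Angle × G => (P.proj a.1, a.2.1)) (by
    rintro a _ ⟨γ, rfl⟩
    simp only [P.proj_act]) c

/-- A map that agrees locally with plots is a plot. -/
theorem isPlot_of_eventuallyEq {X : Type*} [DiffeologicalSpace X] {n : ℕ} {p : Euc n → X}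
    (h : ∀ x, ∃ q : Euc n → X, IsPlot q ∧ ∀ᶠ y in 𝓝 x, p y = q y) : IsPlot p := by
  refine DiffeologicalSpace.locality fun x => ?_
  obtain ⟨q, hq, hqx⟩ := h x
  obtain ⟨u, hu, huo, hxu⟩ := eventually_nhds_iff.1 hqx
  refine ⟨u, huo, hxu, fun {m f} hfu hf => ?_⟩
  have : p ∘ f = q ∘ f := funext fun y => hu _ (hfu y)
  rw [this]
  exact isPlot_reparam hq hf

theorem LoopBundle.caloronProj_smooth {M : Type*} [TopologicalSpace M] [DiffeologicalSpace M]
    [DiffeologicalSpace G] (P : LoopBundle E G Q M) : DSmooth P.caloronProj := by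
  intro n p hp
  refine isPlot_of_eventuallyEq fun x => ?_
  obtain ⟨q, hq, hqx⟩ := hp x
  refine ⟨fun y => (P.proj (q y).1, (q y).2.1), ⟨P.proj_smooth n _ hq.1, hq.2.1⟩, ?_⟩
  filter_upwards [hqx] with y hy
  rw [Function.comp_apply, hy]
  rfl

/-- The pullback of the form `dθ` along a plot of the circle. -/
def dAngle {n : ℕ} (p : Euc n → Real.Angle) (x : Euc n) : Euc n →L[ℝ] ℝ :=
  fderiv ℝ (fun y => (p y - p x).toReal) x

/-- The one-form `Ad(g⁻¹)(A_q(θ) + Φ(q)(θ) dθ) + Θ_g` on `Q × S¹ × G`, where `Θ` is the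
Maurer-Cartan form. -/
def caloronForm [DiffeologicalSpace G] (A : LoopFormData E Q 1) (Φ : Q → Real.Angle → E) :
    FormData (Q × Real.Angle × G) E 1 :=
  fun n p x =>
    (Ad E (p.1 x).2.2⁻¹).compContinuousAlternatingMap
      (A (p.1 x).2.1 n ⟨fun y => (p.1 y).1, p.2.1⟩ x +
        oneForm ((dAngle (fun y => (p.1 y).2.1) x).smulRight (Φ (p.1 x).1 (p.1 x).2.1))) +
    oneForm (leftLogDeriv E (fun y => (p.1 y).2.2) x)

/-- `a` is the connection on the caloron transform determined by the connection `A` and the Higgs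
field `Φ`, i.e. the one to which `Ad(g⁻¹)(A + Φ dθ) + Θ` descends. -/
structure IsCaloronConnection [DiffeologicalSpace G] (A : LoopFormData E Q 1)
    (Φ : Q → Real.Angle → E) (a : FormData (Caloron E G Q) E 1) : Prop where
  isConnection : IsConnection E G (caloronAct E G Q) a
  pullback_eq : pullback (caloronMk E G Q) (caloronMk_smooth E G Q) a = caloronForm A Φ

variable [FiniteDimensional ℝ E]

/-- `s` is the string form of `(A, Φ)`: the integral over the fibre `M × S¹ → M` of the form on
`M × S¹` to which the Chern-Weil form of the caloron-transformed connection descends. -/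
def IsStringForm {M : Type*} [TopologicalSpace M] [DiffeologicalSpace M] [DiffeologicalSpace G]
    (P : LoopBundle E G Q M) {m : ℕ} (f : InvariantPolynomial E G (m + 1)) (A : LoopFormData E Q 1)
    (Φ : Q → Real.Angle → E) (s : FormData M ℝ (2 * m + 1)) : Prop :=
  ∃ (a : FormData (Caloron E G Q) E 1) (w : FormData (M × Real.Angle) ℝ (2 * m + 1 + 1)),
    IsCaloronConnection A Φ a ∧ IsForm w ∧
    pullback P.caloronProj P.caloronProj_smooth w = chernWeil G f a ∧ s = fibreInt w

/-- `w` is the relative Chern-Simons form, as a form on `M × S¹`, of the path of connections on the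
caloron transform determined by the path `(A, Φ)`. -/
def IsCaloronChernSimons {M : Type*} [TopologicalSpace M] [DiffeologicalSpace M]
    [DiffeologicalSpace G] (P : LoopBundle E G Q M) {m : ℕ} (f : InvariantPolynomial E G (m + 1))
    (A : ℝ → LoopFormData E Q 1) (Φ : ℝ → Q → Real.Angle → E)
    (w : FormData (M × Real.Angle) ℝ (2 * m + 1)) : Prop :=
  ∃ a : ℝ → FormData (Caloron E G Q) E 1,
    IsConnectionPath E G (caloronAct E G Q) a ∧
    (∀ t ∈ Set.Icc (0 : ℝ) 1, IsCaloronConnection (A t) (Φ t) (a t)) ∧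
    IsForm w ∧ pullback P.caloronProj P.caloronProj_smooth w = chernSimons G f a

end Bundles

end LoopBundles

end

open LoopBundles

noncomputable section

set_option linter.unusedSectionVars false

namespace LoopBundles

/-! ## Alternation of functions of several vectors -/

section Alternation

variable {U W W' : Type*} [AddCommGroup W] [Module ℝ W] [AddCommGroup W'] [Module ℝ W']

/-! Forms are handled plot by plot, so the analysis takes place on one-forms `a` on Euclidean spaces
and their curvatures `F`. Two properties of the Chern-Weil form f(F, …, F) carry the proof. It is
closed (`extd_chernWeil`): the Bianchi identity replaces dF by [F, a] in each slot, and the sum over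
the slots vanishes by the infinitesimal invariance of f. It does not change under a ↦ Ad(g⁻¹) a +
g⁻¹dg (`chernWeil_gauge`). The Lie-theoretic input is the Maurer-Cartan equation
`fderiv_leftLogDeriv_antisymm` and its consequence `fderiv_Ad_inv`, both obtained in the chart at
the unit.

A path a_t is turned into the single one-form a_χ(s) on X × ℝ, where χ is a smooth step function.
The relative Chern-Simons form is then the integral over s ∈ [0,1] of the contraction with ∂_s of
the Chern-Weil form of this one-form (`chernSimons_eq_lineInt`). Cartan's formula and the
fundamental theorem of calculus (`extDeriv_integral_contract`) give the transgression formula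
`extd_chernSimons`, and gauge invariance of Chern-Simons forms is inherited from Chern-Weil forms.
The same integral formula over the circle, where the boundary terms cancel by periodicity, shows
that integration over the fibre commutes with d (`extd_fibreInt`).

For descent, the caloron form is invariant under plots of the loop group (`caloronForm_act`) and so
defines a connection on the caloron transform. Two plots of the caloron transform over the same plot
of M × S¹ differ locally by a G-valued gauge map that is the same for all pairs (A, Φ)
(`exists_gauge`). Hence Chern-Weil and Chern-Simons forms descend to M × S¹.

The link with the string potential is a computation along the plots (q, θ, 1) of Q × S¹ × G. There
the caloron form is A + Φ dθ, its curvature is F + ∇Φ ∧ dθ and its time derivative is B + φ dθ.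
Contracting f(B, F, …, F) with ∂_θ either hits the first entry, which leaves φ, or one of the k - 1
curvatures, which leaves ∇Φ; this is the integrand of the potential
(`chernSimonsIntegrand_contract`). After exchanging the integrals, the fibre integral of the
Chern-Simons form on M × S¹ pulls back to the potential on Q, so it is the required form on M.
Uniqueness holds because plots of M lift locally to Q (`pullback_injective`), and its differential
comes from transgression. -/

/-- The signed sum of a function of `N` vectors over all permutations of its arguments. -/
def altF {N : ℕ} (T : (Fin N → U) → W) (x : Fin N → U) : W :=
  ∑ σ : Equiv.Perm (Fin N), Equiv.Perm.sign σ • T (x ∘ σ)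

theorem altF_add {N : ℕ} (S T : (Fin N → U) → W) (x : Fin N → U) :
    altF (fun y => S y + T y) x = altF S x + altF T x := by
  simp [altF, smul_add, Finset.sum_add_distrib]

theorem altF_smul {N : ℕ} (c : ℝ) (T : (Fin N → U) → W) (x : Fin N → U) :
    altF (fun y => c • T y) x = c • altF T x := by
  simp only [altF, Finset.smul_sum]
  exact Finset.sum_congr rfl fun σ _ => smul_comm _ _ _

theorem altF_sum {N : ℕ} {ι : Type*} (s : Finset ι) (T : ι → (Fin N → U) → W) (x : Fin N → U) :
    altF (fun y => ∑ i ∈ s, T i y) x = ∑ i ∈ s, altF (T i) x := by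
  simp only [altF, Finset.smul_sum]
  exact Finset.sum_comm

theorem altF_zero {N : ℕ} (x : Fin N → U) : altF (fun _ : Fin N → U => (0 : W)) x = 0 := by
  simp [altF]

theorem altF_comp_perm {N : ℕ} (T : (Fin N → U) → W) (ρ : Equiv.Perm (Fin N)) (x : Fin N → U) :
    altF (fun y => T (y ∘ ρ)) x = Equiv.Perm.sign ρ • altF T x := by
  simp only [altF, Finset.smul_sum, smul_smul]
  refine Fintype.sum_equiv (Equiv.mulRight ρ) _ _ fun σ => ?_
  simp only [Equiv.coe_mulRight, Equiv.Perm.sign_mul, Equiv.Perm.coe_mul]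
  rw [mul_comm (Equiv.Perm.sign σ), ← mul_assoc, Int.units_mul_self, one_mul]
  rfl

/-- The part of `altF T x` in which `x 0` occupies the slot `p`. -/
def altPart {N : ℕ} (T : (Fin (N + 1) → U) → W) (p : Fin (N + 1)) (x : Fin (N + 1) → U) : W :=
  ∑ σ : Equiv.Perm (Fin (N + 1)), if σ p = 0 then Equiv.Perm.sign σ • T (x ∘ σ) else 0

theorem altF_eq_sum_altPart {N : ℕ} (T : (Fin (N + 1) → U) → W) (x : Fin (N + 1) → U) :
    altF T x = ∑ p, altPart T p x := by
  simp only [altF, altPart]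
  rw [Finset.sum_comm]
  refine Finset.sum_congr rfl fun σ _ => ?_
  rw [Finset.sum_eq_single (σ⁻¹ 0)]
  · simp
  · intro b _ hb
    rw [if_neg]
    rintro h
    exact hb (by rw [← h]; simp)
  · simp

/-- Substituting σρ⁻¹ for σ moves the marked slot from p to ρ p. -/
theorem altPart_comp_perm {N : ℕ} (T : (Fin (N + 1) → U) → W) (ρ : Equiv.Perm (Fin (N + 1)))
    (p : Fin (N + 1)) (x : Fin (N + 1) → U) :
    altPart T p x = Equiv.Perm.sign ρ • altPart (fun y => T (y ∘ ρ)) (ρ p) x := by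
  simp only [altPart, Finset.smul_sum]
  refine Fintype.sum_equiv (Equiv.mulRight ρ⁻¹) _ _ fun σ => ?_
  have h1 : (σ * ρ⁻¹) (ρ p) = σ p := by simp
  have h2 : (x ∘ ⇑(σ * ρ⁻¹)) ∘ ⇑ρ = x ∘ σ := by
    ext i
    simp
  have h3 : Equiv.Perm.sign ρ * Equiv.Perm.sign (σ * ρ⁻¹) = Equiv.Perm.sign σ := by
    rw [Equiv.Perm.sign_mul, Equiv.Perm.sign_inv, mul_comm (Equiv.Perm.sign σ), ← mul_assoc,
      Int.units_mul_self, one_mul]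
  rw [Equiv.coe_mulRight, h1, h2, smul_ite, smul_zero, smul_smul, h3]

/-- Contraction with a vector is a sum over the slots that the vector can occupy. A symmetry of T
makes these contributions coincide, so that one slot and a count suffice. -/
theorem altPart_eq_of_invariant {N : ℕ} {T : (Fin (N + 1) → U) → W} {ρ : Equiv.Perm (Fin (N + 1))}
    (h : ∀ y, T (y ∘ ρ) = Equiv.Perm.sign ρ • T y) (p : Fin (N + 1)) (x : Fin (N + 1) → U) :
    altPart T p x = altPart T (ρ p) x := by
  rw [altPart_comp_perm T ρ]
  simp only [h]
  simp only [altPart, Finset.smul_sum]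
  refine Finset.sum_congr rfl fun σ _ => ?_
  rw [smul_ite, smul_zero]
  congr 1
  rw [smul_comm (Equiv.Perm.sign σ), smul_smul (Equiv.Perm.sign ρ), Int.units_mul_self, one_smul]

/-- Permutations that fix 0 are the permutations of the remaining indices, with the same sign. -/
theorem altPart_zero_cons {N : ℕ} (T : (Fin (N + 1) → U) → W) (e : U) (v : Fin N → U) :
    altPart T 0 (Fin.cons e v : Fin (N + 1) → U) =
      altF (fun y => T (Fin.cons e y : Fin (N + 1) → U)) v := by
  simp only [altPart, altF]
  rw [← Equiv.sum_comp Equiv.Perm.decomposeFin.symm, Fintype.sum_prod_type,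
    Finset.sum_eq_single 0]
  · refine Finset.sum_congr rfl fun σ _ => ?_
    rw [Equiv.Perm.decomposeFin_symm_apply_zero, if_pos rfl, Equiv.Perm.decomposeFin.symm_sign,
      if_pos rfl, one_mul]
    congr 2
    ext i
    refine Fin.cases ?_ (fun j => ?_) i
    · simp
    · simp
  · intro p _ hp
    refine Finset.sum_eq_zero fun σ _ => ?_
    rw [Equiv.Perm.decomposeFin_symm_apply_zero, if_neg hp]
  · simp

/-- The cyclic rotation carries the last slot to the front at the cost of its sign (-1)ᴺ. -/
theorem altPart_last_cons {N : ℕ} (T : (Fin (N + 1) → U) → W) (e : U) (v : Fin N → U) :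
    altPart T (Fin.last N) (Fin.cons e v : Fin (N + 1) → U) =
      (-1 : ℤˣ) ^ N • altF (fun y => T (Fin.snoc y e : Fin (N + 1) → U)) v := by
  rw [altPart_comp_perm T (finRotate (N + 1)), finRotate_last, altPart_zero_cons, sign_finRotate]
  congr 2
  ext y
  congr 1
  ext i
  refine Fin.lastCases ?_ (fun j => ?_) i
  · simp
  · rw [Function.comp_apply, finRotate_of_lt (by simp), Fin.snoc_castSucc]
    exact Fin.cons_succ (α := fun _ => U) e y j

/-- Permutations are sorted by the vector that they put into slot 0; the cycle bringing index p to
the front has sign (-1)ᵖ. The right-hand side has the shape of the formula for `extDeriv`. -/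
theorem altF_eq_sum_removeNth {N : ℕ} (S : (Fin (N + 1) → U) → W) (v : Fin (N + 1) → U) :
    altF S v = ∑ p : Fin (N + 1), (-1 : ℤˣ) ^ (p : ℕ) •
      altF (fun y => S (Fin.cons (v p) y : Fin (N + 1) → U)) (p.removeNth v) := by
  have key : ∀ p : Fin (N + 1),
      (-1 : ℤˣ) ^ (p : ℕ) • altF (fun y => S (Fin.cons (v p) y : Fin (N + 1) → U)) (p.removeNth v) =
      ∑ σ : Equiv.Perm (Fin (N + 1)),
        if σ 0 = p then Equiv.Perm.sign σ • S (v ∘ σ) else 0 := by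
    intro p
    rw [← altPart_zero_cons, Fin.cons_removeNth_eq_comp_cycleRange_symm, altPart, Finset.smul_sum]
    refine Fintype.sum_equiv (Equiv.mulLeft p.cycleRange⁻¹) _ _ fun σ => ?_
    rw [Equiv.coe_mulLeft, Equiv.Perm.sign_mul, Equiv.Perm.sign_inv, Fin.sign_cycleRange,
      smul_ite, smul_zero, smul_smul]
    have h : (p.cycleRange⁻¹ * σ) 0 = p ↔ σ 0 = 0 := by
      rw [Equiv.Perm.mul_apply, Equiv.Perm.inv_eq_iff_eq, Fin.cycleRange_self]
    simp only [h]
    rfl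
  rw [Finset.sum_congr rfl fun p _ => key p, Finset.sum_comm]
  simp [altF]

end Alternation

/-! ## Pairs of slots -/

section Pairs

variable {U V W : Type*} [AddCommGroup V] [AddCommGroup W]

/-- The slots `2 i` and `2 i + 1`. -/
def pairIdx (m : ℕ) : Fin m × Fin 2 ≃ Fin (2 * m) :=
  finProdFinEquiv.trans (finCongr (mul_comm m 2))

@[simp]
theorem pairIdx_val {m : ℕ} (i : Fin m) (j : Fin 2) : (pairIdx m (i, j) : ℕ) = j + 2 * i := rfl

/-- The values of a function of two vectors at consecutive pairs of vectors. -/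
def pairs {m : ℕ} (F : U → U → V) (y : Fin (2 * m) → U) : Fin m → V :=
  fun i => F (y (pairIdx m (i, 0))) (y (pairIdx m (i, 1)))

/-- Exchanging two pairs of slots. -/
theorem exists_perm_pairs_swap {m : ℕ} (i i' : Fin m) :
    ∃ π : Equiv.Perm (Fin (2 * m)), Equiv.Perm.sign π = 1 ∧
      ∀ k j, π (pairIdx m (k, j)) = pairIdx m (Equiv.swap i i' k, j) := by
  refine ⟨(pairIdx m).permCongr (Equiv.prodCongrLeft fun _ => Equiv.swap i i'), ?_, ?_⟩
  · rw [Equiv.Perm.sign_permCongr, Equiv.Perm.sign_prodCongrLeft, Fin.prod_univ_two,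
      Int.units_mul_self]
  · intro k j
    simp [Equiv.permCongr_apply]

/-- Exchanging the two slots of a pair. -/
theorem exists_perm_pairs_flip {m : ℕ} (i : Fin m) :
    ∃ π : Equiv.Perm (Fin (2 * m)), Equiv.Perm.sign π = -1 ∧
      π (pairIdx m (i, 0)) = pairIdx m (i, 1) ∧ π (pairIdx m (i, 1)) = pairIdx m (i, 0) ∧
      ∀ k j, k ≠ i → π (pairIdx m (k, j)) = pairIdx m (k, j) := by
  refine ⟨Equiv.swap (pairIdx m (i, 0)) (pairIdx m (i, 1)), ?_, ?_, ?_, ?_⟩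
  · rw [Equiv.Perm.sign_swap]
    simp
  · simp
  · simp
  · intro k j hk
    rw [Equiv.swap_apply_of_ne_of_ne] <;> simp [hk]

/-- A symmetric function, odd in each variable, of the values of an alternating function of two
vectors at pairs of slots is invariant up to sign under permutations that are transitive. -/
theorem exists_perm_pairs {m : ℕ} {F : U → U → V} (hF : ∀ v w, F w v = -F v w)
    {g : (Fin m → V) → W} (hg : ∀ (σ : Equiv.Perm (Fin m)) v, g (v ∘ σ) = g v)
    (hg' : ∀ (v : Fin m → V) i, g (Function.update v i (-v i)) = -g v) (p q : Fin (2 * m)) :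
    ∃ π : Equiv.Perm (Fin (2 * m)), π p = q ∧
      ∀ z, g (pairs F (z ∘ π)) = Equiv.Perm.sign π • g (pairs F z) := by
  obtain ⟨⟨i, a⟩, rfl⟩ := (pairIdx m).surjective p
  obtain ⟨⟨i', b⟩, rfl⟩ := (pairIdx m).surjective q
  obtain ⟨π, hπ, h⟩ := exists_perm_pairs_swap i i'
  have hπz : ∀ z : Fin (2 * m) → U, pairs F (z ∘ π) = pairs F z ∘ Equiv.swap i i' := by
    intro z
    ext k
    simp [pairs, h]
  by_cases hab : a = b
  · subst hab
    refine ⟨π, by rw [h, Equiv.swap_apply_left], fun z => ?_⟩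
    rw [hπz, hg, hπ, one_smul]
  · obtain ⟨ρ, hρ, h0, h1, h2⟩ := exists_perm_pairs_flip i'
    -- When p and q sit in different positions of their pairs, the pair of p is first moved to the
    -- pair of q and the latter is then flipped.
    refine ⟨ρ * π, ?_, fun z => ?_⟩
    · rw [Equiv.Perm.mul_apply, h, Equiv.swap_apply_left]
      fin_cases a <;> fin_cases b <;> simp_all
    · have hz : pairs F (z ∘ ρ) = Function.update (pairs F z) i' (-pairs F z i') := by
        ext k
        by_cases hk : k = i'
        · subst hk
          simp [pairs, h0, h1, hF (z (pairIdx m (k, 0)))]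
        · simp [pairs, hk, h2]
      rw [Equiv.Perm.coe_mul, ← Function.comp_assoc, hπz, hg, hz, hg', Equiv.Perm.sign_mul, hπ, hρ]
      simp

end Pairs

section PairContraction

variable {U V W : Type*} [NormedAddCommGroup V] [NormedSpace ℝ V] [NormedAddCommGroup W]
  [NormedSpace ℝ W]

/-- The contraction of `f(B, F, …, F)` with a vector, before normalisation. -/
theorem altF_cons_pairs_contract {m : ℕ} (f : ContinuousMultilinearMap ℝ (fun _ : Fin (m + 1) => V) W)
    (hf : ∀ (σ : Equiv.Perm (Fin (m + 1))) v, f (v ∘ σ) = f v) (B : U → V) {F : U → U → V}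
    (hF : ∀ v w, F w v = -F v w) (e : U) (v : Fin (2 * m) → U) :
    altF (fun y : Fin (2 * m + 1) → U =>
        f (Fin.cons (B (y 0)) (pairs F (Fin.tail y)) : Fin (m + 1) → V))
      (Fin.cons e v : Fin (2 * m + 1) → U) =
    altF (fun y => f (Fin.cons (B e) (pairs F y) : Fin (m + 1) → V)) v +
      (2 * m : ℝ) • altF (fun y : Fin (2 * m) → U =>
        f (Fin.cons (B ((Fin.snoc y e : Fin (2 * m + 1) → U) 0))
          (pairs F (Fin.tail (Fin.snoc y e : Fin (2 * m + 1) → U))) : Fin (m + 1) → V)) v := by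
  rw [altF_eq_sum_altPart, Fin.sum_univ_succ, altPart_zero_cons]
  congr 1
  -- Without pairs there is nothing to contract, and the coefficient 2m vanishes.
  rcases m with _ | m
  · simp
  have hg : ∀ (b : V) (σ : Equiv.Perm (Fin (m + 1))) (v : Fin (m + 1) → V),
      f (Fin.cons b (v ∘ σ) : Fin (m + 1 + 1) → V) = f (Fin.cons b v : Fin (m + 1 + 1) → V) := by
    intro b σ v
    rw [← hf (Equiv.Perm.decomposeFin.symm (0, σ)) (Fin.cons b v : Fin (m + 1 + 1) → V)]
    congr 1
    ext i
    refine Fin.cases ?_ (fun j => ?_) i <;> simp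
  have hg' : ∀ (b : V) (v : Fin (m + 1) → V) (i : Fin (m + 1)),
      f (Fin.cons b (Function.update v i (-v i)) : Fin (m + 1 + 1) → V) =
        -f (Fin.cons b v : Fin (m + 1 + 1) → V) := by
    intro b v i
    have := f.map_update_smul (Fin.cons b v : Fin (m + 1 + 1) → V) i.succ (-1) (v i)
    rw [neg_one_smul, neg_one_smul, ← Fin.cons_update, ← Fin.cons_update,
      Function.update_eq_self] at this
    exact this
  -- Each slot belonging to a pair contributes as much as the last slot does.
  have key : ∀ p : Fin (2 * (m + 1)), altPart (fun y : Fin (2 * (m + 1) + 1) → U =>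
        f (Fin.cons (B (y 0)) (pairs F (Fin.tail y)) : Fin (m + 1 + 1) → V)) p.succ
      (Fin.cons e v : Fin (2 * (m + 1) + 1) → U) = altPart (fun y : Fin (2 * (m + 1) + 1) → U =>
        f (Fin.cons (B (y 0)) (pairs F (Fin.tail y)) : Fin (m + 1 + 1) → V))
        (Fin.last (2 * (m + 1))) (Fin.cons e v : Fin (2 * (m + 1) + 1) → U) := by
    intro p
    have hq : ∃ π : Equiv.Perm (Fin (2 * (m + 1))), (π p).succ = Fin.last (2 * (m + 1)) ∧
        ∀ (b : V) z, f (Fin.cons b (pairs F (z ∘ π)) : Fin (m + 1 + 1) → V) =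
          Equiv.Perm.sign π • f (Fin.cons b (pairs F z) : Fin (m + 1 + 1) → V) := by
      -- The values are taken in functions of b, so that one permutation serves for every first
      -- entry of f.
      obtain ⟨π, h1, h2⟩ := exists_perm_pairs hF
        (g := fun v (b : V) => f (Fin.cons b v : Fin (m + 1 + 1) → V))
        (fun σ v => funext fun b => hg b σ v) (fun v i => funext fun b => hg' b v i) p
        (Fin.last (2 * m + 1))
      exact ⟨π, by rw [h1]; rfl, fun b z => congrFun (h2 z) b⟩
    obtain ⟨π, h1, h2⟩ := hq
    have hρ : ∀ y : Fin (2 * (m + 1) + 1) → U,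
        Fin.tail (y ∘ ⇑(Equiv.Perm.decomposeFin.symm ((0 : Fin (2 * (m + 1) + 1)), π))) =
          Fin.tail y ∘ π := by
      intro y
      ext i
      simp [Fin.tail]
    rw [altPart_eq_of_invariant (ρ := Equiv.Perm.decomposeFin.symm (0, π))]
    · rw [Equiv.Perm.decomposeFin_symm_apply_succ, Equiv.swap_self, Equiv.refl_apply, h1]
    · intro y
      simp only [hρ, h2, Equiv.Perm.decomposeFin.symm_sign, Function.comp_apply,
        Equiv.Perm.decomposeFin_symm_apply_zero, if_pos, one_mul]
  rw [Finset.sum_congr rfl fun p _ => key p, Finset.sum_const, Finset.card_univ, Fintype.card_fin,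
    altPart_last_cons, (even_two_mul (m + 1)).neg_one_pow, one_smul, ← Nat.cast_smul_eq_nsmul ℝ]
  push_cast
  rfl

end PairContraction

/-! ## Wedge products as alternations -/

section WedgeApply

variable {X : Type*} [DiffeologicalSpace X]
  {V W : Type*} [NormedAddCommGroup V] [NormedSpace ℝ V] [NormedAddCommGroup W] [NormedSpace ℝ W]

theorem wedge_apply {r : ℕ} (f : ContinuousMultilinearMap ℝ (fun _ : Fin r => V) W)
    (η : Fin r → Σ p : ℕ, FormData X V p) (N : ℕ) (hN : ∑ i, (η i).1 = N) (n : ℕ) (p : Plot X n)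
    (x : Euc n) (v : Fin N → Euc n) :
    wedge f η N hN n p x v = (∏ i, ((η i).1.factorial : ℝ))⁻¹ •
      altF (fun y => f fun i => (η i).2 n p x fun j => y (finCongr hN (finSigmaFinEquiv ⟨i, j⟩))) v := by
  rw [wedge, ContinuousAlternatingMap.smul_apply,
    ContinuousMultilinearMap.alternatization_apply_apply]
  rfl

/-- The degree is part of `s`, so replacing `s` also changes the index type of the arguments; the
cast records this. -/
theorem sigma_form_apply {s : Σ p : ℕ, FormData X V p} {d : ℕ} {α : FormData X V d}
    (h : s = ⟨d, α⟩) {n : ℕ} (p : Plot X n) (x : Euc n) (z : Fin s.1 → Euc n) :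
    s.2 n p x z = α n p x fun j => z (Fin.cast (by rw [h]) j) := by
  subst h
  rfl

/-- The i-th form occupies consecutive slots, starting at the sum of the degrees before it. Listing
them as `z` removes the dependent index type from all the explicit wedge formulas. -/
theorem wedge_slot {r : ℕ} {η : Fin r → Σ p : ℕ, FormData X V p} {N : ℕ}
    (hN : ∑ i, (η i).1 = N) {n : ℕ} (p : Plot X n) (x : Euc n) (y : Fin N → Euc n) (i : Fin r)
    {d : ℕ} {α : FormData X V d} (h : η i = ⟨d, α⟩) {z : Fin d → Fin N}
    (hz : ∀ j, (z j : ℕ) = ∑ k : Fin i, (η (Fin.castLE i.2.le k)).1 + j) :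
    ((η i).2 n p x fun j => y (finCongr hN (finSigmaFinEquiv ⟨i, j⟩))) = α n p x fun j => y (z j) := by
  rw [sigma_form_apply h]
  congr 1
  ext1 j
  congr 1
  ext
  rw [hz, finCongr_apply, Fin.val_cast, finSigmaFinEquiv_apply]
  rfl

/-- The values of a two-form as a function of two vectors. -/
def two (F : FormData X V 2) {n : ℕ} (p : Plot X n) (x : Euc n) (v w : Euc n) : V :=
  F n p x ![v, w]

/-- The values of a one-form as a function of a vector. -/
def one (B : FormData X V 1) {n : ℕ} (p : Plot X n) (x : Euc n) (v : Euc n) : V :=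
  B n p x fun _ => v

theorem two_swap (F : FormData X V 2) {n : ℕ} (p : Plot X n) (x : Euc n) (v w : Euc n) :
    two F p x w v = -two F p x v w := by
  have h := (F n p x).toAlternatingMap.map_swap ![v, w] (i := 0) (j := 1) (by simp)
  have h' : (![v, w] ∘ ⇑(Equiv.swap (0 : Fin 2) 1)) = ![w, v] := by
    ext1 i
    fin_cases i <;> simp
  rw [h'] at h
  exact h

theorem wedge_pow_apply {m : ℕ} (f : ContinuousMultilinearMap ℝ (fun _ : Fin (m + 1) => V) W)
    (F : FormData X V 2) (hN) {n : ℕ} (p : Plot X n) (x : Euc n) (v : Fin (2 * (m + 1)) → Euc n) :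
    wedge f (fun _ => ⟨2, F⟩) (2 * m + 1 + 1) hN n p x v =
      ((2 : ℝ) ^ (m + 1))⁻¹ • altF (fun y : Fin (2 * (m + 1)) → Euc n =>
        f (pairs (two F p x) y)) v := by
  rw [wedge_apply]
  congr 1
  · simp
  · congr 1
    ext1 y
    congr 1
    ext1 i
    rw [wedge_slot (η := fun _ : Fin (m + 1) => ⟨2, F⟩) hN p x y i rfl
      (z := fun j => pairIdx (m + 1) (i, j)) (by intro j; simp; ring)]
    unfold pairs two
    congr 1
    ext1 j
    fin_cases j <;> rfl

theorem wedge_cons_apply {m : ℕ} (f : ContinuousMultilinearMap ℝ (fun _ : Fin (m + 1) => V) W)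
    (B : FormData X V 1) (F : FormData X V 2) (hN) {n : ℕ} (p : Plot X n) (x : Euc n)
    (v : Fin (2 * m + 1) → Euc n) :
    wedge f (Fin.cons ⟨1, B⟩ fun _ : Fin m => ⟨2, F⟩) (2 * m + 1) hN n p x v =
      ((2 : ℝ) ^ m)⁻¹ • altF (fun y : Fin (2 * m + 1) → Euc n =>
        f (Fin.cons (one B p x (y 0)) (pairs (two F p x) (Fin.tail y)) : Fin (m + 1) → V)) v := by
  rw [wedge_apply]
  congr 1
  · simp [Fin.prod_univ_succ]
  · congr 1
    ext1 y
    congr 1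
    ext1 i
    refine Fin.cases ?_ (fun k => ?_) i
    · rw [wedge_slot hN p x y 0 (d := 1) (α := B) rfl
        (z := fun j => 0) (by
          intro j
          rw [Finset.sum_eq_zero fun a _ => (Nat.not_lt_zero _ a.2).elim]
          simp)]
      rfl
    · rw [wedge_slot hN p x y k.succ (d := 2) (α := F) rfl
        (z := fun j => (pairIdx m (k, j)).succ) ?_]
      · simp only [Fin.cons_succ, pairs, two]
        congr 1
        ext1 j
        fin_cases j <;> rfl
      · intro j
        have : ∀ a : Fin k, (Fin.castLE k.succ.2.le a.succ : Fin (m + 1)) =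
            (Fin.castLE k.2.le a).succ := fun a => rfl
        simp only [Fin.val_succ, pairIdx_val]
        rw [Fin.sum_univ_succ (n := (k : ℕ))]
        simp only [this, Fin.cons_succ]
        simp
        ring

theorem wedge_snoc_zero_apply {m : ℕ} (f : ContinuousMultilinearMap ℝ (fun _ : Fin (m + 1) => V) W)
    (F : FormData X V 2) (φ : FormData X V 0) (hN) {n : ℕ} (p : Plot X n) (x : Euc n)
    (v : Fin (2 * m) → Euc n) :
    wedge f (Fin.snoc (fun _ : Fin m => ⟨2, F⟩) ⟨0, φ⟩) (2 * m) hN n p x v =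
      ((2 : ℝ) ^ m)⁻¹ • altF (fun y : Fin (2 * m) → Euc n =>
        f (Fin.snoc (pairs (two F p x) y) (φ n p x Fin.elim0) : Fin (m + 1) → V)) v := by
  rw [wedge_apply]
  congr 1
  · simp [Fin.prod_univ_castSucc]
  · congr 1
    ext1 y
    congr 1
    ext1 i
    refine Fin.lastCases ?_ (fun k => ?_) i
    · rw [wedge_slot hN p x y (Fin.last m) (d := 0) (α := φ) (by simp)
        (z := Fin.elim0) (by intro j; exact j.elim0)]
      rw [Fin.snoc_last]
      congr 1
      ext1 j
      exact j.elim0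
    · rw [wedge_slot hN p x y k.castSucc (d := 2) (α := F) (by simp)
        (z := fun j => (pairIdx m (k, j))) ?_]
      · simp only [Fin.snoc_castSucc, pairs, two]
        congr 1
        ext1 j
        fin_cases j <;> rfl
      · intro j
        have : ∀ a : Fin k, (Fin.castLE k.castSucc.2.le a : Fin (m + 1)) =
            (Fin.castLE k.2.le a).castSucc := fun a => rfl
        simp only [Fin.val_castSucc, pairIdx_val, this, Fin.snoc_castSucc]
        simp
        ring

theorem wedge_cons_snoc_apply {l : ℕ}
    (f : ContinuousMultilinearMap ℝ (fun _ : Fin (l + 1 + 1) => V) W)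
    (B : FormData X V 1) (F : FormData X V 2) (D : FormData X V 1) (hN) {n : ℕ} (p : Plot X n)
    (x : Euc n) (v : Fin (2 * (l + 1)) → Euc n) :
    wedge f (Fin.cons ⟨1, B⟩ (Fin.snoc (fun _ : Fin l => ⟨2, F⟩) ⟨1, D⟩)) (2 * (l + 1)) hN n p x v =
      ((2 : ℝ) ^ l)⁻¹ • altF (fun y : Fin (2 * l + 1 + 1) → Euc n =>
        f (Fin.cons (one B p x (y 0)) (Fin.snoc (pairs (two F p x) (Fin.init (Fin.tail y)))
          (one D p x (y (Fin.last _))) : Fin (l + 1) → V) : Fin (l + 1 + 1) → V)) v := by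
  rw [wedge_apply]
  congr 1
  · rw [Fin.prod_univ_succ]
    simp [Fin.prod_univ_castSucc]
  · congr 1
    ext1 y
    congr 1
    ext1 i
    refine Fin.cases ?_ (fun k => ?_) i
    · rw [wedge_slot hN p x y 0 (d := 1) (α := B) rfl
        (z := fun j => 0) (by
          intro j
          rw [Finset.sum_eq_zero fun a _ => (Nat.not_lt_zero _ a.2).elim]
          simp)]
      rfl
    · have : ∀ (k : Fin (l + 1)) (a : Fin k), (Fin.castLE k.succ.2.le a.succ : Fin (l + 1 + 1)) =
            (Fin.castLE k.2.le a).succ := fun _ a => rfl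
      refine Fin.lastCases ?_ (fun k => ?_) k
      · rw [wedge_slot hN p x y (Fin.last l).succ (d := 1) (α := D) (by simp)
          (z := fun j => Fin.last (2 * l + 1)) ?_]
        · rw [Fin.cons_succ, Fin.snoc_last]
          rfl
        · intro j
          -- One slot for B and two for each of the l curvatures precede D, which therefore sits at
          -- position 2l + 1.
          refine Eq.trans ?_ (congrArg (· + (j : ℕ)) (Fin.sum_univ_succ (n := l) _).symm)
          refine Eq.trans ?_ (congrArg (fun s => 1 + s + (j : ℕ))
            (Finset.sum_congr (s₂ := Finset.univ) rfl fun a _ => congrArg Sigma.fst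
            (Fin.snoc_castSucc (α := fun _ => Σ p : ℕ, FormData X V p) ⟨1, D⟩ (fun _ => ⟨2, F⟩) a)).symm)
          simp
          ring
      · rw [wedge_slot hN p x y k.castSucc.succ (d := 2) (α := F) (by simp)
          (z := fun j => (pairIdx l (k, j)).castSucc.succ) ?_]
        · simp only [Fin.cons_succ, Fin.snoc_castSucc, pairs, two]
          congr 1
          ext1 j
          fin_cases j <;> rfl
        · intro j
          refine Eq.trans ?_ (congrArg (· + (j : ℕ)) (Fin.sum_univ_succ (n := (k : ℕ)) _).symm)
          refine Eq.trans ?_ (congrArg (fun s => 1 + s + (j : ℕ))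
            (Finset.sum_congr (s₂ := Finset.univ) rfl fun a _ => congrArg Sigma.fst
            (Fin.snoc_castSucc (α := fun _ => Σ p : ℕ, FormData X V p) ⟨1, D⟩ (fun _ => ⟨2, F⟩)
              (Fin.castLE k.2.le a))).symm)
          simp
          ring

end WedgeApply

/-! ### Logarithmic derivatives and the adjoint action. -/

section LieGroupCalculus

variable {E : Type*} [NormedAddCommGroup E] [NormedSpace ℝ E]
  {G : Type*} [TopologicalSpace G] [ChartedSpace E G] [Group G] [LieGroup 𝓘(ℝ, E) ∞ G]
  {U : Type*} [NormedAddCommGroup U] [NormedSpace ℝ U]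

variable (E G) in
/-- The chart at the unit element. -/
abbrev unitChart : PartialEquiv G E := extChartAt 𝓘(ℝ, E) (1 : G)

variable (E G) in
/-- The coordinates of the unit element. -/
abbrev unitPt : E := unitChart E G 1

/-- The derivative of a map between manifolds, in the preferred charts. -/
def mfd (E₁ E₂ : Type*) {M₁ M₂ : Type*} [NormedAddCommGroup E₁] [NormedSpace ℝ E₁] [NormedAddCommGroup E₂]
    [NormedSpace ℝ E₂] [TopologicalSpace M₁] [ChartedSpace E₁ M₁] [TopologicalSpace M₂]
    [ChartedSpace E₂ M₂] (f : M₁ → M₂) (x : M₁) : E₁ →L[ℝ] E₂ :=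
  (mfderiv 𝓘(ℝ, E₁) 𝓘(ℝ, E₂) f x :)

theorem leftLogDeriv_eq_mfd (f : U → G) (x : U) :
    leftLogDeriv E f x = mfd U E (fun y => (f x)⁻¹ * f y) x := rfl

theorem Ad_eq_mfd (g : G) : Ad E g = mfd E E (fun h : G => g * h * g⁻¹) 1 := rfl

section Mfd

variable {E₁ E₂ E₃ M₁ M₂ M₃ : Type*} [NormedAddCommGroup E₁] [NormedSpace ℝ E₁]
  [NormedAddCommGroup E₂] [NormedSpace ℝ E₂] [NormedAddCommGroup E₃] [NormedSpace ℝ E₃]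
  [TopologicalSpace M₁] [ChartedSpace E₁ M₁] [TopologicalSpace M₂] [ChartedSpace E₂ M₂]
  [TopologicalSpace M₃] [ChartedSpace E₃ M₃]

theorem mfd_congr {f g : M₁ → M₂} {x : M₁} (h : f =ᶠ[𝓝 x] g) : mfd E₁ E₂ f x = mfd E₁ E₂ g x := by
  have h1 := h.self_of_nhds
  simp only [mfd]
  exact Filter.EventuallyEq.mfderiv_eq h

theorem mfd_comp {f : M₁ → M₂} {g : M₂ → M₃} {x : M₁} {y : M₂} (h : f x = y)
    (hg : MDifferentiableAt 𝓘(ℝ, E₂) 𝓘(ℝ, E₃) g y) (hf : MDifferentiableAt 𝓘(ℝ, E₁) 𝓘(ℝ, E₂) f x) :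
    mfd E₁ E₃ (fun z => g (f z)) x = (mfd E₂ E₃ g y).comp (mfd E₁ E₂ f x) := by
  subst h
  exact mfderiv_comp x hg hf

theorem mfd_const (c : M₂) (x : M₁) : mfd E₁ E₂ (fun _ : M₁ => c) x = 0 := mfderiv_const

theorem mfd_id (x : M₁) : mfd E₁ E₁ (fun y : M₁ => y) x = ContinuousLinearMap.id ℝ E₁ := mfderiv_id

theorem mfd_eq_fderiv (f : E₁ → E₂) (x : E₁) : mfd E₁ E₂ f x = fderiv ℝ f x := mfderiv_eq_fderiv

end Mfd

/-- The tangent space at the unit is identified with E by the preferred chart there, so at points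
mapped to 1 the manifold derivative is the ordinary derivative of the coordinates. -/
theorem mfd_eq_fderiv_unitChart {g : U → G} {x : U}
    (hg : MDifferentiableAt 𝓘(ℝ, U) 𝓘(ℝ, E) g x) (h : g x = 1) :
    mfd U E g x = fderiv ℝ (fun y => unitChart E G (g y)) x := by
  simp only [mfd, mfderiv, hg, writtenInExtChartAt, h]
  simp only [modelWithCornersSelf_coe, Set.range_id, fderivWithin_univ, extChartAt_model_space_eq_id]
  rfl

theorem contMDiffAt_unitChart : ContMDiffAt 𝓘(ℝ, E) 𝓘(ℝ, E) ∞ (unitChart E G) (1 : G) :=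
  contMDiffAt_extChartAt

theorem contMDiffAt_unitChart_symm :
    ContMDiffAt 𝓘(ℝ, E) 𝓘(ℝ, E) ∞ (unitChart E G).symm (unitPt E G) :=
  (contMDiffOn_extChartAt_symm (1 : G)).contMDiffAt (extChartAt_target_mem_nhds (1 : G))

theorem unitChart_symm_unitPt : (unitChart E G).symm (unitPt E G) = 1 :=
  extChartAt_to_inv (I := 𝓘(ℝ, E)) (1 : G)

theorem eventually_unitChart_symm_unitChart :
    ∀ᶠ g in 𝓝 (1 : G), (unitChart E G).symm (unitChart E G g) = g := by
  filter_upwards [extChartAt_source_mem_nhds (I := 𝓘(ℝ, E)) (1 : G)] with g hg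
  exact (unitChart E G).left_inv hg

theorem eventually_unitChart_unitChart_symm :
    ∀ᶠ z in 𝓝 (unitPt E G), unitChart E G ((unitChart E G).symm z) = z := by
  filter_upwards [extChartAt_target_mem_nhds (I := 𝓘(ℝ, E)) (1 : G)] with z hz
  exact (unitChart E G).right_inv hz

theorem leftLogDeriv_const_mul (c : G) (f : U → G) (x : U) :
    leftLogDeriv E (fun y => c * f y) x = leftLogDeriv E f x := by
  simp only [leftLogDeriv_eq_mfd, mul_inv_rev, mul_assoc, inv_mul_cancel_left]

theorem leftLogDeriv_const (c : G) (x : U) : leftLogDeriv E (fun _ : U => c) x = 0 :=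
  mfd_const _ _

theorem leftLogDeriv_congr {f g : U → G} {x : U} (h : f =ᶠ[𝓝 x] g) :
    leftLogDeriv E f x = leftLogDeriv E g x := by
  simp only [leftLogDeriv_eq_mfd, h.self_of_nhds]
  refine mfd_congr ?_
  filter_upwards [h] with y hy using by rw [hy]

theorem leftLogDeriv_eq_fderiv {f : U → G} {x : U}
    (hf : MDifferentiableAt 𝓘(ℝ, U) 𝓘(ℝ, E) f x) :
    leftLogDeriv E f x = fderiv ℝ (fun y => unitChart E G ((f x)⁻¹ * f y)) x := by
  have h : MDifferentiableAt 𝓘(ℝ, U) 𝓘(ℝ, E) (fun y => (f x)⁻¹ * f y) x :=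
    ((contMDiff_mul_left (I := 𝓘(ℝ, E)) (n := ∞) (a := (f x)⁻¹)).mdifferentiable
      (by simp) (f x)).comp x hf
  exact mfd_eq_fderiv_unitChart h (inv_mul_cancel _)

theorem leftLogDeriv_comp {U' : Type*} [NormedAddCommGroup U'] [NormedSpace ℝ U'] {f : U → G}
    {h : U' → U} {x : U'} (hf : MDifferentiableAt 𝓘(ℝ, U) 𝓘(ℝ, E) f (h x))
    (hh : DifferentiableAt ℝ h x) :
    leftLogDeriv E (fun y => f (h y)) x = (leftLogDeriv E f (h x)).comp (fderiv ℝ h x) := by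
  have h' : MDifferentiableAt 𝓘(ℝ, U) 𝓘(ℝ, E) (fun y => (f (h x))⁻¹ * f y) (h x) :=
    ((contMDiff_mul_left (I := 𝓘(ℝ, E)) (n := ∞) (a := (f (h x))⁻¹)).mdifferentiable
      (by simp) (f (h x))).comp (h x) hf
  rw [leftLogDeriv_eq_mfd, leftLogDeriv_eq_mfd, ← mfd_eq_fderiv]
  exact mfd_comp rfl h' hh.mdifferentiableAt

/-- The logarithmic derivative of a smooth map is smooth. -/
theorem contDiffAt_leftLogDeriv {f : U → G} {x : U} (hf : ContMDiffAt 𝓘(ℝ, U) 𝓘(ℝ, E) ∞ f x) :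
    ContDiffAt ℝ ∞ (leftLogDeriv E f) x := by
  -- The logarithmic derivative is the partial derivative in the second variable, on the diagonal,
  -- of the coordinates of f(z₁)⁻¹ f(z₂), which are jointly smooth near the diagonal point.
  have h1 : ContMDiffAt (𝓘(ℝ, U).prod 𝓘(ℝ, U)) 𝓘(ℝ, E) ∞
      (fun z : U × U => unitChart E G ((f z.1)⁻¹ * f z.2)) (x, x) := by
    have h2 : ContMDiffAt (𝓘(ℝ, U).prod 𝓘(ℝ, U)) 𝓘(ℝ, E) ∞
        (fun z : U × U => (f z.1)⁻¹ * f z.2) (x, x) :=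
      (ContMDiffAt.comp (x, x) hf contMDiffAt_fst).inv.mul
        (ContMDiffAt.comp (x, x) hf contMDiffAt_snd)
    refine ContMDiffAt.comp_of_eq contMDiffAt_unitChart h2 (inv_mul_cancel _)
  rw [← modelWithCornersSelf_prod, chartedSpaceSelf_prod, contMDiffAt_iff_contDiffAt] at h1
  have h3 := ContDiffAt.fderiv (m := ∞) (f := fun x y => unitChart E G ((f x)⁻¹ * f y)) (g := id)
    h1 contDiffAt_id (by simp)
  refine h3.congr_of_eventuallyEq ?_
  have h4 : ∀ᶠ y in 𝓝 x, ContMDiffAt 𝓘(ℝ, U) 𝓘(ℝ, E) 1 f y :=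
    contMDiffAt_iff_contMDiffAt_nhds (by simp) |>.1 (hf.of_le (by exact_mod_cast le_top))
  filter_upwards [h4] with y hy
  exact leftLogDeriv_eq_fderiv (hy.mdifferentiableAt (by simp))

theorem contDiff_leftLogDeriv {f : U → G} (hf : ContMDiff 𝓘(ℝ, U) 𝓘(ℝ, E) ∞ f) :
    ContDiff ℝ ∞ (leftLogDeriv E f) :=
  contDiff_iff_contDiffAt.2 fun x => contDiffAt_leftLogDeriv (hf x)

/-- Multiplication has the sum as its derivative at (1, 1), both partial maps being the identity
there. -/
theorem mfd_mul_of_eq_one {f g : U → G} {x : U}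
    (hf : MDifferentiableAt 𝓘(ℝ, U) 𝓘(ℝ, E) f x) (hg : MDifferentiableAt 𝓘(ℝ, U) 𝓘(ℝ, E) g x)
    (h1 : f x = 1) (h2 : g x = 1) :
    mfd U E (fun y => f y * g y) x = mfd U E f x + mfd U E g x := by
  have hm : MDifferentiableAt (𝓘(ℝ, E).prod 𝓘(ℝ, E)) 𝓘(ℝ, E) (fun p : G × G => p.1 * p.2)
      (f x, g x) := (contMDiff_mul 𝓘(ℝ, E) ∞).mdifferentiable (by simp) _
  have h3 : mfd U E (fun y => f y * g y) x = (mfderiv (𝓘(ℝ, E).prod 𝓘(ℝ, E)) 𝓘(ℝ, E)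
      (fun p : G × G => p.1 * p.2) (f x, g x) : E × E →L[ℝ] E).comp
      ((mfd U E f x).prod (mfd U E g x)) := by
    rw [← show mfderiv 𝓘(ℝ, U) (𝓘(ℝ, E).prod 𝓘(ℝ, E)) (fun y => (f y, g y)) x =
      (mfd U E f x).prod (mfd U E g x) from hf.mfderiv_prod hg]
    exact mfderiv_comp x hm (hf.prodMk hg)
  rw [h3]
  ext v
  refine (mfderiv_prod_eq_add_apply (v := (mfd U E f x v, mfd U E g x v)) hm).trans ?_
  change mfd E E (fun z : G => z * g x) (f x) (mfd U E f x v) +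
    mfd E E (fun z : G => f x * z) (g x) (mfd U E g x v) = _
  simp only [h1, h2, mul_one, one_mul, mfd_id]
  rfl

theorem contMDiff_conj (g : G) : ContMDiff 𝓘(ℝ, E) 𝓘(ℝ, E) ∞ fun h : G => g * h * g⁻¹ :=
  (contMDiff_const.mul contMDiff_id).mul contMDiff_const

theorem Ad_one : Ad E (1 : G) = ContinuousLinearMap.id ℝ E := by
  rw [Ad_eq_mfd]
  simp only [one_mul, inv_one, mul_one]
  exact mfd_id _

theorem Ad_mul (g h : G) : Ad E (g * h) = (Ad E g).comp (Ad E h) := by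
  have := mfd_comp (f := fun k : G => h * k * h⁻¹) (g := fun k : G => g * k * g⁻¹) (x := 1) (y := 1)
    (by simp) ((contMDiff_conj (E := E) g).mdifferentiable (by simp) _)
    ((contMDiff_conj (E := E) h).mdifferentiable (by simp) _)
  rw [Ad_eq_mfd, Ad_eq_mfd, Ad_eq_mfd, ← this]
  congr 1
  ext k
  simp only [mul_inv_rev, mul_assoc]

/-- The quotient (f(x)g(x))⁻¹ f(y)g(y) is the conjugate of f(x)⁻¹f(y) by g(x)⁻¹ times g(x)⁻¹g(y), a
product of two maps with value 1 at y = x. -/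
theorem leftLogDeriv_mul {f g : U → G} {x : U}
    (hf : MDifferentiableAt 𝓘(ℝ, U) 𝓘(ℝ, E) f x) (hg : MDifferentiableAt 𝓘(ℝ, U) 𝓘(ℝ, E) g x) :
    leftLogDeriv E (fun y => f y * g y) x =
      (Ad E (g x)⁻¹).comp (leftLogDeriv E f x) + leftLogDeriv E g x := by
  have hl : ∀ {h : U → G}, MDifferentiableAt 𝓘(ℝ, U) 𝓘(ℝ, E) h x →
      MDifferentiableAt 𝓘(ℝ, U) 𝓘(ℝ, E) (fun y => (h x)⁻¹ * h y) x := fun {h} hh =>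
    ((contMDiff_mul_left (I := 𝓘(ℝ, E)) (n := ∞) (a := (h x)⁻¹)).mdifferentiable
      (by simp) (h x)).comp x hh
  rw [leftLogDeriv_eq_mfd, leftLogDeriv_eq_mfd, leftLogDeriv_eq_mfd, Ad_eq_mfd,
    ← mfd_comp (f := fun y => (f x)⁻¹ * f y) (g := fun h : G => (g x)⁻¹ * h * (g x)⁻¹⁻¹)
      (inv_mul_cancel (f x)) ((contMDiff_conj (g x)⁻¹).mdifferentiable (by simp) _) (hl hf),
    ← mfd_mul_of_eq_one _ (hl hg) (by simp) (by simp)]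
  · congr 1
    ext y
    simp only [mul_inv_rev, mul_assoc, inv_inv, mul_inv_cancel_left]
  · exact ((contMDiff_conj (g x)⁻¹).mdifferentiable (by simp) _).comp x (hl hf)

end LieGroupCalculus

/-! ### The Maurer-Cartan equation. -/

section MaurerCartan

variable {E : Type*} [NormedAddCommGroup E] [NormedSpace ℝ E]
  {G : Type*} [TopologicalSpace G] [ChartedSpace E G] [Group G] [LieGroup 𝓘(ℝ, E) ∞ G]
  {U : Type*} [NormedAddCommGroup U] [NormedSpace ℝ U]

variable (E G) in
/-- The derivative at the unit of left translation, in the chart at the unit. -/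
def translD (z : E) : E →L[ℝ] E :=
  fderiv ℝ (fun w => unitChart E G ((unitChart E G).symm z * (unitChart E G).symm w)) (unitPt E G)

theorem contDiffAt_unitChart_mul :
    ContDiffAt ℝ ∞ (fun p : E × E =>
      unitChart E G ((unitChart E G).symm p.1 * (unitChart E G).symm p.2))
      (unitPt E G, unitPt E G) := by
  have h2 : ContMDiffAt (𝓘(ℝ, E).prod 𝓘(ℝ, E)) 𝓘(ℝ, E) ∞
      (fun p : E × E => (unitChart E G).symm p.1 * (unitChart E G).symm p.2)
      (unitPt E G, unitPt E G) :=
    (ContMDiffAt.comp (unitPt E G, unitPt E G) contMDiffAt_unitChart_symm contMDiffAt_fst).mul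
      (ContMDiffAt.comp (unitPt E G, unitPt E G) contMDiffAt_unitChart_symm contMDiffAt_snd)
  have h1 := ContMDiffAt.comp_of_eq contMDiffAt_unitChart h2
    (by simp only [unitChart_symm_unitPt, mul_one])
  rwa [← modelWithCornersSelf_prod, chartedSpaceSelf_prod, contMDiffAt_iff_contDiffAt] at h1

theorem contDiffAt_translD : ContDiffAt ℝ ∞ (translD E G) (unitPt E G) :=
  ContDiffAt.fderiv (m := ∞) (n := ∞) (f := fun z w =>
    unitChart E G ((unitChart E G).symm z * (unitChart E G).symm w)) (g := fun _ => unitPt E G)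
    contDiffAt_unitChart_mul contDiffAt_const (by simp)

theorem translD_unitPt : translD E G (unitPt E G) = ContinuousLinearMap.id ℝ E := by
  rw [translD, unitChart_symm_unitPt]
  simp only [one_mul]
  have : (fun w => unitChart E G ((unitChart E G).symm w)) =ᶠ[𝓝 (unitPt E G)] fun w => w :=
    eventually_unitChart_unitChart_symm
  rw [this.fderiv_eq, fderiv_fun_id]

theorem eventually_differentiableAt_unitChart_mul :
    ∀ᶠ z in 𝓝 (unitPt E G), DifferentiableAt ℝ
      (fun w => unitChart E G ((unitChart E G).symm z * (unitChart E G).symm w)) (unitPt E G) := by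
  have h1 : ∀ᶠ p in 𝓝 (unitPt E G, unitPt E G), ContDiffAt ℝ 1 (fun p : E × E =>
      unitChart E G ((unitChart E G).symm p.1 * (unitChart E G).symm p.2)) p :=
    (contDiffAt_unitChart_mul.of_le (by exact_mod_cast le_top)).eventually (by simp)
  have h2 : Filter.Tendsto (fun z : E => (z, unitPt E G)) (𝓝 (unitPt E G))
      (𝓝 (unitPt E G, unitPt E G)) := by
    rw [nhds_prod_eq]
    exact Filter.tendsto_id.prodMk tendsto_const_nhds
  filter_upwards [h2.eventually h1] with z hz
  have h3 : DifferentiableAt ℝ (fun w : E => (z, w)) (unitPt E G) := by fun_prop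
  exact (hz.differentiableAt (by simp)).comp (unitPt E G) h3

/-- Writing g(y) = g(x) · g(x)⁻¹g(y) and differentiating at y = x separates the derivative of left
translation from the logarithmic derivative. Differentiating this identity once more gives the
Maurer-Cartan equation. -/
theorem eventually_fderiv_unitChart {g : U → G} {x₀ : U}
    (hg : ContMDiffAt 𝓘(ℝ, U) 𝓘(ℝ, E) ∞ g x₀) (h : g x₀ = 1) :
    ∀ᶠ x in 𝓝 x₀, fderiv ℝ (fun y => unitChart E G (g y)) x =
      (translD E G (unitChart E G (g x))).comp (leftLogDeriv E g x) := by
  have h4 : ∀ᶠ y in 𝓝 x₀, ContMDiffAt 𝓘(ℝ, U) 𝓘(ℝ, E) 1 g y :=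
    contMDiffAt_iff_contMDiffAt_nhds (by simp) |>.1 (hg.of_le (by exact_mod_cast le_top))
  have hc : Filter.Tendsto g (𝓝 x₀) (𝓝 1) := by
    have := hg.continuousAt.tendsto
    rwa [h] at this
  have hc' : Filter.Tendsto (fun x => unitChart E G (g x)) (𝓝 x₀) (𝓝 (unitPt E G)) :=
    (contMDiffAt_unitChart (E := E) (G := G)).continuousAt.tendsto.comp hc
  filter_upwards [h4, hc.eventually (eventually_unitChart_symm_unitChart (E := E)),
    hc'.eventually eventually_differentiableAt_unitChart_mul] with x hx h5 h6
  have h7 : ContMDiffAt 𝓘(ℝ, U) 𝓘(ℝ, E) 1 (fun y => (g x)⁻¹ * g y) x :=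
    (contMDiffAt_const (c := (g x)⁻¹)).mul hx
  have h8 : DifferentiableAt ℝ (fun y => unitChart E G ((g x)⁻¹ * g y)) x :=
    (contMDiffAt_iff_contDiffAt.1 (ContMDiffAt.comp_of_eq
      (contMDiffAt_unitChart.of_le (by exact_mod_cast le_top)) h7
      (inv_mul_cancel (g x)))).differentiableAt (by simp)
  have h9 : (fun y => unitChart E G (g y)) =ᶠ[𝓝 x] fun y => unitChart E G
      ((unitChart E G).symm (unitChart E G (g x)) *
        (unitChart E G).symm (unitChart E G ((g x)⁻¹ * g y))) := by
    have h10 : Filter.Tendsto (fun y => (g x)⁻¹ * g y) (𝓝 x) (𝓝 1) := by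
      have := h7.continuousAt.tendsto
      rwa [inv_mul_cancel] at this
    filter_upwards [h10.eventually (eventually_unitChart_symm_unitChart (E := E))] with y hy
    rw [h5, hy, mul_inv_cancel_left]
  have h11 : unitPt E G = unitChart E G ((g x)⁻¹ * g x) := by rw [inv_mul_cancel]
  rw [h9.fderiv_eq, leftLogDeriv_eq_fderiv (hx.mdifferentiableAt (by simp)), translD]
  rw [h11] at h6 ⊢
  exact fderiv_fun_comp x h6 h8

/-- The Maurer-Cartan equation in the chart at the unit. -/
theorem fderiv_leftLogDeriv_antisymm_of_eq_one {g : U → G} {x : U}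
    (hg : ContMDiffAt 𝓘(ℝ, U) 𝓘(ℝ, E) ∞ g x) (h : g x = 1) (v w : U) :
    fderiv ℝ (leftLogDeriv E g) x v w - fderiv ℝ (leftLogDeriv E g) x w v =
      fderiv ℝ (translD E G) (unitPt E G) (leftLogDeriv E g x w) (leftLogDeriv E g x v) -
      fderiv ℝ (translD E G) (unitPt E G) (leftLogDeriv E g x v) (leftLogDeriv E g x w) := by
  have hu : ContDiffAt ℝ ∞ (fun y => unitChart E G (g y)) x :=
    contMDiffAt_iff_contDiffAt.1 (ContMDiffAt.comp_of_eq contMDiffAt_unitChart hg h)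
  have hx : unitChart E G (g x) = unitPt E G := by rw [h]
  have hL : DifferentiableAt ℝ (fun y => translD E G (unitChart E G (g y))) x := by
    have := contDiffAt_translD (E := E) (G := G)
    rw [← hx] at this
    exact (this.comp x hu).differentiableAt (by simp)
  have hθ : DifferentiableAt ℝ (leftLogDeriv E g) x :=
    (contDiffAt_leftLogDeriv hg).differentiableAt (by simp)
  have h1 := Filter.EventuallyEq.fderiv_eq (𝕜 := ℝ) (eventually_fderiv_unitChart hg h)
  have h0 := (eventually_fderiv_unitChart hg h).self_of_nhds
  -- The equation is the symmetry of the second derivative of the coordinates of g, once their first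
  -- derivative is factored as `translD` composed with the logarithmic derivative.
  have hsymm : fderiv ℝ (fderiv ℝ (fun y => unitChart E G (g y))) x v w =
      fderiv ℝ (fderiv ℝ (fun y => unitChart E G (g y))) x w v :=
    (hu.isSymmSndFDerivAt (by
      rw [minSmoothness_of_isRCLikeNormedField]; exact ENat.LEInfty.out)).eq v w
  rw [h1] at hsymm
  rw [hx, translD_unitPt, ContinuousLinearMap.id_comp] at h0
  have hchain : fderiv ℝ (fun y => translD E G (unitChart E G (g y))) x =
      (fderiv ℝ (translD E G) (unitPt E G)).comp (leftLogDeriv E g x) := by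
    rw [← h0, ← hx]
    exact fderiv_fun_comp x (by rw [hx]; exact contDiffAt_translD.differentiableAt (by simp))
      (hu.differentiableAt (by simp))
  rw [fderiv_clm_comp hL hθ, hchain, hx, translD_unitPt] at hsymm
  simp only [add_apply, ContinuousLinearMap.comp_apply,
    ContinuousLinearMap.compL_apply, ContinuousLinearMap.flip_apply,
    ContinuousLinearMap.id_comp] at hsymm
  rw [sub_eq_sub_iff_add_eq_add]
  exact hsymm.trans (add_comm _ _)

theorem mfd_unitChart_one : mfd E E (unitChart E G) 1 = ContinuousLinearMap.id ℝ E := by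
  have hd : MDifferentiableAt 𝓘(ℝ, E) 𝓘(ℝ, E) (unitChart E G) 1 :=
    contMDiffAt_unitChart.mdifferentiableAt (by simp)
  have h2 : mfd E E (unitChart E G) 1 =
      fderiv ℝ (fun z => unitChart E G ((unitChart E G).symm z)) (unitPt E G) := by
    simp only [mfd, mfderiv, hd, writtenInExtChartAt]
    simp only [modelWithCornersSelf_coe, Set.range_id, fderivWithin_univ,
      extChartAt_model_space_eq_id]
    rfl
  have : (fun w => unitChart E G ((unitChart E G).symm w)) =ᶠ[𝓝 (unitPt E G)] fun w => w :=
    eventually_unitChart_unitChart_symm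
  rw [h2, this.fderiv_eq, fderiv_fun_id]

theorem mfd_unitChart_symm : mfd E E (unitChart E G).symm (unitPt E G) =
    ContinuousLinearMap.id ℝ E := by
  rw [mfd_eq_fderiv_unitChart (contMDiffAt_unitChart_symm.mdifferentiableAt (by simp))
    unitChart_symm_unitPt]
  have : (fun w => unitChart E G ((unitChart E G).symm w)) =ᶠ[𝓝 (unitPt E G)] fun w => w :=
    eventually_unitChart_unitChart_symm
  rw [this.fderiv_eq, fderiv_fun_id]

variable (E G) in
/-- A left-invariant vector field in the chart at the unit. -/
def chartField (v z : E) : E :=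
  (mfderivWithin 𝓘(ℝ, E) 𝓘(ℝ, E) (unitChart E G).symm (Set.range 𝓘(ℝ, E)) z : E →L[ℝ] E).inverse
    (mfd E E (fun h : G => (unitChart E G).symm z * h) 1 v)

/-- The derivative of the inverse chart at z turns both sides into the derivative of left
translation by the point with coordinates z, and it is invertible. -/
theorem chartField_eventuallyEq (v : E) :
    chartField E G v =ᶠ[𝓝 (unitPt E G)] fun z => translD E G z v := by
  filter_upwards [eventually_differentiableAt_unitChart_mul (E := E) (G := G),
    extChartAt_target_mem_nhds (I := 𝓘(ℝ, E)) (1 : G)] with z hz hz'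
  have hsz : ContMDiffAt 𝓘(ℝ, E) 𝓘(ℝ, E) ∞ (unitChart E G).symm z :=
    (contMDiffOn_extChartAt_symm (1 : G)).contMDiffAt
      ((isOpen_extChartAt_target (1 : G)).mem_nhds hz')
  have hA : (mfderivWithin 𝓘(ℝ, E) 𝓘(ℝ, E) (unitChart E G).symm (Set.range 𝓘(ℝ, E)) z : E →L[ℝ] E)
      = mfd E E (unitChart E G).symm z := by
    rw [modelWithCornersSelf_coe, Set.range_id, mfderivWithin_univ]
    rfl
  have hinv : (mfderivWithin 𝓘(ℝ, E) 𝓘(ℝ, E) (unitChart E G).symm (Set.range 𝓘(ℝ, E)) z :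
      E →L[ℝ] E).IsInvertible := isInvertible_mfderivWithin_extChartAt_symm hz'
  have hmul : MDifferentiableAt 𝓘(ℝ, E) 𝓘(ℝ, E) (fun h : G => (unitChart E G).symm z * h) 1 :=
    (contMDiff_mul_left (I := 𝓘(ℝ, E)) (n := ∞)).mdifferentiable (by simp) _
  have h1 : (mfd E E (unitChart E G).symm z).comp (translD E G z) =
      mfd E E (fun h : G => (unitChart E G).symm z * h) 1 := by
    have hz1 : unitChart E G ((unitChart E G).symm z * (unitChart E G).symm (unitPt E G)) = z := by
      rw [unitChart_symm_unitPt, mul_one]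
      exact (unitChart E G).right_inv hz'
    have h2 : (fun w => (unitChart E G).symm (unitChart E G
        ((unitChart E G).symm z * (unitChart E G).symm w))) =ᶠ[𝓝 (unitPt E G)]
        fun w => (unitChart E G).symm z * (unitChart E G).symm w := by
      have h3 : Filter.Tendsto (fun w => (unitChart E G).symm z * (unitChart E G).symm w)
          (𝓝 (unitPt E G)) (𝓝 ((unitChart E G).symm z)) := by
        have h4 := (contMDiffAt_unitChart_symm (E := E) (G := G)).continuousAt.tendsto
        rw [unitChart_symm_unitPt] at h4
        have h5 := hmul.continuousAt.tendsto.comp h4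
        rw [mul_one] at h5
        exact h5
      filter_upwards [h3.eventually ((isOpen_extChartAt_source (I := 𝓘(ℝ, E)) (1 : G)).mem_nhds
        ((unitChart E G).map_target hz'))] with w hw
      exact (unitChart E G).left_inv hw
    rw [translD, ← mfd_eq_fderiv, ← mfd_comp (x := unitPt E G) (y := z)
      (f := fun w => unitChart E G ((unitChart E G).symm z * (unitChart E G).symm w))
      (g := (unitChart E G).symm) hz1 (hsz.mdifferentiableAt (by simp)) hz.mdifferentiableAt]
    rw [mfd_congr h2, mfd_comp unitChart_symm_unitPt hmul
      (contMDiffAt_unitChart_symm.mdifferentiableAt (by simp)), mfd_unitChart_symm,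
      ContinuousLinearMap.comp_id]
  rw [chartField, ← h1, ← hA]
  exact hinv.inverse_apply_self _

/-- The bracket is by definition that of left-invariant vector fields at the unit, computed in the
chart at the unit, whose derivative there is the identity. -/
theorem brk_eq_chartField (v w : E) :
    brk E G v w = VectorField.lieBracket ℝ (chartField E G v) (chartField E G w)
      (unitPt E G) := by
  have h : brk E G v w = (mfd E E (unitChart E G) 1).inverse (VectorField.lieBracketWithin ℝ
      (chartField E G v) (chartField E G w)
      ((unitChart E G).symm ⁻¹' Set.univ ∩ Set.range 𝓘(ℝ, E)) (unitPt E G)) := rfl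
  rw [h, mfd_unitChart_one, ContinuousLinearMap.inverse_id, modelWithCornersSelf_coe, Set.range_id,
    Set.preimage_univ, Set.univ_inter, VectorField.lieBracketWithin_univ]
  rfl

/-- This matches the abstract bracket with the antisymmetrised derivative of `translD` that appears
in the Maurer-Cartan computation. -/
theorem brk_eq_translD (v w : E) :
    brk E G v w = fderiv ℝ (translD E G) (unitPt E G) v w -
      fderiv ℝ (translD E G) (unitPt E G) w v := by
  have hd : ∀ v u : E, fderiv ℝ (fun z => translD E G z v) (unitPt E G) u =
      fderiv ℝ (translD E G) (unitPt E G) u v := by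
    intro v u
    rw [fderiv_clm_apply (contDiffAt_translD.differentiableAt (by simp))
      (differentiableAt_const v)]
    simp
  rw [brk_eq_chartField, VectorField.lieBracket_eq]
  beta_reduce
  rw [(chartField_eventuallyEq v).fderiv_eq,
    (chartField_eventuallyEq w).fderiv_eq, (chartField_eventuallyEq v).self_of_nhds,
    (chartField_eventuallyEq w).self_of_nhds, hd, hd]
  beta_reduce
  rw [translD_unitPt]
  rfl

/-- The Maurer-Cartan equation. -/
theorem fderiv_leftLogDeriv_antisymm {g : U → G} {x : U}
    (hg : ContMDiffAt 𝓘(ℝ, U) 𝓘(ℝ, E) ∞ g x) (v w : U) :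
    fderiv ℝ (leftLogDeriv E g) x v w - fderiv ℝ (leftLogDeriv E g) x w v =
      -brk E G (leftLogDeriv E g x v) (leftLogDeriv E g x w) := by
  -- Left translation by g(x)⁻¹ moves the value to the unit and leaves the logarithmic derivative
  -- unchanged.
  have h1 : ContMDiffAt 𝓘(ℝ, U) 𝓘(ℝ, E) ∞ (fun y => (g x)⁻¹ * g y) x :=
    (contMDiffAt_const (c := (g x)⁻¹)).mul hg
  have h2 : leftLogDeriv E (fun y => (g x)⁻¹ * g y) = leftLogDeriv E g :=
    funext fun y => leftLogDeriv_const_mul _ _ _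
  have := fderiv_leftLogDeriv_antisymm_of_eq_one h1 (inv_mul_cancel _) v w
  rw [h2] at this
  rw [this, brk_eq_translD, neg_sub]

end MaurerCartan

/-! ### Smoothness and derivative of the adjoint action. -/

section Adjoint

variable {E : Type*} [NormedAddCommGroup E] [NormedSpace ℝ E]
  {G : Type*} [TopologicalSpace G] [ChartedSpace E G] [Group G] [LieGroup 𝓘(ℝ, E) ∞ G]
  {U : Type*} [NormedAddCommGroup U] [NormedSpace ℝ U]

theorem leftLogDeriv_unitChart_symm :
    leftLogDeriv E (unitChart E G).symm (unitPt E G) = ContinuousLinearMap.id ℝ E := by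
  rw [leftLogDeriv_eq_mfd, unitChart_symm_unitPt]
  simp only [inv_one, one_mul]
  exact mfd_unitChart_symm

variable (E) in
/-- The family `(z, y) ↦ σ(z) g(y)` for the inverse `σ` of the chart at the unit. -/
def chartMul (g : U → G) (p : E × U) : G := (unitChart E G).symm p.1 * g p.2

theorem contMDiffAt_chartMul {g : U → G} {x : U} (hg : ContMDiffAt 𝓘(ℝ, U) 𝓘(ℝ, E) ∞ g x) :
    ContMDiffAt 𝓘(ℝ, E × U) 𝓘(ℝ, E) ∞ (chartMul E g) (unitPt E G, x) :=
  (ContMDiffAt.comp (I' := 𝓘(ℝ, E)) (unitPt E G, x) contMDiffAt_unitChart_symm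
    contDiffAt_fst.contMDiffAt).mul
    (ContMDiffAt.comp (I' := 𝓘(ℝ, U)) (unitPt E G, x) hg contDiffAt_snd.contMDiffAt)

theorem eventually_leftLogDeriv_chartMul {g : U → G} {x : U}
    (hg : ContMDiffAt 𝓘(ℝ, U) 𝓘(ℝ, E) ∞ g x) :
    ∀ᶠ p in 𝓝 (unitPt E G, x), leftLogDeriv E (chartMul E g) p =
      (Ad E (g p.2)⁻¹).comp ((leftLogDeriv E (unitChart E G).symm p.1).comp
        (ContinuousLinearMap.fst ℝ E U)) +
      (leftLogDeriv E g p.2).comp (ContinuousLinearMap.snd ℝ E U) := by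
  have h1 : ∀ᶠ p in 𝓝 (unitPt E G, x), ContMDiffAt 𝓘(ℝ, E) 𝓘(ℝ, E) 1 (unitChart E G).symm p.1 :=
    continuousAt_fst.eventually (contMDiffAt_iff_contMDiffAt_nhds (by simp) |>.1
      (contMDiffAt_unitChart_symm.of_le (by exact_mod_cast le_top)))
  have h2 : ∀ᶠ p in 𝓝 (unitPt E G, x), ContMDiffAt 𝓘(ℝ, U) 𝓘(ℝ, E) 1 g p.2 :=
    continuousAt_snd.eventually (contMDiffAt_iff_contMDiffAt_nhds (by simp) |>.1
      (hg.of_le (by exact_mod_cast le_top)))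
  filter_upwards [h1, h2] with p hp1 hp2
  have h3 := leftLogDeriv_mul (E := E) (x := p)
    (f := fun p : E × U => (unitChart E G).symm p.1) (g := fun p : E × U => g p.2)
    ((ContMDiffAt.comp (I' := 𝓘(ℝ, E)) p hp1
      contDiffAt_fst.contMDiffAt).mdifferentiableAt (by simp))
    ((ContMDiffAt.comp (I' := 𝓘(ℝ, U)) p hp2
      contDiffAt_snd.contMDiffAt).mdifferentiableAt (by simp))
  have h4 := leftLogDeriv_comp (E := E) (x := p) (h := Prod.fst) (f := (unitChart E G).symm)
    (hp1.mdifferentiableAt (by simp)) differentiableAt_fst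
  have h5 := leftLogDeriv_comp (E := E) (x := p) (h := Prod.snd) (f := g)
    (hp2.mdifferentiableAt (by simp)) differentiableAt_snd
  rw [fderiv_fst] at h4
  rw [fderiv_snd] at h5
  rw [← h4, ← h5]
  exact h3

/-- Ad(g⁻¹) is the component in the direction of z of the logarithmic derivative of σ(z) g(y) at the
unit, so it is as smooth as that derivative. -/
theorem contDiffAt_Ad_inv {g : U → G} {x : U} (hg : ContMDiffAt 𝓘(ℝ, U) 𝓘(ℝ, E) ∞ g x) :
    ContDiffAt ℝ ∞ (fun y => Ad E (g y)⁻¹) x := by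
  have h1 := contDiffAt_leftLogDeriv (contMDiffAt_chartMul hg)
  have h2 : ContDiffAt ℝ ∞ (fun y : U => (leftLogDeriv E (chartMul E g) (unitPt E G, y)).comp
      (ContinuousLinearMap.inl ℝ E U)) x :=
    (h1.comp (g := leftLogDeriv E (chartMul E g)) x
      (contDiffAt_const.prodMk contDiffAt_id)).clm_comp contDiffAt_const
  refine h2.congr_of_eventuallyEq ?_
  have h3 : ContinuousAt (fun y : U => (unitPt E G, y)) x := by fun_prop
  filter_upwards [h3.eventually (eventually_leftLogDeriv_chartMul hg)] with y hy
  rw [hy, leftLogDeriv_unitChart_symm]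
  ext a
  simp

theorem contDiff_Ad_inv {g : U → G} (hg : ContMDiff 𝓘(ℝ, U) 𝓘(ℝ, E) ∞ g) :
    ContDiff ℝ ∞ (fun y => Ad E (g y)⁻¹) :=
  contDiff_iff_contDiffAt.2 fun x => contDiffAt_Ad_inv (hg x)

/-- The derivative of `Ad(g⁻¹)`. -/
theorem fderiv_Ad_inv {g : U → G} {x : U} (hg : ContMDiffAt 𝓘(ℝ, U) 𝓘(ℝ, E) ∞ g x)
    (w : U) (a : E) :
    fderiv ℝ (fun y => Ad E (g y)⁻¹) x w a = brk E G (Ad E (g x)⁻¹ a) (leftLogDeriv E g x w) := by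
  have hM := contMDiffAt_chartMul (E := E) hg
  have hD : DifferentiableAt ℝ (leftLogDeriv E (chartMul E g)) (unitPt E G, x) :=
    (contDiffAt_leftLogDeriv hM).differentiableAt (by simp)
  -- The Maurer-Cartan equation for σ(z) g(y), in the mixed directions. The component along y does
  -- not depend on z, so its derivative vanishes (`h2`); the component along z is Ad(g(y)⁻¹) a,
  -- whose derivative is sought (`h3`).
  have h1 := fderiv_leftLogDeriv_antisymm hM (a, 0) (0, w)
  have hev := eventually_leftLogDeriv_chartMul (E := E) hg
  have h2 : fderiv ℝ (leftLogDeriv E (chartMul E g)) (unitPt E G, x) (a, 0) (0, w) = 0 := by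
    have h3 : HasFDerivAt (fun z : E => (z, x)) (ContinuousLinearMap.inl ℝ E U) (unitPt E G) :=
      hasFDerivAt_prodMk_left _ _
    have h4 : HasFDerivAt (fun z : E => leftLogDeriv E (chartMul E g) (z, x) (0, w))
        (((ContinuousLinearMap.apply ℝ E ((0 : E), w)).comp
          (fderiv ℝ (leftLogDeriv E (chartMul E g)) (unitPt E G, x))).comp
          (ContinuousLinearMap.inl ℝ E U)) (unitPt E G) :=
      HasFDerivAt.comp (g := fun p => leftLogDeriv E (chartMul E g) p (0, w)) (unitPt E G)
        ((ContinuousLinearMap.apply ℝ E ((0 : E), w)).hasFDerivAt.comp (unitPt E G, x)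
        hD.hasFDerivAt) h3
    have h5 : (fun z : E => leftLogDeriv E (chartMul E g) (z, x) (0, w)) =ᶠ[𝓝 (unitPt E G)]
        fun _ => leftLogDeriv E g x w := by
      filter_upwards [h3.continuousAt.eventually hev] with z hz
      rw [hz]
      simp
    have h6 := h4.fderiv
    rw [h5.fderiv_eq, fderiv_fun_const] at h6
    have h7 := DFunLike.congr_fun h6 a
    simpa using h7.symm
  have h3 : fderiv ℝ (leftLogDeriv E (chartMul E g)) (unitPt E G, x) (0, w) (a, 0) =
      fderiv ℝ (fun y => Ad E (g y)⁻¹) x w a := by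
    have h3 : HasFDerivAt (fun y : U => (unitPt E G, y)) (ContinuousLinearMap.inr ℝ E U) x :=
      hasFDerivAt_prodMk_right _ _
    have h4 : HasFDerivAt (fun y : U => leftLogDeriv E (chartMul E g) (unitPt E G, y) (a, 0))
        (((ContinuousLinearMap.apply ℝ E (a, (0 : U))).comp
          (fderiv ℝ (leftLogDeriv E (chartMul E g)) (unitPt E G, x))).comp
          (ContinuousLinearMap.inr ℝ E U)) x :=
      HasFDerivAt.comp (g := fun p => leftLogDeriv E (chartMul E g) p (a, 0)) x
        ((ContinuousLinearMap.apply ℝ E (a, (0 : U))).hasFDerivAt.comp (unitPt E G, x)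
        hD.hasFDerivAt) h3
    have h5 : (fun y : U => leftLogDeriv E (chartMul E g) (unitPt E G, y) (a, 0)) =ᶠ[𝓝 x]
        fun y => Ad E (g y)⁻¹ a := by
      filter_upwards [h3.continuousAt.eventually hev] with y hy
      rw [hy, leftLogDeriv_unitChart_symm]
      simp
    have h6 := h4.fderiv
    rw [h5.fderiv_eq, fderiv_clm_apply ((contDiffAt_Ad_inv hg).differentiableAt (by simp))
      (differentiableAt_const a)] at h6
    have h7 := DFunLike.congr_fun h6 w
    simpa using h7.symm
  rw [h2, h3, hev.self_of_nhds, leftLogDeriv_unitChart_symm] at h1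
  simpa using h1

/-- The adjoint action is by Lie algebra automorphisms. -/
theorem Ad_brk (g : G) (v w : E) : Ad E g (brk E G v w) = brk E G (Ad E g v) (Ad E g w) := by
  have hσ := contMDiffAt_unitChart_symm (E := E) (G := G)
  have hM : ContMDiffAt 𝓘(ℝ, E) 𝓘(ℝ, E) ∞ (fun z => (unitChart E G).symm z * g⁻¹) (unitPt E G) :=
    hσ.mul contMDiffAt_const
  -- Right translation by g⁻¹ applies Ad g to the logarithmic derivative. Comparing the
  -- Maurer-Cartan equations before and after translation gives the compatibility with the bracket.
  have hev : leftLogDeriv E (fun z => (unitChart E G).symm z * g⁻¹) =ᶠ[𝓝 (unitPt E G)]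
      fun z => (Ad E g).comp (leftLogDeriv E (unitChart E G).symm z) := by
    filter_upwards [contMDiffAt_iff_contMDiffAt_nhds (by simp) |>.1
      (hσ.of_le (n := ∞) (m := 1) (by exact_mod_cast le_top))] with z hz
    have h3 := leftLogDeriv_mul (E := E) (x := z) (f := (unitChart E G).symm) (g := fun _ => g⁻¹)
      (hz.mdifferentiableAt (by simp)) mdifferentiableAt_const
    rw [leftLogDeriv_const, add_zero, inv_inv] at h3
    exact h3
  have hd : fderiv ℝ (leftLogDeriv E (fun z => (unitChart E G).symm z * g⁻¹)) (unitPt E G) =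
      (ContinuousLinearMap.compL ℝ E E E (Ad E g)).comp
        (fderiv ℝ (leftLogDeriv E (unitChart E G).symm) (unitPt E G)) := by
    rw [hev.fderiv_eq]
    exact ((ContinuousLinearMap.compL ℝ E E E (Ad E g)).hasFDerivAt.comp (unitPt E G)
      ((contDiffAt_leftLogDeriv hσ).differentiableAt (by simp)).hasFDerivAt).fderiv
  have h1 := fderiv_leftLogDeriv_antisymm hM v w
  have h2 := fderiv_leftLogDeriv_antisymm hσ v w
  rw [hd, hev.self_of_nhds] at h1
  beta_reduce at h1
  rw [leftLogDeriv_unitChart_symm] at h1 h2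
  simp only [ContinuousLinearMap.comp_apply, ContinuousLinearMap.compL_apply,
    ContinuousLinearMap.id_apply] at h1 h2
  rw [← map_sub, h2, map_neg, neg_inj] at h1
  exact h1

end Adjoint

/-! ### The bracket as a bilinear map, and infinitesimal invariance. -/

section Bracket

variable (E : Type*) [NormedAddCommGroup E] [NormedSpace ℝ E] [FiniteDimensional ℝ E]
  (G : Type*) [TopologicalSpace G] [ChartedSpace E G] [Group G] [LieGroup 𝓘(ℝ, E) ∞ G]

/-- The Lie bracket of `T₁G = E` as a continuous bilinear map. -/
def brkC : E →L[ℝ] E →L[ℝ] E := (brkL E G).toContinuousBilinearMap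

variable {E}

theorem brkC_apply (v w : E) : brkC E G v w = brk E G v w := rfl

theorem brkC_swap (v w : E) : brkC E G w v = -brkC E G v w := by
  have : CompleteSpace E := FiniteDimensional.complete ℝ E
  have : LieGroup 𝓘(ℝ, E) (minSmoothness ℝ 3) G :=
    LieGroup.of_le (n := ∞) (by
      rw [minSmoothness_of_isRCLikeNormedField]; exact ENat.LEInfty.out)
  exact (lie_skew (L := GroupLieAlgebra 𝓘(ℝ, E) G) w v).symm

theorem brkC_jacobi (u v w : E) : brkC E G (brkC E G u v) w + brkC E G (brkC E G v w) u +
    brkC E G (brkC E G w u) v = 0 := by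
  have : CompleteSpace E := FiniteDimensional.complete ℝ E
  have : LieGroup 𝓘(ℝ, E) (minSmoothness ℝ 3) G :=
    LieGroup.of_le (n := ∞) (by
      rw [minSmoothness_of_isRCLikeNormedField]; exact ENat.LEInfty.out)
  have h := lie_jacobi (L := GroupLieAlgebra 𝓘(ℝ, E) G) u v w
  have h' : brkC E G u (brkC E G v w) + brkC E G v (brkC E G w u) +
    brkC E G w (brkC E G u v) = 0 := h
  rw [brkC_swap G w (brkC E G u v), brkC_swap G u (brkC E G v w), brkC_swap G v (brkC E G w u),
    ← neg_eq_zero, ← h']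
  abel

theorem Ad_brkC (g : G) (v w : E) : Ad E g (brkC E G v w) = brkC E G (Ad E g v) (Ad E g w) :=
  Ad_brk g v w

variable {G}

/-- The infinitesimal form of the invariance of an invariant polynomial. -/
theorem InvariantPolynomial.sum_update_brkC {k : ℕ} (f : InvariantPolynomial E G k) (v : Fin k → E)
    (w : E) : ∑ i, f.toMap (Function.update v i (brkC E G (v i) w)) = 0 := by
  have hσ := contMDiffAt_unitChart_symm (E := E) (G := G)
  have hd : ∀ i, HasFDerivAt (fun z => Ad E ((unitChart E G).symm z)⁻¹ (v i))
      ((ContinuousLinearMap.apply ℝ E (v i)).comp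
        (fderiv ℝ (fun z => Ad E ((unitChart E G).symm z)⁻¹) (unitPt E G))) (unitPt E G) := fun i =>
    (ContinuousLinearMap.apply ℝ E (v i)).hasFDerivAt.comp _
      ((contDiffAt_Ad_inv hσ).differentiableAt (by simp)).hasFDerivAt
  have h1 := HasFDerivAt.multilinear_comp (f := f.toMap) hd
  -- By invariance the function differentiated here is constant, while the product rule writes its
  -- derivative as the sum over the slots.
  simp only [f.inv] at h1
  have h2 := DFunLike.congr_fun (h1.unique (hasFDerivAt_const _ _)) w
  simp only [FunLike.coe_sum, Finset.sum_apply, ContinuousLinearMap.comp_apply,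
    ContinuousLinearMap.apply_apply, fderiv_Ad_inv hσ w, leftLogDeriv_unitChart_symm,
    ContinuousMultilinearMap.toContinuousLinearMap_apply, unitChart_symm_unitPt, inv_one, Ad_one,
    ContinuousLinearMap.id_apply, zero_apply] at h2
  exact h2

end Bracket

/-! ### Curvature on normed spaces, the Bianchi identity and closedness. -/

section Curvature

variable {E : Type*} [NormedAddCommGroup E] [NormedSpace ℝ E] [FiniteDimensional ℝ E]
  {G : Type*} [TopologicalSpace G] [ChartedSpace E G] [Group G] [LieGroup 𝓘(ℝ, E) ∞ G]
  {U : Type*} [NormedAddCommGroup U] [NormedSpace ℝ U]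

variable (G) in
/-- The curvature `da + ½[a, a]` of a one-form on a normed space. -/
def curv (a : U → U →L[ℝ] E) (x v w : U) : E :=
  fderiv ℝ a x v w - fderiv ℝ a x w v + brkC E G (a x v) (a x w)

theorem curv_swap (a : U → U →L[ℝ] E) (x v w : U) : curv G a x w v = -curv G a x v w := by
  rw [curv, curv, brkC_swap G (a x v)]
  abel

/-- Naturality of the curvature. -/
theorem curv_pullback {U' : Type*} [NormedAddCommGroup U'] [NormedSpace ℝ U'] {a : U → U →L[ℝ] E}
    {h : U' → U} {x : U'} (ha : DifferentiableAt ℝ a (h x)) (hh : ContDiffAt ℝ ∞ h x) (v w : U') :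
    curv G (fun y => (a (h y)).comp (fderiv ℝ h y)) x v w =
      curv G a (h x) (fderiv ℝ h x v) (fderiv ℝ h x w) := by
  have h1 : DifferentiableAt ℝ h x := hh.differentiableAt (by simp)
  have h2 : DifferentiableAt ℝ (fderiv ℝ h) x :=
    (hh.fderiv_right (m := ∞) (by simp)).differentiableAt (by simp)
  have h3 : fderiv ℝ (fderiv ℝ h) x v w = fderiv ℝ (fderiv ℝ h) x w v :=
    (hh.isSymmSndFDerivAt (by
      rw [minSmoothness_of_isRCLikeNormedField]; exact ENat.LEInfty.out)).eq v w
  rw [curv, curv, fderiv_clm_comp (c := fun y => a (h y)) (ha.comp x h1) h2,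
    fderiv_fun_comp x ha h1]
  simp only [add_apply, ContinuousLinearMap.comp_apply, ContinuousLinearMap.compL_apply,
    ContinuousLinearMap.flip_apply, h3]
  abel

/-- The behaviour of the curvature under gauge transformations. -/
theorem curv_gauge {a : U → U →L[ℝ] E} {g : U → G} {x : U} (ha : DifferentiableAt ℝ a x)
    (hg : ContMDiffAt 𝓘(ℝ, U) 𝓘(ℝ, E) ∞ g x) (v w : U) :
    curv G (fun y => (Ad E (g y)⁻¹).comp (a y) + leftLogDeriv E g y) x v w =
      Ad E (g x)⁻¹ (curv G a x v w) := by
  have h1 : DifferentiableAt ℝ (fun y => Ad E (g y)⁻¹) x :=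
    (contDiffAt_Ad_inv hg).differentiableAt (by simp)
  have h2 : DifferentiableAt ℝ (leftLogDeriv E g) x :=
    (contDiffAt_leftLogDeriv hg).differentiableAt (by simp)
  have h3 := fderiv_leftLogDeriv_antisymm hg v w
  rw [← brkC_apply, sub_eq_iff_eq_add] at h3
  rw [curv, curv, fderiv_fun_add (h1.clm_comp ha) h2, fderiv_clm_comp h1 ha]
  simp only [add_apply, ContinuousLinearMap.comp_apply, ContinuousLinearMap.compL_apply,
    ContinuousLinearMap.flip_apply, h3, fderiv_Ad_inv hg, ← brkC_apply, map_add, map_sub, Ad_brkC]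
  rw [brkC_swap G (Ad E (g x)⁻¹ (a x w)) (leftLogDeriv E g x v)]
  abel

/-- The derivative of the curvature. -/
theorem fderiv_curv {a : U → U →L[ℝ] E} {x : U} (ha : ContDiffAt ℝ ∞ a x) (u v w : U) :
    HasFDerivAt (fun y => curv G a y v w) (fderiv ℝ (fun y => curv G a y v w) x) x ∧
    fderiv ℝ (fun y => curv G a y v w) x u =
      fderiv ℝ (fderiv ℝ a) x u v w - fderiv ℝ (fderiv ℝ a) x u w v +
      (brkC E G (fderiv ℝ a x u v) (a x w) + brkC E G (a x v) (fderiv ℝ a x u w)) := by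
  have h1 := (ha.differentiableAt (by simp)).hasFDerivAt
  have h2 := ((ha.fderiv_right (m := ∞) (by simp)).differentiableAt (by simp)).hasFDerivAt
  have h3' : ∀ v : U, HasFDerivAt (fun y => fderiv ℝ a y v)
      ((ContinuousLinearMap.apply ℝ (U →L[ℝ] E) v).comp (fderiv ℝ (fderiv ℝ a) x)) x := by
    intro v
    have h := (ContinuousLinearMap.apply ℝ (U →L[ℝ] E) v).hasFDerivAt (x := fderiv ℝ a x)
    exact h.comp x h2
  have h3 : ∀ v w : U, HasFDerivAt (fun y => fderiv ℝ a y v w)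
      (((ContinuousLinearMap.apply ℝ E w).comp (ContinuousLinearMap.apply ℝ (U →L[ℝ] E) v)).comp
        (fderiv ℝ (fderiv ℝ a) x)) x := fun v w =>
    (ContinuousLinearMap.apply ℝ E w).hasFDerivAt.comp x (h3' v)
  have h4 : ∀ v : U, HasFDerivAt (fun y => a y v)
      ((ContinuousLinearMap.apply ℝ E v).comp (fderiv ℝ a x)) x := fun v =>
    (ContinuousLinearMap.apply ℝ E v).hasFDerivAt.comp x h1
  have h5 := ((h3 v w).sub (h3 w v)).add ((brkC E G).hasFDerivAt_of_bilinear (h4 v) (h4 w))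
  have h6 : HasFDerivAt (fun y => curv G a y v w) _ x := h5
  refine ⟨h6.differentiableAt.hasFDerivAt, ?_⟩
  rw [h6.fderiv]
  simp [add_comm]

/-- The Bianchi identity: after antisymmetrisation the derivative of the curvature `F` in the
direction of the first argument is `[F, a]`. -/
theorem antisymm_fderiv_curv {a : U → U →L[ℝ] E} {x : U} (ha : ContDiffAt ℝ ∞ a x)
    (L : (U → U → U → E) →+ ℝ) (h12 : ∀ h, L (fun u v w => h v u w) = -L h)
    (h23 : ∀ h, L (fun u v w => h u w v) = -L h) :
    L (fun u v w => fderiv ℝ (fun y => curv G a y v w) x u) =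
      L (fun u v w => brkC E G (curv G a x v w) (a x u)) := by
  have hs : ∀ u v w : U, fderiv ℝ (fderiv ℝ a) x u v w = fderiv ℝ (fderiv ℝ a) x v u w := fun u v w =>
    congrArg (fun l => l w) ((ha.isSymmSndFDerivAt (by
      rw [minSmoothness_of_isRCLikeNormedField]; exact ENat.LEInfty.out)).eq u v)
  -- Second derivatives are symmetric in their first two arguments, hence killed by L, which is odd
  -- under exchanging them.
  have h0 : L (fun u v w => fderiv ℝ (fderiv ℝ a) x u v w) = 0 := by
    have h1 : (fun u v w => fderiv ℝ (fderiv ℝ a) x v u w) =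
        fun u v w => fderiv ℝ (fderiv ℝ a) x u v w := by
      ext1 u; ext1 v; ext1 w
      exact hs v u w
    have := h12 fun u v w => fderiv ℝ (fderiv ℝ a) x u v w
    rw [h1] at this
    linarith
  have h0' : L (fun u v w => fderiv ℝ (fderiv ℝ a) x u w v) = 0 := by
    rw [h23 fun u v w => fderiv ℝ (fderiv ℝ a) x u v w, h0, neg_zero]
  have hcyc : ∀ h : U → U → U → E, L (fun u v w => h v w u) = L h := fun h => by
    rw [h12 fun u v w => h u w v, h23, neg_neg]
  have hcyc' : ∀ h : U → U → U → E, L (fun u v w => h w u v) = L h := fun h => by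
    rw [h23 fun u v w => h v u w, h12, neg_neg]
  -- L does not see cyclic permutations, so the Jacobi identity says that three times this value is
  -- zero.
  have hJ : L (fun u v w => brkC E G (brkC E G (a x u) (a x v)) (a x w)) = 0 := by
    have h1 := hcyc fun u v w => brkC E G (brkC E G (a x u) (a x v)) (a x w)
    have h2 := hcyc' fun u v w => brkC E G (brkC E G (a x u) (a x v)) (a x w)
    have h3 : L ((fun u v w => brkC E G (brkC E G (a x u) (a x v)) (a x w)) +
        (fun u v w => brkC E G (brkC E G (a x v) (a x w)) (a x u)) +
        (fun u v w => brkC E G (brkC E G (a x w) (a x u)) (a x v))) = 0 := by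
      rw [← map_zero L]
      congr 1
      ext1 u; ext1 v; ext1 w
      exact brkC_jacobi G _ _ _
    rw [map_add, map_add] at h3
    linarith
  have hneg : L (fun u v w => brkC E G (fderiv ℝ a x u w) (a x v)) =
      -L (fun u v w => brkC E G (fderiv ℝ a x u v) (a x w)) := h23 _
  have hflip : L (fun u v w => brkC E G (fderiv ℝ a x v u) (a x w)) =
      -L (fun u v w => brkC E G (fderiv ℝ a x u v) (a x w)) := h12 _
  have hl : (fun u v w => fderiv ℝ (fun y => curv G a y v w) x u) =
      (fun u v w => fderiv ℝ (fderiv ℝ a) x u v w) - (fun u v w => fderiv ℝ (fderiv ℝ a) x u w v) +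
      ((fun u v w => brkC E G (fderiv ℝ a x u v) (a x w)) -
        (fun u v w => brkC E G (fderiv ℝ a x u w) (a x v))) := by
    ext1 u; ext1 v; ext1 w
    rw [(fderiv_curv ha u v w).2, brkC_swap G (fderiv ℝ a x u w) (a x v), ← sub_eq_add_neg]
    rfl
  have hr : (fun u v w => brkC E G (curv G a x u v) (a x w)) =
      (fun u v w => brkC E G (fderiv ℝ a x u v) (a x w)) -
        (fun u v w => brkC E G (fderiv ℝ a x v u) (a x w)) +
        (fun u v w => brkC E G (brkC E G (a x u) (a x v)) (a x w)) := by
    ext1 u; ext1 v; ext1 w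
    simp [curv]
  rw [hl, hcyc fun u v w => brkC E G (curv G a x u v) (a x w), hr]
  simp only [map_add, map_sub, h0, h0', hJ, hneg, hflip]
  ring

theorem altF_congr {U W : Type*} [AddCommGroup W] [Module ℝ W] {N : ℕ} {S T : (Fin N → U) → W}
    (h : ∀ y, S y = T y) (z : Fin N → U) : altF S z = altF T z := by
  rw [funext h]

/-- The alternation of `f(F, …, h, …, F)` with a function `h` of three vectors in the slot `i`. -/
def slotAlt {m : ℕ} (f : ContinuousMultilinearMap ℝ (fun _ : Fin m => E) ℝ) (F : U → U → E)
    (i : Fin m) (z : Fin (2 * m + 1) → U) : (U → U → U → E) →+ ℝ where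
  toFun h := altF (fun y : Fin (2 * m + 1) → U => f (Function.update (pairs F (Fin.tail y)) i
    (h (y 0) (Fin.tail y (pairIdx m (i, 0))) (Fin.tail y (pairIdx m (i, 1)))))) z
  map_zero' := by simp [f.map_coord_zero i, altF_zero]
  map_add' h h' := by simp [altF_add]

theorem slotAlt_apply {m : ℕ} (f : ContinuousMultilinearMap ℝ (fun _ : Fin m => E) ℝ)
    (F : U → U → E) (i : Fin m) (z : Fin (2 * m + 1) → U) (h : U → U → U → E) :
    slotAlt f F i z h = altF (fun y : Fin (2 * m + 1) → U =>
      f (Function.update (pairs F (Fin.tail y)) i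
        (h (y 0) (Fin.tail y (pairIdx m (i, 0))) (Fin.tail y (pairIdx m (i, 1)))))) z := rfl

theorem pairIdx_ne {m : ℕ} {k i : Fin m} (j j' : Fin 2) (hk : k ≠ i) :
    pairIdx m (k, j) ≠ pairIdx m (i, j') :=
  fun h => hk (Prod.ext_iff.1 ((pairIdx m).injective h)).1

/-- The transposition of slot 0 with the first slot of pair i leaves the other pairs alone and
changes the sign of the alternation. With the next lemma this makes `slotAlt` an admissible
functional in the Bianchi identity `antisymm_fderiv_curv`. -/
theorem slotAlt_swap_left {m : ℕ} (f : ContinuousMultilinearMap ℝ (fun _ : Fin m => E) ℝ)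
    (F : U → U → E) (i : Fin m) (z : Fin (2 * m + 1) → U) (h : U → U → U → E) :
    slotAlt f F i z (fun u v w => h v u w) = -slotAlt f F i z h := by
  have := altF_comp_perm (fun y : Fin (2 * m + 1) → U => f (Function.update (pairs F (Fin.tail y)) i
    (h (y 0) (Fin.tail y (pairIdx m (i, 0))) (Fin.tail y (pairIdx m (i, 1))))))
    (Equiv.swap 0 (pairIdx m (i, 0)).succ) z
  rw [Equiv.Perm.sign_swap (Fin.succ_ne_zero _).symm, Units.neg_smul, one_smul] at this
  rw [slotAlt_apply, slotAlt_apply]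
  rw [← this]
  refine altF_congr (fun y => ?_) z
  congr 1
  ext1 k
  by_cases hk : k = i
  · subst hk
    simp [Fin.tail, Equiv.swap_apply_of_ne_of_ne, Fin.succ_ne_zero]
  · simp [hk, pairs, Fin.tail, Equiv.swap_apply_of_ne_of_ne, Fin.succ_ne_zero, pairIdx_ne _ _ hk]

theorem slotAlt_swap_right {m : ℕ} (f : ContinuousMultilinearMap ℝ (fun _ : Fin m => E) ℝ)
    (F : U → U → E) (i : Fin m) (z : Fin (2 * m + 1) → U) (h : U → U → U → E) :
    slotAlt f F i z (fun u v w => h u w v) = -slotAlt f F i z h := by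
  have := altF_comp_perm (fun y : Fin (2 * m + 1) → U => f (Function.update (pairs F (Fin.tail y)) i
    (h (y 0) (Fin.tail y (pairIdx m (i, 0))) (Fin.tail y (pairIdx m (i, 1))))))
    (Equiv.swap (pairIdx m (i, 0)).succ (pairIdx m (i, 1)).succ) z
  rw [Equiv.Perm.sign_swap (by simp), Units.neg_smul, one_smul] at this
  rw [slotAlt_apply, slotAlt_apply]
  rw [← this]
  refine altF_congr (fun y => ?_) z
  congr 1
  ext1 k
  by_cases hk : k = i
  · subst hk
    simp [Fin.tail, Equiv.swap_apply_of_ne_of_ne, (Fin.succ_ne_zero _).symm]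
  · simp [hk, pairs, Fin.tail, Equiv.swap_apply_of_ne_of_ne, pairIdx_ne _ _ hk]

/-- The Chern-Weil form `f(F, …, F)` is closed. -/
theorem altF_fderiv_pairs_curv {m : ℕ} (f : InvariantPolynomial E G m) {a : U → U →L[ℝ] E} {x : U}
    (ha : ContDiffAt ℝ ∞ a x) (z : Fin (2 * m + 1) → U) :
    altF (fun y : Fin (2 * m + 1) → U =>
      fderiv ℝ (fun x => f.toMap (pairs (curv G a x) (Fin.tail y))) x (y 0)) z = 0 := by
  -- The product rule distributes the derivative over the m curvature slots.
  have h1 : ∀ y : Fin (2 * m + 1) → U,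
      fderiv ℝ (fun x => f.toMap (pairs (curv G a x) (Fin.tail y))) x (y 0) =
      ∑ i, f.toMap (Function.update (pairs (curv G a x) (Fin.tail y)) i
        (fderiv ℝ (fun x' => curv G a x' (Fin.tail y (pairIdx m (i, 0)))
          (Fin.tail y (pairIdx m (i, 1)))) x (y 0))) := by
    intro y
    have h := (HasFDerivAt.multilinear_comp (f := f.toMap) fun i =>
      (fderiv_curv (G := G) ha 0 (Fin.tail y (pairIdx m (i, 0)))
        (Fin.tail y (pairIdx m (i, 1)))).1).fderiv
    refine (DFunLike.congr_fun h (y 0)).trans ?_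
    simp [ContinuousMultilinearMap.toContinuousLinearMap_apply]
    rfl
  have h2 : ∀ i, altF (fun y : Fin (2 * m + 1) → U =>
      f.toMap (Function.update (pairs (curv G a x) (Fin.tail y)) i
        (fderiv ℝ (fun x' => curv G a x' (Fin.tail y (pairIdx m (i, 0)))
          (Fin.tail y (pairIdx m (i, 1)))) x (y 0)))) z =
      altF (fun y : Fin (2 * m + 1) → U =>
      f.toMap (Function.update (pairs (curv G a x) (Fin.tail y)) i
        (brkC E G (pairs (curv G a x) (Fin.tail y) i) (a x (y 0))))) z := fun i =>
    
    antisymm_fderiv_curv ha (slotAlt f.toMap (curv G a x) i z) (slotAlt_swap_left _ _ i z)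
      (slotAlt_swap_right _ _ i z)
  simp only [h1]
  -- After the Bianchi identity in each slot, the sum over the slots is the infinitesimal action of
  -- a on f, which vanishes before alternation.
  rw [altF_sum, Finset.sum_congr rfl fun i _ => h2 i, ← altF_sum]
  simp only [f.sum_update_brkC, altF_zero]

end Curvature

/-! ### Integrals depending on parameters, and Cartan's formula. -/

section ParametricIntegral

open MeasureTheory

variable {U : Type*} [NormedAddCommGroup U] [NormedSpace ℝ U]
  {V : Type*} [NormedAddCommGroup V] [NormedSpace ℝ V]

/-- Integrals of smooth functions over compact intervals depend smoothly on parameters. -/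
theorem contDiff_intervalIntegral {F : U → ℝ → V} (hF : ContDiff ℝ ∞ fun z : U × ℝ => F z.1 z.2)
    {a b : ℝ} (hab : a ≤ b) : ContDiff ℝ ∞ fun x => ∫ s in a..b, F x s := by
  let χ : ContDiffBump (0 : ℝ) := ⟨|a| + |b| + 1, |a| + |b| + 2, by positivity, by linarith⟩
  have hχ : ∀ s ∈ Set.Ioc a b, χ (-s) = 1 := fun s hs => by
    refine χ.one_of_mem_closedBall ?_
    rw [mem_closedBall_zero_iff, norm_neg, Real.norm_eq_abs, abs_le]
    change -(|a| + |b| + 1) ≤ s ∧ s ≤ |a| + |b| + 1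
    constructor <;> linarith [hs.1, hs.2, neg_abs_le a, le_abs_self b, abs_nonneg a, abs_nonneg b]
  -- The integral is the value at 0 of the convolution of the indicator of (a, b] with s ↦ χ(s) F(x,
  -- -s). The cutoff χ supplies compact support and is 1 on the part of the line that matters.
  have h := contDiffOn_convolution_right_with_param_comp (μ := volume) (n := ⊤)
    (ContinuousLinearMap.lsmul ℝ ℝ : ℝ →L[ℝ] V →L[ℝ] V)
    (s := (Set.univ : Set U)) (v := fun _ => (0 : ℝ)) contDiffOn_const
    (f := (Set.Ioc a b).indicator fun _ => (1 : ℝ)) (g := fun x s => χ s • F x (-s))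
    (k := Metric.closedBall 0 (|a| + |b| + 2)) isOpen_univ (isCompact_closedBall _ _)
    (fun x s _ hs => by
      rw [χ.zero_of_le_dist, zero_smul]
      exact (not_le.1 hs).le)
    (((integrable_indicator_iff measurableSet_Ioc).2
      (integrableOn_const (by simp))).locallyIntegrable)
    (by
      have h1 : ContDiff ℝ ∞ fun z : U × ℝ => χ z.2 • F z.1 (-z.2) :=
        (χ.contDiff.comp contDiff_snd).smul (hF.comp (contDiff_fst.prodMk contDiff_snd.neg))
      exact h1.contDiffOn)
  rw [contDiffOn_univ] at h
  convert h using 2 with x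
  rw [intervalIntegral.integral_of_le hab, convolution_def, ← integral_indicator measurableSet_Ioc]
  refine integral_congr_ae (Filter.Eventually.of_forall fun s => ?_)
  by_cases hs : s ∈ Set.Ioc a b
  · simp [hs, hχ s hs]
  · simp [hs]

/-- Differentiation under the integral sign. -/
theorem hasFDerivAt_intervalIntegral [FiniteDimensional ℝ U] {F : U → ℝ → V}
    (hF : ContDiff ℝ ∞ fun z : U × ℝ => F z.1 z.2) (a b : ℝ) (x : U) :
    HasFDerivAt (fun x => ∫ s in a..b, F x s) (∫ s in a..b, fderiv ℝ (fun x => F x s) x) x := by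
  have hc : Continuous fun z : U × ℝ => fderiv ℝ (fun x => F x z.2) z.1 :=
    (ContDiff.fderiv (𝕜 := ℝ) (n := 0) (m := ∞) (f := fun (z : U × ℝ) (x : U) => F x z.2)
      (g := Prod.fst) (hF.comp (contDiff_snd.prodMk (contDiff_snd.comp contDiff_fst)))
      contDiff_fst (by simp)).continuous
  have : ProperSpace U := FiniteDimensional.proper ℝ U
  obtain ⟨C, hC⟩ := ((isCompact_closedBall x 1).prod (isCompact_uIcc (a := a) (b := b))).exists_bound_of_continuousOn
    hc.continuousOn
  have hFc : ∀ y : U, Continuous (F y) := fun y =>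
    hF.continuous.comp (by fun_prop : Continuous fun s : ℝ => (y, s))
  refine intervalIntegral.hasFDerivAt_integral_of_dominated_of_fderiv_le
    (bound := fun _ => C) (Metric.closedBall_mem_nhds x one_pos)
    (Filter.Eventually.of_forall fun y => (hFc y).aestronglyMeasurable)
    ((hFc x).intervalIntegrable _ _)
    (hc.comp (by fun_prop : Continuous fun s : ℝ => (x, s))).aestronglyMeasurable
    (Filter.Eventually.of_forall fun s hs y hy => hC (y, s) ⟨hy, Set.uIoc_subset_uIcc hs⟩)
    intervalIntegrable_const
    (Filter.Eventually.of_forall fun s _ y _ => ?_)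
  have h1 : ContDiff ℝ ∞ fun x => F x s := hF.comp (contDiff_id.prodMk contDiff_const)
  exact (h1.differentiable (by simp) y).hasFDerivAt

/-- The exterior derivative is a continuous linear function of the derivative, so it passes under
the integral with it. -/
theorem extDeriv_intervalIntegral [FiniteDimensional ℝ U] [CompleteSpace V] {k : ℕ}
    {η : U → ℝ → U [⋀^Fin k]→L[ℝ] V} (hη : ContDiff ℝ ∞ fun z : U × ℝ => η z.1 z.2) (a b : ℝ)
    (x : U) : extDeriv (fun x => ∫ s in a..b, η x s) x = ∫ s in a..b, extDeriv (fun x => η x s) x := by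
  have hc : Continuous fun s => fderiv ℝ (fun x => η x s) x :=
    (ContDiff.fderiv (𝕜 := ℝ) (n := 0) (m := ∞) (f := fun (s : ℝ) (x : U) => η x s)
      (g := fun _ => x) (hη.comp (contDiff_snd.prodMk contDiff_fst))
      contDiff_const (by simp)).continuous
  have h1 := ContinuousLinearMap.intervalIntegral_comp_comm (𝕜 := ℝ) (μ := volume)
    (E := U →L[ℝ] U [⋀^Fin k]→L[ℝ] V) (F := U [⋀^Fin (k + 1)]→L[ℝ] V) (a := a) (b := b)
    (f := fun s => fderiv ℝ (fun x => η x s) x)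
    (by exact ContinuousAlternatingMap.alternatizeUncurryFinCLM ℝ U V)
    (Continuous.intervalIntegrable (by exact hc) a b)
  rw [extDeriv, (hasFDerivAt_intervalIntegral hη a b x).fderiv]
  exact h1.symm

/-- Contraction with a vector, as a continuous linear map. -/
def curryLeftCLM {k : ℕ} (e : U) : (U [⋀^Fin (k + 1)]→L[ℝ] V) →L[ℝ] U [⋀^Fin k]→L[ℝ] V :=
  (ContinuousLinearMap.apply ℝ (U [⋀^Fin k]→L[ℝ] V) e).comp
    (ContinuousAlternatingMap.curryLeftLI (𝕜 := ℝ) (E := U) (F := V)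
      (n := k)).toContinuousLinearMap

/-- Pullback along a linear map, as a continuous linear map. -/
def compCLM {k : ℕ} {U' : Type*} [NormedAddCommGroup U'] [NormedSpace ℝ U'] (i : U →L[ℝ] U') :
    (U' [⋀^Fin k]→L[ℝ] V) →L[ℝ] U [⋀^Fin k]→L[ℝ] V :=
  ContinuousAlternatingMap.compContinuousLinearMapCLM i

/-- The exterior derivative as a function of the derivative. -/
def extCLM (k : ℕ) (U V : Type*) [NormedAddCommGroup U] [NormedSpace ℝ U] [NormedAddCommGroup V]
    [NormedSpace ℝ V] : (U →L[ℝ] U [⋀^Fin k]→L[ℝ] V) →L[ℝ] U [⋀^Fin (k + 1)]→L[ℝ] V :=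
  ContinuousAlternatingMap.alternatizeUncurryFinCLM ℝ U V

theorem contDiff_extDeriv {k : ℕ} {η : U → U [⋀^Fin k]→L[ℝ] V} (hη : ContDiff ℝ ∞ η) :
    ContDiff ℝ ∞ (extDeriv η) := by
  have h0 : ContDiff ℝ ∞ (fderiv ℝ η) := hη.fderiv_right (m := ∞) (by simp)
  have h1 := ContinuousLinearMap.contDiff (𝕜 := ℝ) (n := ∞) (E := U →L[ℝ] U [⋀^Fin k]→L[ℝ] V)
    (F := U [⋀^Fin (k + 1)]→L[ℝ] V) (by exact extCLM k U V)
  exact h1.comp h0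

/-- Cartan's formula for a constant vector field. -/
theorem extDeriv_curryLeft {k : ℕ} {η : U → U [⋀^Fin (k + 1)]→L[ℝ] V} {x : U}
    (hη : DifferentiableAt ℝ η x) (e : U) :
    extDeriv (fun y => (η y).curryLeft e) x = fderiv ℝ η x e - (extDeriv η x).curryLeft e := by
  have hd : DifferentiableAt ℝ (fun y => (η y).curryLeft e) x :=
    (curryLeftCLM (V := V) (k := k) e).differentiableAt.comp x hη
  ext v
  rw [ContinuousAlternatingMap.sub_apply, ContinuousAlternatingMap.curryLeft_apply_apply,
    extDeriv_apply hd, extDeriv_apply hη, Fin.sum_univ_succ (n := k + 1)]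
  have h0 : ∀ z : Fin (k + 1) → U, DifferentiableAt ℝ (fun y => η y z) x := fun z =>
    (ContinuousAlternatingMap.apply ℝ U V z).differentiableAt.comp x hη
  have h1 : fderiv ℝ (fun y => η y v) x e = fderiv ℝ η x e v := by
    have h2 := ((ContinuousAlternatingMap.apply ℝ U V v).hasFDerivAt.comp x hη.hasFDerivAt).fderiv
    exact DFunLike.congr_fun h2 e
  have h3 : ∀ i : Fin (k + 1), (i.succ.removeNth (Fin.cons e v : Fin (k + 1 + 1) → U) :
      Fin (k + 1) → U) = Fin.cons e (i.removeNth v) := fun i => by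
    ext1 j
    refine Fin.cases ?_ (fun j => ?_) j
    · simp [Fin.removeNth]
    · simp [Fin.removeNth]
  have h4 : (Fin.removeNth 0 (Fin.cons e v : Fin (k + 1 + 1) → U) : Fin (k + 1) → U) = v := by
    ext1 j
    simp [Fin.removeNth]
  rw [← h1]
  simp only [Matrix.vecCons, h3, h4, Fin.val_zero, pow_zero, one_smul, Fin.cons_zero, Fin.cons_succ,
    Fin.val_succ, pow_succ, mul_neg, mul_one, neg_smul, Finset.sum_neg_distrib,
    ContinuousAlternatingMap.curryLeft_apply_apply]
  abel

/-- By Cartan's formula the exterior derivative of the contraction is the derivative along e minus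
the contraction of dη. The first term integrates to the boundary values. -/
theorem extDeriv_integral_contract [FiniteDimensional ℝ U] [CompleteSpace V] {U' : Type*}
    [NormedAddCommGroup U'] [NormedSpace ℝ U'] {k : ℕ} {η : U' → U' [⋀^Fin (k + 1)]→L[ℝ] V}
    (hη : ContDiff ℝ ∞ η) (i : U →L[ℝ] U') (e : U') (a b : ℝ) (x : U) :
    extDeriv (fun x => ∫ s in a..b,
        ((η (i x + s • e)).curryLeft e).compContinuousLinearMap i) x =
      (η (i x + b • e)).compContinuousLinearMap i - (η (i x + a • e)).compContinuousLinearMap i -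
      ∫ s in a..b, ((extDeriv η (i x + s • e)).curryLeft e).compContinuousLinearMap i := by
  have hsm : ContDiff ℝ ∞ fun z : U × ℝ =>
      ((η (i z.1 + z.2 • e)).curryLeft e).compContinuousLinearMap i :=
    (compCLM (V := V) (k := k) i).contDiff.comp
      ((curryLeftCLM (V := V) (k := k) e).contDiff.comp (hη.comp (by fun_prop)))
  have hline : ∀ s : ℝ, HasDerivAt (fun s : ℝ => i x + s • e) e s := fun s => by
    simpa using ((hasDerivAt_id s).smul_const e).const_add (i x)
  have hder : ∀ s : ℝ, HasDerivAt (fun s : ℝ => (η (i x + s • e)).compContinuousLinearMap i)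
      ((fderiv ℝ η (i x + s • e) e).compContinuousLinearMap i) s := fun s =>
    (compCLM (V := V) (k := k + 1) i).hasFDerivAt.comp_hasDerivAt s
      ((hη.differentiable (by simp) _).hasFDerivAt.comp_hasDerivAt s (hline s))
  have hc1 : Continuous fun s : ℝ => (fderiv ℝ η (i x + s • e) e).compContinuousLinearMap i := by
    have h1 : Continuous (fderiv ℝ η) := hη.continuous_fderiv (by simp)
    have h2 : Continuous fun s : ℝ => fderiv ℝ η (i x + s • e) e :=
      (h1.comp (by fun_prop : Continuous fun s : ℝ => i x + s • e)).clm_apply continuous_const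
    exact (compCLM (V := V) (k := k + 1) i).continuous.comp h2
  have hext := contDiff_extDeriv hη
  have hc2 : Continuous fun s : ℝ =>
      ((extDeriv η (i x + s • e)).curryLeft e).compContinuousLinearMap i :=
    (compCLM (V := V) (k := k + 1) i).continuous.comp
      ((curryLeftCLM (V := V) (k := k + 1) e).continuous.comp
        (hext.continuous.comp (by fun_prop : Continuous fun s : ℝ => i x + s • e)))
  rw [extDeriv_intervalIntegral hsm, ← intervalIntegral.integral_eq_sub_of_hasDerivAt
    (fun s _ => hder s) (hc1.intervalIntegrable _ _),
    ← intervalIntegral.integral_sub (hc1.intervalIntegrable _ _) (hc2.intervalIntegrable _ _)]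
  refine intervalIntegral.integral_congr fun s _ => ?_
  have hf : fderiv ℝ (fun x => i x + s • e) = fun _ => i := by
    ext1 y
    rw [fderiv_add_const, i.fderiv]
  have hd : DifferentiableAt ℝ (fun y => (η y).curryLeft e) (i x + s • e) :=
    ((curryLeftCLM (V := V) (k := k) e).contDiff.comp hη).differentiable (by simp) _
  have hp := extDeriv_pullback (r := ∞) (x := x)  (f := fun x => i x + s • e) hd (by fun_prop) (by
      rw [minSmoothness_of_isRCLikeNormedField]; exact ENat.LEInfty.out)
  rw [hf] at hp
  beta_reduce at hp ⊢
  rw [hp, extDeriv_curryLeft (hη.differentiable (by simp) _)]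
  rfl

end ParametricIntegral

/-! ### Elementary operations on forms. -/

section FormCalculus

variable {X Y : Type*} [DiffeologicalSpace X] [DiffeologicalSpace Y]
  {V W : Type*} [NormedAddCommGroup V] [NormedSpace ℝ V] [NormedAddCommGroup W] [NormedSpace ℝ W]
  {U : Type*} [NormedAddCommGroup U] [NormedSpace ℝ U]

/-- A family of alternating maps on a finite-dimensional space is smooth if its values are. -/
theorem contDiff_of_apply [FiniteDimensional ℝ V] {n k : ℕ} {η : U → (Euc n) [⋀^Fin k]→L[ℝ] V}
    (h : ∀ v, ContDiff ℝ ∞ fun x => η x v) : ContDiff ℝ ∞ η := by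
  let b : Fin n → Euc n := fun i => EuclideanSpace.basisFun (Fin n) ℝ i
  let ev : ((Euc n) [⋀^Fin k]→L[ℝ] V) →ₗ[ℝ] ((Fin k → Fin n) → V) :=
    { toFun := fun α c => α fun j => b (c j)
      map_add' := fun _ _ => rfl
      map_smul' := fun _ _ => rfl }
  have hinj : LinearMap.ker ev = ⊥ := by
    refine LinearMap.ker_eq_bot.2 fun α β hαβ => ?_
    apply ContinuousAlternatingMap.toAlternatingMap_injective
    refine Module.Basis.ext_alternating (EuclideanSpace.basisFun (Fin n) ℝ).toBasis fun c _ => ?_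
    have := congrFun hαβ c
    simpa [ev, b] using this
  -- A form is recovered linearly from its values on tuples of basis vectors, and every linear map
  -- out of this finite-dimensional space of values is continuous.
  obtain ⟨L, hL⟩ := ev.exists_leftInverse_of_injective hinj
  have h1 : ContDiff ℝ ∞ fun x => LinearMap.toContinuousLinearMap L (ev (η x)) :=
    (LinearMap.toContinuousLinearMap L).contDiff.comp (contDiff_pi.2 fun c => h _)
  convert h1 using 2 with x
  exact (DFunLike.congr_fun hL (η x)).symm

theorem contDiff_apply {n k : ℕ} {η : U → (Euc n) [⋀^Fin k]→L[ℝ] V} (h : ContDiff ℝ ∞ η)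
    (v : Fin k → Euc n) : ContDiff ℝ ∞ fun x => η x v :=
  (ContinuousAlternatingMap.apply ℝ (Euc n) V v).contDiff.comp h

theorem contDiff_altF {N : ℕ} {U' : Type*} {T : (Fin N → U') → U → W}
    (h : ∀ y, ContDiff ℝ ∞ (T y)) (v : Fin N → U') :
    ContDiff ℝ ∞ fun x => altF (fun y => T y x) v := by
  simp only [altF]
  refine ContDiff.sum fun σ _ => ?_
  rcases Int.units_eq_one_or (Equiv.Perm.sign σ) with hσ | hσ
  · simpa [hσ] using h _
  · simpa [hσ] using (h _).neg

theorem isForm_wedge [FiniteDimensional ℝ W] {r : ℕ}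
    (f : ContinuousMultilinearMap ℝ (fun _ : Fin r => V) W)
    {η : Fin r → Σ p : ℕ, FormData X V p} (h : ∀ i, IsForm (η i).2) (N : ℕ)
    (hN : ∑ i, (η i).1 = N) : IsForm (wedge f η N hN) where
  smooth n p := by
    refine contDiff_of_apply fun v => ?_
    simp only [wedge_apply]
    refine contDiff_const.smul (contDiff_altF (fun y => ?_) v)
    exact f.contDiff.comp (contDiff_pi.2 fun i => contDiff_apply ((h i).smooth n p) _)
  reparam n m p g hg x := by
    ext v
    rw [ContinuousAlternatingMap.compContinuousLinearMap_apply, wedge_apply, wedge_apply]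
    simp only [fun i => (h i).reparam n m p g hg x]
    rfl

theorem IsForm.extd {k : ℕ} {η : FormData X V k} (h : IsForm η) : IsForm (extd η) where
  smooth n p := contDiff_extDeriv (h.smooth n p)
  reparam n m p g hg x := by
    rw [LoopBundles.extd, LoopBundles.extd, funext (h.reparam n m p g hg)]
    exact extDeriv_pullback (r := ∞) ((h.smooth m p).differentiable (by simp) _) hg.contDiffAt (by
      rw [minSmoothness_of_isRCLikeNormedField]; exact ENat.LEInfty.out)

theorem IsForm.add {k : ℕ} {η ζ : FormData X V k} (h : IsForm η) (h' : IsForm ζ) :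
    IsForm (η + ζ) where
  smooth n p := (h.smooth n p).add (h'.smooth n p)
  reparam n m p g hg x := by
    simp only [Pi.add_apply, h.reparam, h'.reparam]
    rfl

theorem IsForm.smul {k : ℕ} {η : FormData X V k} (h : IsForm η) (c : ℝ) : IsForm (c • η) where
  smooth n p := (h.smooth n p).const_smul c
  reparam n m p g hg x := by
    simp only [Pi.smul_apply, h.reparam]
    rfl

/-- A one-form on the domain of a plot, as a family of linear maps. -/
def oneL (a : FormData X V 1) {n : ℕ} (p : Plot X n) (x : Euc n) : Euc n →L[ℝ] V :=
  (ContinuousAlternatingMap.ofSubsingleton ℝ (Euc n) V (0 : Fin 1)).symm (a n p x)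

theorem oneL_apply (a : FormData X V 1) {n : ℕ} (p : Plot X n) (x v : Euc n) :
    oneL a p x v = a n p x fun _ => v := rfl

theorem oneForm_oneL (a : FormData X V 1) {n : ℕ} (p : Plot X n) (x : Euc n) :
    oneForm (oneL a p x) = a n p x :=
  (ContinuousAlternatingMap.ofSubsingleton ℝ (Euc n) V (0 : Fin 1)).apply_symm_apply _

theorem contDiff_clm_of_apply {n : ℕ} {a : U → Euc n →L[ℝ] V}
    (h : ∀ v, ContDiff ℝ ∞ fun x => a x v) : ContDiff ℝ ∞ a :=
  contDiff_clm_apply_iff.2 h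

theorem IsForm.contDiff_oneL {a : FormData X V 1} (h : IsForm a) {n : ℕ} (p : Plot X n) :
    ContDiff ℝ ∞ (oneL a p) :=
  contDiff_clm_of_apply fun _ => contDiff_apply (h.smooth n p) _

theorem extd_one_apply {a : FormData X V 1} (h : IsForm a) {n : ℕ} (p : Plot X n) (x v w : Euc n) :
    extd a n p x ![v, w] = fderiv ℝ (oneL a p) x v w - fderiv ℝ (oneL a p) x w v := by
  have h1 : ∀ u u' : Euc n, fderiv ℝ (oneL a p) x u u' = fderiv ℝ (fun y => oneL a p y u') x u := by
    intro u u'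
    rw [fderiv_clm_apply ((h.contDiff_oneL p).differentiable (by simp) x)
      (differentiableAt_const u')]
    simp
  rw [extd, extDeriv_apply ((h.smooth n p).differentiable (by simp) x), Fin.sum_univ_two, h1, h1]
  have h2 : (fun y => a n p y (Fin.removeNth 0 ![v, w])) = fun y => oneL a p y w := by
    ext1 y
    rw [oneL_apply]
    congr 1
    ext1 j
    fin_cases j
    simp [Fin.removeNth]
  have h3 : (fun y => a n p y (Fin.removeNth 1 ![v, w])) = fun y => oneL a p y v := by
    ext1 y
    rw [oneL_apply]
    congr 1
    ext1 j
    fin_cases j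
    simp [Fin.removeNth]
  rw [h2, h3]
  simp [sub_eq_add_neg]

theorem extd_zeroForm_apply (φ : X → V) {n : ℕ} (p : Plot X n) (x v : Euc n) :
    (extd (zeroForm φ) : FormData X V 1) n p x (fun _ => v) = fderiv ℝ (fun y => φ (p.1 y)) x v := by
  have h : extd (zeroForm φ) n p x = _ := extDeriv_constOfIsEmpty (fun y => φ (p.1 y)) x
  rw [h]
  rfl

end FormCalculus

/-! ### Curvature and Chern-Weil forms on diffeological spaces. -/

section CurvatureForm

variable {E : Type*} [NormedAddCommGroup E] [NormedSpace ℝ E] [FiniteDimensional ℝ E]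
  {G : Type*} [TopologicalSpace G] [ChartedSpace E G] [Group G] [LieGroup 𝓘(ℝ, E) ∞ G]
  {X : Type*} [DiffeologicalSpace X]

theorem lieBr_apply (v : Fin 2 → E) : lieBr E G v = brkC E G (v 0) (v 1) := rfl

theorem altF_two {U W : Type*} [AddCommGroup W] [Module ℝ W] (T : (Fin 2 → U) → W) (v w : U) :
    altF T ![v, w] = T ![v, w] - T ![w, v] := by
  have h : (Finset.univ : Finset (Equiv.Perm (Fin 2))) = {1, Equiv.swap 0 1} := by decide
  have h2 : (![v, w] ∘ ⇑(Equiv.swap (0 : Fin 2) 1)) = ![w, v] := by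
    ext1 i
    fin_cases i <;> simp
  rw [altF, h, Finset.sum_pair (by decide), Equiv.Perm.sign_swap (by decide), h2]
  simp [sub_eq_add_neg]

theorem bracketForm_one_one_apply (a b : FormData X E 1) {n : ℕ} (p : Plot X n) (x v w : Euc n) :
    bracketForm G a b n p x ![v, w] = brkC E G (oneL a p x v) (oneL b p x w) -
      brkC E G (oneL a p x w) (oneL b p x v) := by
  let η : Fin 2 → Σ q, FormData X E q := ![⟨1, a⟩, ⟨1, b⟩]
  have hN : ∑ i, (η i).1 = 2 := by simp [η]
  have h : bracketForm G a b n p x ![v, w] = _ := wedge_apply (lieBr E G) η 2 hN n p x ![v, w]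
  rw [h]
  have hT : ∀ y : Fin 2 → Euc n, (lieBr E G fun i => (η i).2 n p x
      fun j : Fin (η i).1 => y (finCongr hN (finSigmaFinEquiv ⟨i, j⟩))) =
      brkC E G (oneL a p x (y 0)) (oneL b p x (y 1)) := by
    intro y
    rw [lieBr_apply]
    refine congrArg₂ (fun v w => brkC E G v w) ?_ ?_
    · change a n p x _ = a n p x _
      congr 1
      ext1 j
      congr 1
      fin_cases j
      rfl
    · change b n p x _ = b n p x _
      congr 1
      ext1 j
      congr 1
      fin_cases j
      rfl
  rw [altF_congr hT, altF_two]
  simp [η]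

theorem bracketForm_one_zero_apply (a : FormData X E 1) (φ : X → E) {n : ℕ} (p : Plot X n)
    (x v : Euc n) :
    bracketForm G a (zeroForm φ) n p x (fun _ => v) = brkC E G (oneL a p x v) (φ (p.1 x)) := by
  let η : Fin 2 → Σ q, FormData X E q := ![⟨1, a⟩, ⟨0, zeroForm φ⟩]
  have hN : ∑ i, (η i).1 = 1 := by simp [η]
  have h : bracketForm G a (zeroForm φ) n p x (fun _ => v) = _ :=
    wedge_apply (lieBr E G) η 1 hN n p x fun _ => v
  have hη : (∏ i, ((η i).1.factorial : ℝ))⁻¹ = 1 := by simp [η]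
  rw [h, hη, one_smul, altF, Fintype.sum_unique, lieBr_apply]
  simp
  rfl

/-- On (v, w) the form [a, a] is 2[a v, a w], which absorbs the factor ½. -/
theorem two_curvature {a : FormData X E 1} (h : IsForm a) {n : ℕ} (p : Plot X n) (x : Euc n) :
    two (curvature G a) p x = curv G (oneL a p) x := by
  ext v w
  have h1 : two (curvature G a) p x v w = extd a n p x ![v, w] +
    (1 / 2 : ℝ) • bracketForm G a a n p x ![v, w] := rfl
  rw [h1, extd_one_apply h, bracketForm_one_one_apply, brkC_swap G (oneL a p x v) (oneL a p x w),
    sub_neg_eq_add, curv, ← two_smul ℝ (brkC E G _ _), smul_smul]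
  norm_num

theorem isForm_curvature {a : FormData X E 1} (h : IsForm a) : IsForm (curvature G a) :=
  h.extd.add ((isForm_wedge (lieBr E G) (fun i => by fin_cases i <;> exact h) _ _).smul _)

theorem isForm_chernWeil {m : ℕ} (f : InvariantPolynomial E G (m + 1)) {a : FormData X E 1}
    (h : IsForm a) : IsForm (chernWeil G f a) :=
  isForm_wedge f.toMap (fun _ => isForm_curvature h) _ _

theorem chernWeil_apply {m : ℕ} (f : InvariantPolynomial E G (m + 1)) {a : FormData X E 1}
    (h : IsForm a) {n : ℕ} (p : Plot X n) (x : Euc n) (v : Fin (2 * (m + 1)) → Euc n) :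
    chernWeil G f a n p x v = ((2 : ℝ) ^ (m + 1))⁻¹ •
      altF (fun y : Fin (2 * (m + 1)) → Euc n => f.toMap (pairs (curv G (oneL a p) x) y)) v := by
  rw [← two_curvature h]
  exact wedge_pow_apply f.toMap (curvature G a) _ p x v

/-- Chern-Weil forms are closed. -/
theorem extd_chernWeil {m : ℕ} (f : InvariantPolynomial E G (m + 1)) {a : FormData X E 1}
    (h : IsForm a) : extd (chernWeil G f a) = 0 := by
  ext n p x v
  have ha := (h.contDiff_oneL p).contDiffAt (x := x)
  have h1 : ∀ y : Fin (2 * (m + 1)) → Euc n, DifferentiableAt ℝ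
      (fun x' => f.toMap (pairs (curv G (oneL a p) x') y)) x := fun y =>
    (HasFDerivAt.multilinear_comp (f := f.toMap) fun i =>
      (fderiv_curv (G := G) ha 0 (y (pairIdx (m + 1) (i, 0))) (y (pairIdx (m + 1) (i, 1)))).1).differentiableAt
  rw [extd, extDeriv_apply (((isForm_chernWeil f h).smooth n p).differentiable (by simp) x)]
  simp only [chernWeil_apply f h]
  -- Sorting the vanishing alternation by the vector in slot 0, the direction of differentiation,
  -- gives the sum that defines `extDeriv`, up to the normalisation.
  have h2 := altF_fderiv_pairs_curv f ha v
  rw [altF_eq_sum_removeNth] at h2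
  simp only [Fin.cons_zero, Fin.tail_cons] at h2
  have h3 : ∀ (z : Fin (2 * (m + 1)) → Euc n) (u : Euc n), fderiv ℝ (fun x' =>
      ((2 : ℝ) ^ (m + 1))⁻¹ • altF (fun y : Fin (2 * (m + 1)) → Euc n =>
        f.toMap (pairs (curv G (oneL a p) x') y)) z) x u =
      ((2 : ℝ) ^ (m + 1))⁻¹ • altF (fun y : Fin (2 * (m + 1)) → Euc n => fderiv ℝ (fun x' =>
        f.toMap (pairs (curv G (oneL a p) x') y)) x u) z := by
    intro z u
    have h4 : HasFDerivAt (fun x' => altF (fun y : Fin (2 * (m + 1)) → Euc n =>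
        f.toMap (pairs (curv G (oneL a p) x') y)) z) (∑ σ : Equiv.Perm (Fin (2 * (m + 1))),
        Equiv.Perm.sign σ • fderiv ℝ (fun x' =>
          f.toMap (pairs (curv G (oneL a p) x') (z ∘ σ))) x) x :=
      HasFDerivAt.fun_sum fun σ _ => (h1 (z ∘ σ)).hasFDerivAt.const_smul _
    have h5 : HasFDerivAt (fun x' => ((2 : ℝ) ^ (m + 1))⁻¹ •
        altF (fun y : Fin (2 * (m + 1)) → Euc n => f.toMap (pairs (curv G (oneL a p) x') y)) z) _ x :=
      h4.const_smul (((2 : ℝ) ^ (m + 1))⁻¹)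
    rw [h5.fderiv]
    simp [altF, Units.smul_def]
  simp only [h3]
  have h6 := congrArg (((2 : ℝ) ^ (m + 1))⁻¹ • ·) h2
  simp only [smul_zero, Finset.smul_sum] at h6
  refine Eq.trans (Finset.sum_congr rfl fun i _ => ?_) h6
  rw [smul_comm]
  simp [Units.smul_def]

end CurvatureForm

/-! ### Contraction of f(F, …, F) with a vector. -/

section PairContraction

variable {U V W : Type*} [NormedAddCommGroup V] [NormedSpace ℝ V] [NormedAddCommGroup W]
  [NormedSpace ℝ W]

theorem pairs_cons {m : ℕ} (F : U → U → V) (e : U) (y : Fin (2 * m + 1) → U) :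
    pairs F (Fin.cons e y : Fin (2 * m + 1 + 1) → U) =
      (Fin.cons (F e (y 0)) (pairs F (Fin.tail y)) : Fin (m + 1) → V) := by
  ext1 i
  refine Fin.cases ?_ (fun i => ?_) i
  · rfl
  · simp only [pairs, Fin.cons_succ, Fin.tail]
    congr 1

/-- The contraction of `f(F, …, F)` with a vector, before normalisation. -/
theorem altF_pairs_contract {m : ℕ} (f : ContinuousMultilinearMap ℝ (fun _ : Fin (m + 1) => V) W)
    (hf : ∀ (σ : Equiv.Perm (Fin (m + 1))) v, f (v ∘ σ) = f v) {F : U → U → V}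
    (hF : ∀ v w, F w v = -F v w) (e : U) (v : Fin (2 * m + 1) → U) :
    altF (fun y : Fin (2 * (m + 1)) → U => f (pairs F y)) (Fin.cons e v : Fin (2 * m + 1 + 1) → U) =
      (2 * (m + 1) : ℝ) • altF (fun y : Fin (2 * m + 1) → U =>
        f (Fin.cons (F e (y 0)) (pairs F (Fin.tail y)) : Fin (m + 1) → V)) v := by
  -- The symmetry group of the pairs is transitive on the slots, so each of the 2m + 2 slots
  -- contributes as slot 0 does.
  have h0 : ∀ p : Fin (2 * m + 1 + 1), altPart (fun y : Fin (2 * m + 1 + 1) → U => f (pairs F y)) p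
      (Fin.cons e v : Fin (2 * m + 1 + 1) → U) = altF (fun y : Fin (2 * m + 1) → U =>
        f (Fin.cons (F e (y 0)) (pairs F (Fin.tail y)) : Fin (m + 1) → V)) v := by
    intro p
    obtain ⟨π, hπ, h⟩ := exists_perm_pairs (m := m + 1) hF (g := f) hf (fun v i => by
      have := f.map_update_smul v i (-1) (v i)
      rwa [neg_one_smul, neg_one_smul, Function.update_eq_self] at this) p
      (0 : Fin (2 * m + 1 + 1))
    rw [altPart_eq_of_invariant (ρ := π) h, hπ, altPart_zero_cons]
    exact altF_congr (fun y => by rw [pairs_cons]) v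
  refine (altF_eq_sum_altPart (N := 2 * m + 1) _ _).trans ?_
  refine (Finset.sum_congr rfl fun p _ => h0 p).trans ?_
  rw [Finset.sum_const, Finset.card_univ, Fintype.card_fin,
    ← Nat.cast_smul_eq_nsmul ℝ]
  congr 1
  push_cast
  ring

theorem altF_map {U' : Type*} {N : ℕ} (T : (Fin N → U) → W) (i : U' → U) (v : Fin N → U') :
    altF T (fun j => i (v j)) = altF (fun y => T fun j => i (y j)) v := rfl

end PairContraction

/-! ### Integration of forms over an extra variable. -/

section LineIntegral

variable {X Y : Type*} [DiffeologicalSpace X] [DiffeologicalSpace Y]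
  {V : Type*} [NormedAddCommGroup V] [NormedSpace ℝ V]

/-- The last coordinate of `ℝⁿ⁺¹`. -/
def lastL (n : ℕ) : Euc (n + 1) →L[ℝ] ℝ := EuclideanSpace.proj (Fin.last n)

theorem initL_inclL (n : ℕ) (x : Euc n) : initL n (inclL n x) = x := by
  ext i
  exact Fin.snoc_castSucc (α := fun _ => ℝ) (0 : ℝ) (fun i => x i) i

theorem initL_lastVec (n : ℕ) : initL n (lastVec n) = 0 := by
  ext i
  change (EuclideanSpace.single (Fin.last n) (1 : ℝ) : Euc (n + 1)) i.castSucc = 0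
  simp

theorem lastL_inclL (n : ℕ) (x : Euc n) : lastL n (inclL n x) = 0 := by
  simp [lastL, inclL]

theorem lastL_lastVec (n : ℕ) : lastL n (lastVec n) = 1 := by
  simp [lastL, lastVec]

/-- The map `g × id : ℝⁿ⁺¹ → ℝᵐ⁺¹` for a map `g : ℝⁿ → ℝᵐ`. -/
def timesId {n m : ℕ} (g : Euc n → Euc m) (y : Euc (n + 1)) : Euc (m + 1) :=
  inclL m (g (initL n y)) + lastL n y • lastVec m

theorem initL_timesId {n m : ℕ} (g : Euc n → Euc m) (y : Euc (n + 1)) :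
    initL m (timesId g y) = g (initL n y) := by
  simp [timesId, initL_inclL, initL_lastVec]

theorem lastL_timesId {n m : ℕ} (g : Euc n → Euc m) (y : Euc (n + 1)) :
    lastL m (timesId g y) = lastL n y := by
  simp [timesId, lastL_inclL, lastL_lastVec]

theorem contDiff_timesId {n m : ℕ} {g : Euc n → Euc m} (hg : ContDiff ℝ ∞ g) :
    ContDiff ℝ ∞ (timesId g) :=
  ((inclL m).contDiff.comp (hg.comp (initL n).contDiff)).add
    ((lastL n).contDiff.smul contDiff_const)

theorem hasFDerivAt_timesId {n m : ℕ} {g : Euc n → Euc m} (hg : ContDiff ℝ ∞ g)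
    (y : Euc (n + 1)) : HasFDerivAt (timesId g)
      (((inclL m).comp ((fderiv ℝ g (initL n y)).comp (initL n))) +
        (lastL n).smulRight (lastVec m)) y :=
  ((inclL m).hasFDerivAt.comp y ((hg.differentiable (by simp) _).hasFDerivAt.comp y
    (initL n).hasFDerivAt)).add ((lastL n).hasFDerivAt.smul_const (lastVec m))

/-- A natural way to turn plots of `X` to plots of `Y` with one more variable. -/
def IsThickening (P : ∀ n, Plot X n → Plot Y (n + 1)) : Prop :=
  ∀ (n m : ℕ) (p : Plot X m) (g : Euc n → Euc m) (hg : ContDiff ℝ ∞ g),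
    P n (p.reparam g hg) = (P m p).reparam (timesId g) (contDiff_timesId hg)

/-- Integration of forms over the last variable. -/
def lineInt {k : ℕ} (P : ∀ n, Plot X n → Plot Y (n + 1)) (a b : ℝ) (η : FormData Y V (k + 1)) :
    FormData X V k :=
  fun n p x => ∫ s in a..b, ((η (n + 1) (P n p) (inclL n x + s • lastVec n)).curryLeft
    (lastVec n)).compContinuousLinearMap (inclL n)

variable {P : ∀ n, Plot X n → Plot Y (n + 1)} {k : ℕ} {η : FormData Y V (k + 1)}

theorem IsForm.contDiff_contract (hη : IsForm η) {n : ℕ} (p : Plot Y (n + 1)) :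
    ContDiff ℝ ∞ fun z : Euc n × ℝ => ((η (n + 1) p (inclL n z.1 + z.2 • lastVec n)).curryLeft
      (lastVec n)).compContinuousLinearMap (inclL n) :=
  (compCLM (V := V) (k := k) (inclL n)).contDiff.comp
    ((curryLeftCLM (V := V) (k := k) (lastVec n)).contDiff.comp ((hη.smooth _ p).comp (by fun_prop)))

theorem IsForm.continuous_contract (hη : IsForm η) {n : ℕ} (p : Plot Y (n + 1)) (x : Euc n) :
    Continuous fun s : ℝ => ((η (n + 1) p (inclL n x + s • lastVec n)).curryLeft
      (lastVec n)).compContinuousLinearMap (inclL n) :=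
  (compCLM (V := V) (k := k) (inclL n)).continuous.comp
    ((curryLeftCLM (V := V) (k := k) (lastVec n)).continuous.comp
      ((hη.smooth _ p).continuous.comp (by fun_prop)))

/-- The derivative of g × id fixes the integration direction and acts as dg on the others, so
pullback along g passes through the contraction and the integral. -/
theorem isForm_lineInt [CompleteSpace V] (hP : IsThickening P) (hη : IsForm η) {a b : ℝ}
    (hab : a ≤ b) : IsForm (lineInt P a b η) where
  smooth n p := contDiff_intervalIntegral
    (F := fun x s => ((η (n + 1) (P n p) (inclL n x + s • lastVec n)).curryLeft
      (lastVec n)).compContinuousLinearMap (inclL n)) (hη.contDiff_contract (P n p)) hab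
  reparam n m p g hg x := by
    have hc : Continuous fun s : ℝ =>
        ((η (m + 1) (P m p) (inclL m (g x) + s • lastVec m)).curryLeft
          (lastVec m)).compContinuousLinearMap (inclL m) :=
      hη.continuous_contract (P m p) (g x)
    have h := ContinuousLinearMap.intervalIntegral_comp_comm (𝕜 := ℝ) (μ := MeasureTheory.volume)
      (E := (Euc m) [⋀^Fin k]→L[ℝ] V) (F := (Euc n) [⋀^Fin k]→L[ℝ] V)
      (compCLM (V := V) (k := k) (fderiv ℝ g x)) (hc.intervalIntegrable a b)
    refine Eq.trans (intervalIntegral.integral_congr fun s _ => ?_) h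
    beta_reduce
    rw [hP, hη.reparam, (hasFDerivAt_timesId hg _).fderiv]
    have h1 : timesId g (inclL n x + s • lastVec n) = inclL m (g x) + s • lastVec m := by
      simp [timesId, initL_inclL, initL_lastVec, lastL_inclL, lastL_lastVec]
    have h2 : initL n (inclL n x + s • lastVec n) = x := by
      simp [initL_inclL, initL_lastVec]
    rw [h1, h2]
    ext v
    change η _ _ _ _ = η _ _ _ _
    congr 1
    ext1 j
    refine Fin.cases ?_ (fun j => ?_) j
    · simp [initL_lastVec, lastL_lastVec]
    · simp [initL_inclL, lastL_inclL]

theorem extd_lineInt [CompleteSpace V] (hη : IsForm η) (a b : ℝ) (n : ℕ) (p : Plot X n)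
    (x : Euc n) : extd (lineInt P a b η) n p x =
      (η (n + 1) (P n p) (inclL n x + b • lastVec n)).compContinuousLinearMap (inclL n) -
      (η (n + 1) (P n p) (inclL n x + a • lastVec n)).compContinuousLinearMap (inclL n) -
      lineInt P a b (extd η) n p x :=
  extDeriv_integral_contract (hη.smooth _ (P n p)) (inclL n) (lastVec n) a b x

theorem isThickening_timesCircle :
    IsThickening fun n (p : Plot X n) => (p.timesCircle : Plot (X × Real.Angle) (n + 1)) := by
  intro n m p g hg
  apply Subtype.ext
  funext y
  refine Prod.ext ?_ ?_
  · exact congrArg p.1 (initL_timesId g y).symm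
  · exact congrArg (fun s : ℝ => (s : Real.Angle)) (lastL_timesId g y).symm

theorem fibreInt_eq_lineInt (η : FormData (X × Real.Angle) V (k + 1)) :
    fibreInt η = (-1 : ℝ) ^ k • lineInt (fun _ p => p.timesCircle) 0 (2 * Real.pi) η := by
  funext n p x
  exact intervalIntegral.integral_smul _ _

theorem isForm_fibreInt [CompleteSpace V] {η : FormData (X × Real.Angle) V (k + 1)}
    (hη : IsForm η) : IsForm (fibreInt η) := by
  rw [fibreInt_eq_lineInt]
  exact (isForm_lineInt isThickening_timesCircle hη (by positivity)).smul _

/-- Translation of the last variable by 2π does not change the plot, and its derivative is the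
identity. -/
theorem periodic_timesCircle {η : FormData (X × Real.Angle) V k} (hη : IsForm η) {n : ℕ}
    (p : Plot X n) (y : Euc (n + 1)) :
    η (n + 1) p.timesCircle (y + (2 * Real.pi) • lastVec n) = η (n + 1) p.timesCircle y := by
  have hg : ContDiff ℝ ∞ fun y : Euc (n + 1) => y + (2 * Real.pi) • lastVec n := by fun_prop
  have h1 : p.timesCircle.reparam _ hg = p.timesCircle := by
    apply Subtype.ext
    funext y
    refine Prod.ext ?_ ?_
    · refine congrArg p.1 ?_
      simp [initL_lastVec]
    · change ((lastL n (y + (2 * Real.pi) • lastVec n) : ℝ) : Real.Angle) = (lastL n y : ℝ)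
      simp [lastL_lastVec]
  have h2 := hη.reparam _ _ p.timesCircle _ hg y
  rw [h1, fderiv_add_const, fderiv_fun_id] at h2
  exact h2.symm

/-- Integration over the fibre commutes with the exterior derivative. -/
theorem extd_fibreInt [CompleteSpace V] {η : FormData (X × Real.Angle) V (k + 1)}
    (hη : IsForm η) : extd (fibreInt η) = fibreInt (extd η) := by
  funext n p x
  have h := extd_lineInt (P := fun n (p : Plot X n) => p.timesCircle) hη 0 (2 * Real.pi) n p x
  rw [periodic_timesCircle hη, zero_smul, add_zero, sub_self, zero_sub] at h
  have h2 : extd (fibreInt η) n p x = (-1 : ℝ) ^ k •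
      extd (lineInt (fun n (p : Plot X n) => p.timesCircle) 0 (2 * Real.pi) η) n p x := by
    rw [fibreInt_eq_lineInt]
    exact extDeriv_smul _ _
  -- Contraction in the first slot anticommutes with d; the passage from (-1)ᵏ to (-1)ᵏ⁺¹ in the
  -- normalisation makes up for this sign.
  rw [h2, h, fibreInt_eq_lineInt, pow_succ, mul_neg_one, neg_smul, smul_neg]
  rfl

end LineIntegral

/-! ### Components of the curvature on a product with a line. -/

section Slices

variable {E : Type*} [NormedAddCommGroup E] [NormedSpace ℝ E] [FiniteDimensional ℝ E]
  {G : Type*} [TopologicalSpace G] [ChartedSpace E G] [Group G] [LieGroup 𝓘(ℝ, E) ∞ G]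

theorem hasFDerivAt_inclL_add {n : ℕ} (c : Euc (n + 1)) (x : Euc n) :
    HasFDerivAt (fun x => inclL n x + c) (inclL n) x :=
  (inclL n).hasFDerivAt.add_const c

theorem curv_inclL {n : ℕ} {α : Euc (n + 1) → Euc (n + 1) →L[ℝ] E} (hα : ContDiff ℝ ∞ α) (x : Euc n)
    (c : Euc (n + 1)) (v w : Euc n) :
    curv G α (inclL n x + c) (inclL n v) (inclL n w) =
      curv G (fun x' => (α (inclL n x' + c)).comp (inclL n)) x v w := by
  have h := curv_pullback (G := G) (h := fun x' => inclL n x' + c) (x := x) (a := α)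
    (hα.differentiable (by simp) _) (by fun_prop) v w
  have hf : fderiv ℝ (fun x => inclL n x + c) = fun _ => inclL n :=
    funext fun y => (hasFDerivAt_inclL_add c y).fderiv
  rw [hf] at h
  exact h.symm

/-- This serves twice: with the time variable, where the one-form has no component along the line,
and with the loop variable, where that component is the Higgs field. -/
theorem curv_lastVec {n : ℕ} {α : Euc (n + 1) → Euc (n + 1) →L[ℝ] E} (hα : ContDiff ℝ ∞ α)
    (x : Euc n) (τ : ℝ) (w : Euc n) :
    curv G α (inclL n x + τ • lastVec n) (lastVec n) (inclL n w) =
      deriv (fun s : ℝ => α (inclL n x + s • lastVec n) (inclL n w)) τ -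
      fderiv ℝ (fun x' => α (inclL n x' + τ • lastVec n) (lastVec n)) x w +
      brkC E G (α (inclL n x + τ • lastVec n) (lastVec n))
        (α (inclL n x + τ • lastVec n) (inclL n w)) := by
  have hd : HasFDerivAt α (fderiv ℝ α (inclL n x + τ • lastVec n)) (inclL n x + τ • lastVec n) :=
    (hα.differentiable (by simp) _).hasFDerivAt
  have hline : HasDerivAt (fun s : ℝ => inclL n x + s • lastVec n) (lastVec n) τ := by
    simpa using ((hasDerivAt_id τ).smul_const (lastVec n)).const_add (inclL n x)
  have h1 : HasDerivAt (fun s : ℝ => α (inclL n x + s • lastVec n) (inclL n w))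
      (fderiv ℝ α (inclL n x + τ • lastVec n) (lastVec n) (inclL n w)) τ :=
    (ContinuousLinearMap.apply ℝ E (inclL n w)).hasFDerivAt.comp_hasDerivAt τ
      (hd.comp_hasDerivAt τ hline)
  have h2 : HasFDerivAt (fun x' => α (inclL n x' + τ • lastVec n) (lastVec n))
      ((ContinuousLinearMap.apply ℝ E (lastVec n)).comp
        ((fderiv ℝ α (inclL n x + τ • lastVec n)).comp (inclL n))) x :=
    (ContinuousLinearMap.apply ℝ E (lastVec n)).hasFDerivAt.comp x
      (hd.comp x (hasFDerivAt_inclL_add _ x))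
  rw [h1.deriv, h2.fderiv]
  rfl

variable {Y : Type*} [DiffeologicalSpace Y]

/-- The contraction of a Chern-Weil form with the last vector. -/
theorem chernWeil_contract {m : ℕ} (f : InvariantPolynomial E G (m + 1)) {a : FormData Y E 1}
    (h : IsForm a) {n : ℕ} (P : Plot Y (n + 1)) (x : Euc n) (τ : ℝ)
    (v : Fin (2 * m + 1) → Euc n) :
    ((chernWeil G f a (n + 1) P (inclL n x + τ • lastVec n)).curryLeft
      (lastVec n)).compContinuousLinearMap (inclL n) v =
    ((m + 1 : ℕ) : ℝ) • ((2 : ℝ) ^ m)⁻¹ • altF (fun z : Fin (2 * m + 1) → Euc n => f.toMap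
      (Fin.cons (curv G (oneL a P) (inclL n x + τ • lastVec n) (lastVec n) (inclL n (z 0)))
        (pairs (curv G (fun x' => (oneL a P (inclL n x' + τ • lastVec n)).comp (inclL n)) x)
          (Fin.tail z)) : Fin (m + 1) → E)) v := by
  have h1 := chernWeil_apply f h P (inclL n x + τ • lastVec n)
    (Fin.cons (lastVec n) (fun j => inclL n (v j)) : Fin (2 * m + 1 + 1) → Euc (n + 1))
  have h2 := altF_pairs_contract f.toMap f.symm
    (F := curv G (oneL a P) (inclL n x + τ • lastVec n)) (fun v w => curv_swap _ _ _ _)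
    (lastVec n) (fun j => inclL n (v j))
  refine (h1.trans (congrArg _ h2)).trans ?_
  rw [altF_map, smul_smul, smul_smul]
  congr 1
  -- The 2(m + 1) slots against the factor 2^(m+1) in the normalisation leave (m + 1) / 2^m.
  · push_cast
    field_simp
    ring
  · refine altF_congr (fun z => ?_) v
    congr 2
    ext1 i
    exact curv_inclL (h.contDiff_oneL P) x _ _ _

theorem chernWeil_inclL {m : ℕ} (f : InvariantPolynomial E G (m + 1)) {a : FormData Y E 1}
    (h : IsForm a) {n : ℕ} (P : Plot Y (n + 1)) (x : Euc n) (c : Euc (n + 1))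
    (v : Fin (2 * (m + 1)) → Euc n) :
    (chernWeil G f a (n + 1) P (inclL n x + c)).compContinuousLinearMap (inclL n) v =
    ((2 : ℝ) ^ (m + 1))⁻¹ • altF (fun z : Fin (2 * (m + 1)) → Euc n => f.toMap
      (pairs (curv G (fun x' => (oneL a P (inclL n x' + c)).comp (inclL n)) x) z)) v := by
  refine (chernWeil_apply f h P (inclL n x + c) fun j => inclL n (v j)).trans ?_
  rw [altF_map]
  congr 1
  refine altF_congr (fun z => ?_) v
  congr 1
  ext1 i
  exact curv_inclL (h.contDiff_oneL P) x _ _ _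

end Slices

/-! ### Paths of forms and transgression. -/

section Paths

open Real

variable {X : Type*} [DiffeologicalSpace X] {V : Type*} [NormedAddCommGroup V] [NormedSpace ℝ V]

/-- A smooth path of forms. -/
structure IsFormPath {k : ℕ} (a : ℝ → FormData X V k) : Prop where
  isForm : ∀ t ∈ Set.Icc (0 : ℝ) 1, IsForm (a t)
  smooth : ∀ (n : ℕ) (p : Plot X n),
    ContDiffOn ℝ ∞ (fun z : Euc n × ℝ => a z.2 n p z.1) {z | z.2 ∈ Set.Icc (0 : ℝ) 1}

theorem smoothTransition_mem_Icc (t : ℝ) : smoothTransition t ∈ Set.Icc (0 : ℝ) 1 :=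
  ⟨smoothTransition.nonneg t, smoothTransition.le_one t⟩

/-- The step function maps [0,1] monotonically onto itself. Monotonicity makes the substitution
valid without any regularity of I. -/
theorem intervalIntegral_smoothTransition {W : Type*} [NormedAddCommGroup W] [NormedSpace ℝ W]
    (I : ℝ → W) : ∫ t in (0 : ℝ)..1, I t =
      ∫ τ in (0 : ℝ)..1, deriv smoothTransition τ • I (smoothTransition τ) := by
  have himg : smoothTransition '' Set.Icc 0 1 = Set.Icc 0 1 := by
    refine Set.Subset.antisymm (Set.image_subset_iff.2 fun t _ => smoothTransition_mem_Icc t) ?_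
    have h := intermediate_value_Icc (zero_le_one (α := ℝ)) (smoothTransition.continuous.continuousOn)
    rwa [smoothTransition.zero, smoothTransition.one] at h
  have hd : ∀ τ, HasDerivAt smoothTransition (deriv smoothTransition τ) τ := fun τ =>
    ((smoothTransition.contDiff (n := ⊤)).differentiable (by simp) τ).hasDerivAt
  have h := MeasureTheory.integral_image_eq_integral_deriv_smul_of_monotoneOn
    (measurableSet_Icc (a := (0 : ℝ)) (b := 1)) (fun τ _ => (hd τ).hasDerivWithinAt)
    (smoothTransition.monotone.monotoneOn _) I
  rw [himg] at h
  rw [intervalIntegral.integral_of_le zero_le_one, intervalIntegral.integral_of_le zero_le_one,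
    ← MeasureTheory.integral_Icc_eq_integral_Ioc, ← MeasureTheory.integral_Icc_eq_integral_Ioc, h]

/-- For a plot `p` of `X`, the plot `(x, s) ↦ (p x, s)` of `X × ℝ`. -/
def Plot.timesLine {n : ℕ} (p : Plot X n) : Plot (X × ℝ) (n + 1) :=
  ⟨fun y => (p.1 (initL n y), lastL n y), isPlot_reparam p.2 (initL n).contDiff,
    (lastL n).contDiff.isPlot⟩

theorem isThickening_timesLine :
    IsThickening fun n (p : Plot X n) => (p.timesLine : Plot (X × ℝ) (n + 1)) := by
  intro n m p g hg
  apply Subtype.ext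
  funext y
  exact Prod.ext (congrArg p.1 (initL_timesId g y).symm) (lastL_timesId g y).symm

/-- The form on `X × ℝ` with slices `a (χ s)`, where `χ` is the smooth step function. -/
def pathTotal {k : ℕ} (a : ℝ → FormData X V k) : FormData (X × ℝ) V k :=
  fun n p x => a (smoothTransition (p.1 x).2) n ⟨fun y => (p.1 y).1, p.2.1⟩ x

/-- The step function takes all its values in [0,1], so smoothness of the path up to the boundary
gives smoothness on the whole line. -/
theorem isForm_pathTotal {k : ℕ} {a : ℝ → FormData X V k} (h : IsFormPath a) :
    IsForm (pathTotal a) where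
  smooth n p := by
    have h1 : ContDiff ℝ ∞ fun x : Euc n => (x, smoothTransition (p.1 x).2) :=
      contDiff_id.prodMk (smoothTransition.contDiff.comp p.2.2.contDiff)
    have h2 := (h.smooth n ⟨fun y => (p.1 y).1, p.2.1⟩).comp (s := Set.univ) h1.contDiffOn
      fun x _ => smoothTransition_mem_Icc _
    exact contDiffOn_univ.1 h2
  reparam n m p g hg x :=
    (h.isForm _ (smoothTransition_mem_Icc _)).reparam n m ⟨fun y => (p.1 y).1, p.2.1⟩ g hg x

/-- Since the step function never leaves [0,1], the derivative within [0,1] is enough for a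
two-sided chain rule, also at the ends. -/
theorem IsFormPath.hasDerivAt {k : ℕ} {a : ℝ → FormData X V k} (h : IsFormPath a) (n : ℕ)
    (p : Plot X n) (x : Euc n) (τ : ℝ) :
    HasDerivAt (fun s => a (smoothTransition s) n p x)
      (deriv smoothTransition τ • timeDeriv a (smoothTransition τ) n p x) τ := by
  have h1 : ContDiffOn ℝ ∞ (fun r => a r n p x) (Set.Icc 0 1) :=
    (h.smooth n p).comp (contDiff_const.prodMk contDiff_id).contDiffOn fun r hr => hr
  have h2 := (h1.differentiableOn (by simp) _ (smoothTransition_mem_Icc τ)).hasDerivWithinAt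
  have h3 : HasDerivAt smoothTransition (deriv smoothTransition τ) τ :=
    ((smoothTransition.contDiff (n := ⊤)).differentiable (by simp) τ).hasDerivAt
  exact h2.scomp_hasDerivAt τ h3 fun s => smoothTransition_mem_Icc s

theorem oneL_pathTotal {a : ℝ → FormData X V 1} (h : IsFormPath a) {n : ℕ} (p : Plot X n)
    (y : Euc (n + 1)) : oneL (pathTotal a) p.timesLine y =
      (oneL (a (smoothTransition (lastL n y))) p (initL n y)).comp (initL n) := by
  ext v
  have h1 := (h.isForm _ (smoothTransition_mem_Icc (lastL n y))).reparam _ _ p (initL n)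
    (initL n).contDiff y
  rw [(initL n).fderiv] at h1
  exact DFunLike.congr_fun h1 fun _ => v

theorem initL_add_smul {n : ℕ} (x : Euc n) (τ : ℝ) : initL n (inclL n x + τ • lastVec n) = x := by
  simp [initL_inclL, initL_lastVec]

theorem lastL_add_smul {n : ℕ} (x : Euc n) (τ : ℝ) : lastL n (inclL n x + τ • lastVec n) = τ := by
  simp [lastL_inclL, lastL_lastVec]

variable {E : Type*} [NormedAddCommGroup E] [NormedSpace ℝ E] [FiniteDimensional ℝ E]
  {G : Type*} [TopologicalSpace G] [ChartedSpace E G] [Group G] [LieGroup 𝓘(ℝ, E) ∞ G]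

theorem oneL_pathTotal_comp_inclL {a : ℝ → FormData X V 1} (h : IsFormPath a) {n : ℕ} (p : Plot X n)
    (τ : ℝ) : (fun x => (oneL (pathTotal a) p.timesLine (inclL n x + τ • lastVec n)).comp (inclL n)) =
      oneL (a (smoothTransition τ)) p := by
  ext x v
  rw [oneL_pathTotal h, initL_add_smul, lastL_add_smul, ContinuousLinearMap.comp_apply,
    ContinuousLinearMap.comp_apply, initL_inclL]

variable (G) in
/-- The integrand `k f(B_t, F_t, …, F_t)` of the relative Chern-Simons form. -/
def chernSimonsIntegrand {m : ℕ} (f : InvariantPolynomial E G (m + 1)) (a : ℝ → FormData X E 1)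
    (t : ℝ) : FormData X ℝ (2 * m + 1) :=
  ((m + 1 : ℕ) : ℝ) • wedge f.toMap
    (Fin.cons ⟨1, timeDeriv a t⟩ fun _ : Fin m => ⟨2, curvature G (a t)⟩) (2 * m + 1)
    (by simp [Fin.sum_univ_succ]; ring)

/-- The total one-form annihilates ∂_s, so its curvature contracted with ∂_s is its s-derivative
χ′(s) B_χ(s), while on the slices it is F_χ(s). -/
theorem smul_chernSimonsIntegrand {m : ℕ} (f : InvariantPolynomial E G (m + 1))
    {a : ℝ → FormData X E 1} (h : IsFormPath a) {n : ℕ} (p : Plot X n) (x : Euc n) (τ : ℝ) :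
    deriv smoothTransition τ • chernSimonsIntegrand G f a (smoothTransition τ) n p x =
      ((chernWeil G f (pathTotal a) (n + 1) p.timesLine (inclL n x + τ • lastVec n)).curryLeft
        (lastVec n)).compContinuousLinearMap (inclL n) := by
  have hα := (isForm_pathTotal h).contDiff_oneL p.timesLine
  ext v
  rw [chernWeil_contract f (isForm_pathTotal h), oneL_pathTotal_comp_inclL h,
    ← two_curvature (h.isForm _ (smoothTransition_mem_Icc τ))]
  rw [ContinuousAlternatingMap.smul_apply, chernSimonsIntegrand, Pi.smul_apply, Pi.smul_apply,
    Pi.smul_apply, ContinuousAlternatingMap.smul_apply, wedge_cons_apply, smul_comm]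
  congr 1
  rw [smul_comm]
  congr 1
  rw [← altF_smul]
  refine altF_congr (fun z => ?_) v
  have hcons : ∀ (b : E) (u : Fin m → E), deriv smoothTransition τ •
      f.toMap (Fin.cons b u : Fin (m + 1) → E) =
      f.toMap (Fin.cons (deriv smoothTransition τ • b) u : Fin (m + 1) → E) := by
    intro b u
    have := f.toMap.map_update_smul (Fin.cons b u : Fin (m + 1) → E) 0 (deriv smoothTransition τ) b
    rw [Fin.update_cons_zero, Fin.update_cons_zero] at this
    exact this.symm
  rw [hcons]
  congr 2
  rw [curv_lastVec hα]
  have h1 : (fun x' => oneL (pathTotal a) p.timesLine (inclL n x' + τ • lastVec n) (lastVec n)) =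
      fun _ => 0 := by
    funext x'
    rw [oneL_pathTotal h, ContinuousLinearMap.comp_apply, initL_lastVec, map_zero]
  have h2 : (fun s : ℝ => oneL (pathTotal a) p.timesLine (inclL n x + s • lastVec n)
      (inclL n (z 0))) = fun s => a (smoothTransition s) n p x fun _ => z 0 := by
    funext s
    rw [oneL_pathTotal h, initL_add_smul, lastL_add_smul, ContinuousLinearMap.comp_apply,
      initL_inclL, oneL_apply]
  have h3 := (ContinuousAlternatingMap.apply ℝ (Euc n) E fun _ : Fin 1 =>
    z 0).hasFDerivAt.comp_hasDerivAt τ (h.hasDerivAt n p x τ)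
  have h4 : HasDerivAt (fun s => a (smoothTransition s) n p x fun _ => z 0) _ τ := h3
  rw [congrFun h1 x, h1, h2, h4.deriv]
  simp
  rfl

/-- The relative Chern-Simons form as the integral of a Chern-Weil form. -/
theorem chernSimons_eq_lineInt {m : ℕ} (f : InvariantPolynomial E G (m + 1)) {a : ℝ → FormData X E 1}
    (h : IsFormPath a) : chernSimons G f a =
      lineInt (fun _ p => p.timesLine) 0 1 (chernWeil G f (pathTotal a)) := by
  funext n p x
  rw [chernSimons, ← intervalIntegral.integral_smul]
  refine (intervalIntegral_smoothTransition (chernSimonsIntegrand G f a · n p x)).trans ?_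
  exact intervalIntegral.integral_congr fun τ _ => smul_chernSimonsIntegrand f h p x τ

theorem isForm_chernSimons {m : ℕ} (f : InvariantPolynomial E G (m + 1)) {a : ℝ → FormData X E 1}
    (h : IsFormPath a) : IsForm (chernSimons G f a) := by
  rw [chernSimons_eq_lineInt f h]
  exact isForm_lineInt isThickening_timesLine (isForm_chernWeil f (isForm_pathTotal h)) zero_le_one

/-- The transgression formula. -/
theorem extd_chernSimons {m : ℕ} (f : InvariantPolynomial E G (m + 1)) {a : ℝ → FormData X E 1}
    (h : IsFormPath a) : extd (chernSimons G f a) = chernWeil G f (a 1) - chernWeil G f (a 0) := by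
  -- The boundary terms: on a slice the Chern-Weil form of the total one-form is that of the
  -- connection at the corresponding time.
  have hend : ∀ (n : ℕ) (p : Plot X n) (x : Euc n) (τ t : ℝ), smoothTransition τ = t →
      (chernWeil G f (pathTotal a) (n + 1) p.timesLine
        (inclL n x + τ • lastVec n)).compContinuousLinearMap (inclL n) =
      chernWeil G f (a t) n p x := by
    rintro n p x τ t rfl
    ext v
    refine (chernWeil_inclL f (isForm_pathTotal h) p.timesLine x (τ • lastVec n) v).trans ?_
    rw [oneL_pathTotal_comp_inclL h]
    exact (chernWeil_apply f (h.isForm _ (smoothTransition_mem_Icc τ)) p x v).symm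
  rw [chernSimons_eq_lineInt f h]
  funext n p x
  rw [extd_lineInt (isForm_chernWeil f (isForm_pathTotal h)), extd_chernWeil f (isForm_pathTotal h),
    hend n p x 1 1 smoothTransition.one, hend n p x 0 0 smoothTransition.zero]
  -- The Chern-Weil form being closed, only the boundary terms remain.
  have h0 : lineInt (fun n (p : Plot X n) => p.timesLine) 0 1
      (0 : FormData (X × ℝ) ℝ (2 * m + 1 + 1 + 1)) n p x = 0 := by
    rw [lineInt]
    refine Eq.trans (intervalIntegral.integral_congr (g := fun _ => 0) fun s _ => ?_) (by simp)
    rfl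
  rw [h0, sub_zero]
  rfl

end Paths

/-! ### Descent of forms along maps with local lifts. -/

section Descent

variable {X Y : Type*} [DiffeologicalSpace X] [DiffeologicalSpace Y]
  {V : Type*} [NormedAddCommGroup V] [NormedSpace ℝ V] {k : ℕ}

/-- The values of a form are local. -/
theorem IsForm.apply_congr {η : FormData X V k} (hη : IsForm η) {n : ℕ} {p q : Plot X n} {x : Euc n}
    (h : p.1 =ᶠ[𝓝 x] q.1) : η n p x = η n q x := by
  obtain ⟨u, hu, huo, hxu⟩ := eventually_nhds_iff.1 h
  -- Precomposed with a retraction into the set of agreement, the two plots become equal, and near x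
  -- the retraction changes nothing.
  obtain ⟨r, hr, hru, hrx⟩ := exists_smooth_retraction huo hxu
  have h1 : p.reparam r hr = q.reparam r hr := Subtype.ext (funext fun y => hu _ (hru y))
  have h2 : fderiv ℝ r x = ContinuousLinearMap.id ℝ (Euc n) := by
    rw [Filter.EventuallyEq.fderiv_eq hrx, fderiv_fun_id]
  have h3 := hη.reparam n n p r hr x
  have h4 := hη.reparam n n q r hr x
  rw [h1, h4, hrx.self_of_nhds, h2] at h3
  exact h3.symm

/-- `π` has local lifts: plots of `Y` lift locally to plots of `X`. -/
def HasLocalLifts (π : X → Y) : Prop :=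
  ∀ (n : ℕ) (p : Plot Y n) (x : Euc n), ∃ q : Plot X n, ∀ᶠ y in 𝓝 x, π (q.1 y) = p.1 y

/-- The form `η` takes the same values on plots of `X` with the same image in `Y`. -/
def IsBasic (π : X → Y) (η : FormData X V k) : Prop :=
  ∀ (n : ℕ) (q q' : Plot X n) (x : Euc n), (∀ᶠ y in 𝓝 x, π (q.1 y) = π (q'.1 y)) →
    η n q x = η n q' x

/-- Pullback along a map with local lifts is injective. -/
theorem pullback_injective {π : X → Y} (hπ : DSmooth π) (hl : HasLocalLifts π)
    {η ζ : FormData Y V k} (hη : IsForm η) (hζ : IsForm ζ)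
    (h : pullback π hπ η = pullback π hπ ζ) : η = ζ := by
  funext n p x
  obtain ⟨q, hq⟩ := hl n p x
  have hq' : (q.map π hπ).1 =ᶠ[𝓝 x] p.1 := hq
  rw [← hη.apply_congr hq', ← hζ.apply_congr hq']
  exact congrFun (congrFun (congrFun h n) q) x

/-- The form on `Y` to which a basic form on `X` descends. -/
def descend {π : X → Y} (hl : HasLocalLifts π) (η : FormData X V k) : FormData Y V k :=
  fun n p x => η n (hl n p x).choose x

theorem descend_apply {π : X → Y} (hl : HasLocalLifts π) {η : FormData X V k} (hb : IsBasic π η)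
    {n : ℕ} {p : Plot Y n} {q : Plot X n} {x : Euc n} (h : ∀ᶠ y in 𝓝 x, π (q.1 y) = p.1 y) :
    descend hl η n p x = η n q x := by
  refine hb n _ q x ?_
  filter_upwards [h, (hl n p x).choose_spec] with y h1 h2
  rw [h1, h2]

/-- A lift near x is also a lift near each nearby point, so around x the descended form is given by
a single plot of X. -/
theorem isForm_descend {π : X → Y} (hl : HasLocalLifts π) {η : FormData X V k} (hη : IsForm η)
    (hb : IsBasic π η) : IsForm (descend hl η) where
  smooth n p := contDiff_iff_contDiffAt.2 fun x => by
    obtain ⟨q, hq⟩ := hl n p x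
    refine (hη.smooth n q).contDiffAt.congr_of_eventuallyEq ?_
    filter_upwards [hq.eventually_nhds] with y hy
    exact descend_apply hl hb hy
  reparam n m p g hg x := by
    obtain ⟨q, hq⟩ := hl m p (g x)
    rw [descend_apply hl hb hq, ← hη.reparam n m q g hg x]
    exact descend_apply hl hb (hg.continuous.continuousAt.eventually hq)

theorem pullback_descend {π : X → Y} (hπ : DSmooth π) (hl : HasLocalLifts π) {η : FormData X V k}
    (hb : IsBasic π η) : pullback π hπ (descend hl η) = η := by
  funext n p x
  exact descend_apply hl hb (Filter.Eventually.of_forall fun _ => rfl)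

/-- A constant plot is its own reparametrisation by a constant map, which has derivative zero. -/
theorem IsForm.oneForm_const {η : FormData X V 1} (hη : IsForm η) {n : ℕ} {p : Plot X n} {c : X}
    (h : ∀ x, p.1 x = c) (x : Euc n) : η n p x = 0 := by
  have h1 : p.reparam (fun _ : Euc n => x) contDiff_const = p :=
    Subtype.ext (funext fun y => (h x).trans (h y).symm)
  have h2 := hη.reparam n n p (fun _ => x) contDiff_const x
  rw [h1, fderiv_fun_const] at h2
  rw [h2]
  ext v
  exact (η n p x).map_coord_zero 0 rfl

end Descent

/-! ### The form dθ in terms of local lifts. -/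

section Angle

/-- Local lifts of plots of the circle. -/
theorem exists_angle_lift {n : ℕ} {θ : Euc n → Real.Angle} (hθ : IsPlot θ) (x : Euc n) :
    ∃ l : Euc n → ℝ, ContDiff ℝ ∞ l ∧ ∀ᶠ y in 𝓝 x, θ y = (l y : Real.Angle) := by
  obtain ⟨l, hl, h⟩ := hθ x
  exact ⟨l, hl.contDiff, h⟩

/-- Near x a continuous lift moves by less than π, and in that range `toReal` inverts the projection
to the circle. -/
theorem dAngle_eq {n : ℕ} {θ : Euc n → Real.Angle} {l : Euc n → ℝ} {x : Euc n}
    (hl : ContinuousAt l x) (h : ∀ᶠ y in 𝓝 x, θ y = (l y : Real.Angle)) :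
    dAngle θ x = fderiv ℝ l x := by
  have h1 : ∀ᶠ y in 𝓝 x, |l y - l x| < Real.pi := by
    have h2 : Filter.Tendsto (fun y => |l y - l x|) (𝓝 x) (𝓝 0) := by
      have := (hl.sub (continuousAt_const (y := l x))).abs.tendsto
      simpa using this
    exact h2.eventually (gt_mem_nhds Real.pi_pos)
  have h2 : (fun y => (θ y - θ x).toReal) =ᶠ[𝓝 x] fun y => l y - l x := by
    filter_upwards [h, h1] with y hy hy'
    rw [hy, h.self_of_nhds, ← Real.Angle.coe_sub, Real.Angle.toReal_coe_eq_self_iff]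
    exact ⟨(abs_lt.1 hy').1, (abs_lt.1 hy').2.le⟩
  rw [dAngle, h2.fderiv_eq, fderiv_sub_const]

end Angle

/-! ### Invariance of the caloron form. -/

section CaloronForm

variable {E : Type*} [NormedAddCommGroup E] [NormedSpace ℝ E]
  {G : Type*} [TopologicalSpace G] [ChartedSpace E G] [Group G] [LieGroup 𝓘(ℝ, E) ∞ G]
  {Q : Type*} [DiffeologicalSpace Q] [MulAction (Loop E G)ᵐᵒᵖ Q]
  {M : Type*} [TopologicalSpace M] [DiffeologicalSpace M]

theorem Loop.mul_apply (γ δ : Loop E G) (θ : Real.Angle) : (γ * δ) θ = γ θ * δ θ := rfl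

theorem Loop.inv_apply (γ : Loop E G) (θ : Real.Angle) : γ⁻¹ θ = (γ θ)⁻¹ := rfl

theorem Loop.one_apply (θ : Real.Angle) : (1 : Loop E G) θ = 1 := rfl

/-- The behaviour of connections under the action of plots of the loop group. -/
theorem IsLoopConnection.oneL_act (P : LoopBundle E G Q M) {A : LoopFormData E Q 1}
    (hA : IsLoopConnection E G (fun q γ => q <• γ) A) {n : ℕ} (q q' : Plot Q n)
    (c : Plot (Loop E G) n) (h : ∀ x, q'.1 x = q.1 x <• c.1 x) (θ : Real.Angle) (x : Euc n) :
    oneL (A θ) q' x = (Ad E (c.1 x θ)⁻¹).comp (oneL (A θ) q x) +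
      leftLogDeriv E (fun z => c.1 z θ) x := by
  -- Equivariance is assumed for fixed loops only. The two-parameter plot q(y₁) c(y₂) restricts on
  -- the diagonal to q c, with y₂ fixed to a translate of q, and with y₁ fixed to an orbit map. The
  -- value at the diagonal vector (v, v) is the sum of those at (v, 0) and (0, v).
  let e : Euc (n + n) ≃L[ℝ] Euc n × Euc n := ContinuousLinearEquiv.ofFinrankEq (by simp)
  have he1 : ContDiff ℝ ∞ fun y => (e y).1 := contDiff_fst.comp e.contDiff
  have he2 : ContDiff ℝ ∞ fun y => (e y).2 := contDiff_snd.comp e.contDiff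
  let R : Plot Q (n + n) := ⟨fun y => q.1 (e y).1 <• c.1 (e y).2,
    P.act_smooth (n + n) (q.reparam _ he1) (c.reparam _ he2)⟩
  have hF := hA.isLoopForm.isForm θ
  have key : ∀ (L : Euc n →L[ℝ] Euc n × Euc n) (b : Euc n × Euc n) (v : Euc n),
      oneL (A θ) (R.reparam (fun y => e.symm (L y + b)) (by fun_prop)) x v =
        oneL (A θ) R (e.symm (L x + b)) (e.symm (L v)) := by
    intro L b v
    have h1 := hF.reparam n (n + n) R (fun y => e.symm (L y + b)) (by fun_prop) x
    have h2 : HasFDerivAt (fun y => e.symm (L y + b))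
        ((e.symm : (Euc n × Euc n) →L[ℝ] Euc (n + n)).comp L) x :=
      (e.symm : (Euc n × Euc n) →L[ℝ] Euc (n + n)).hasFDerivAt.comp x (L.hasFDerivAt.add_const b)
    rw [oneL_apply, h1, h2.fderiv]
    rfl
  ext v
  let i1 : Euc n →L[ℝ] Euc n × Euc n := ContinuousLinearMap.inl ℝ _ _
  let i2 : Euc n →L[ℝ] Euc n × Euc n := ContinuousLinearMap.inr ℝ _ _
  have k1 := key (i1 + i2) 0 v
  have k2 := key i1 (i2 x) v
  have k3 := key i2 (i1 x) v
  have hq' : R.reparam (fun y => e.symm ((i1 + i2) y + 0)) (by fun_prop) = q' := by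
    apply Subtype.ext
    funext y
    simp [R, Plot.reparam, i1, i2, h]
  have h2 : oneL (A θ) (R.reparam (fun y => e.symm (i1 y + i2 x)) (by fun_prop)) x v =
      Ad E (c.1 x θ)⁻¹ (oneL (A θ) q x v) := by
    have h3 := hA.equivariant (c.1 x) n q (R.reparam (fun y => e.symm (i1 y + i2 x)) (by fun_prop))
      (fun y => by simp [R, Plot.reparam, i1, i2]) θ x
    rw [oneL_apply, h3]
    rfl
  have h3 : oneL (A θ) (R.reparam (fun y => e.symm (i2 y + i1 x)) (by fun_prop)) x v =
      leftLogDeriv E (fun z => c.1 z θ) x v := by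
    have h3 := hA.vertical (q.1 x) n c (R.reparam (fun y => e.symm (i2 y + i1 x)) (by fun_prop))
      (fun y => by simp [R, Plot.reparam, i1, i2]) θ x
    rw [oneL_apply, h3]
    rfl
  rw [hq'] at k1
  rw [h2] at k2
  rw [h3] at k3
  have hx1 : (i1 + i2) x + 0 = i1 x + i2 x := by simp
  have hx2 : i2 x + i1 x = i1 x + i2 x := add_comm _ _
  have hv : e.symm ((i1 + i2) v) = e.symm (i1 v) + e.symm (i2 v) := by
    rw [add_apply, map_add]
  rw [hx1, hv, (oneL (A θ) R _).map_add] at k1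
  rw [hx2] at k3
  rw [k1, ← k2, ← k3]
  rfl

/-- The one-form `A_q(θ) + Φ(q)(θ) dθ` on the domain of a plot `(q, θ)` of `Q × S¹`. -/
def higgsConn (A : LoopFormData E Q 1) (Φ : Q → Real.Angle → E) {n : ℕ} (q : Plot Q n)
    (θ : Euc n → Real.Angle) (x : Euc n) : Euc n →L[ℝ] E :=
  oneL (A (θ x)) q x + (dAngle θ x).smulRight (Φ (q.1 x) (θ x))

/-- By the chain rule the logarithmic derivative of y ↦ c_y(θ(y)) is the one with frozen θ, which is
the inhomogeneous term of the connection, plus c⁻¹∂c dθ, which is that of the Higgs field. -/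
theorem higgsConn_act (P : LoopBundle E G Q M) {A : LoopFormData E Q 1} {Φ : Q → Real.Angle → E}
    (hA : IsLoopConnection E G (fun q γ => q <• γ) A) (hΦ : IsHiggs E G (fun q γ => q <• γ) Φ) {n : ℕ}
    (q q' : Plot Q n) (c : Plot (Loop E G) n) (h : ∀ x, q'.1 x = q.1 x <• c.1 x)
    {θ : Euc n → Real.Angle} (hθ : IsPlot θ) (x : Euc n) :
    higgsConn A Φ q' θ x = (Ad E (c.1 x (θ x))⁻¹).comp (higgsConn A Φ q θ x) +
      leftLogDeriv E (fun y => c.1 y (θ y)) x := by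
  obtain ⟨l, hl, hlx⟩ := exists_angle_lift hθ x
  have hθx : θ x = (l x : Real.Angle) := hlx.self_of_nhds
  have hc : ContMDiff 𝓘(ℝ, Euc n × ℝ) 𝓘(ℝ, E) ∞ fun z : Euc n × ℝ => c.1 z.1 (z.2 : Real.Angle) :=
    c.2
  have hmd : MDifferentiableAt 𝓘(ℝ, Euc n × ℝ) 𝓘(ℝ, E)
      (fun z : Euc n × ℝ => c.1 z.1 (z.2 : Real.Angle)) (x, l x) :=
    hc.mdifferentiable (by simp) _
  have hld : HasFDerivAt l (fderiv ℝ l x) x := (hl.differentiable (by simp) x).hasFDerivAt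
  have h1 : leftLogDeriv E (fun y => c.1 y (θ y)) x =
      (leftLogDeriv E (fun z : Euc n × ℝ => c.1 z.1 (z.2 : Real.Angle)) (x, l x)).comp
        ((ContinuousLinearMap.id ℝ (Euc n)).prod (fderiv ℝ l x)) := by
    have h2 : (fun y => c.1 y (θ y)) =ᶠ[𝓝 x] fun y => c.1 y (l y : Real.Angle) := by
      filter_upwards [hlx] with y hy
      rw [hy]
    have h3 : HasFDerivAt (fun y => (y, l y))
        ((ContinuousLinearMap.id ℝ (Euc n)).prod (fderiv ℝ l x)) x := (hasFDerivAt_id x).prodMk hld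
    rw [leftLogDeriv_congr h2, ← h3.fderiv]
    exact leftLogDeriv_comp (E := E) (h := fun y => (y, l y)) hmd h3.differentiableAt
  have h2 : leftLogDeriv E (fun y => c.1 y (θ x)) x =
      (leftLogDeriv E (fun z : Euc n × ℝ => c.1 z.1 (z.2 : Real.Angle)) (x, l x)).comp
        (ContinuousLinearMap.inl ℝ (Euc n) ℝ) := by
    have h3 : HasFDerivAt (fun y : Euc n => (y, l x)) (ContinuousLinearMap.inl ℝ (Euc n) ℝ) x :=
      hasFDerivAt_prodMk_left _ _
    rw [hθx, ← h3.fderiv]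
    exact leftLogDeriv_comp (E := E) (h := fun y => (y, l x)) hmd h3.differentiableAt
  have h3 : leftLogDeriv E (fun r : ℝ => c.1 x (r : Real.Angle)) (l x) =
      (leftLogDeriv E (fun z : Euc n × ℝ => c.1 z.1 (z.2 : Real.Angle)) (x, l x)).comp
        (ContinuousLinearMap.inr ℝ (Euc n) ℝ) := by
    have h3 : HasFDerivAt (fun s : ℝ => (x, s)) (ContinuousLinearMap.inr ℝ (Euc n) ℝ) (l x) :=
      hasFDerivAt_prodMk_right _ _
    rw [← h3.fderiv]
    exact leftLogDeriv_comp (E := E) (h := fun s => (x, s)) hmd h3.differentiableAt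
  have h4 := hΦ.equivariant (q.1 x) (c.1 x) (l x)
  rw [← hθx] at h4
  ext v
  rw [higgsConn, higgsConn, hA.oneL_act P q q' c h, h x, h4, h1, h2, h3, dAngle_eq hl.continuous.continuousAt hlx]
  simp only [add_apply, ContinuousLinearMap.comp_apply, ContinuousLinearMap.smulRight_apply,
    ContinuousLinearMap.inl_apply, ContinuousLinearMap.inr_apply, ContinuousLinearMap.prod_apply,
    ContinuousLinearMap.id_apply, map_add, map_smul, smul_add]
  have h5 : ((v, fderiv ℝ l x v) : Euc n × ℝ) = (v, 0) + fderiv ℝ l x v • ((0 : Euc n), (1 : ℝ)) := by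
    simp
  rw [h5, map_add, map_smul]
  abel

variable [DiffeologicalSpace G] [IsManifoldDiffeology E G]

theorem Plot.contMDiff {n : ℕ} {g : Euc n → G} (h : IsPlot g) :
    ContMDiff 𝓘(ℝ, Euc n) 𝓘(ℝ, E) ∞ g :=
  (IsManifoldDiffeology.isPlot_iff (E := E)).1 h

theorem oneL_caloronForm (A : LoopFormData E Q 1) (Φ : Q → Real.Angle → E) {n : ℕ}
    (p : Plot (Q × Real.Angle × G) n) (x : Euc n) :
    oneL (caloronForm A Φ) p x = (Ad E (p.1 x).2.2⁻¹).comp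
      (higgsConn A Φ ⟨fun y => (p.1 y).1, p.2.1⟩ (fun y => (p.1 y).2.1) x) +
      leftLogDeriv E (fun y => (p.1 y).2.2) x := rfl

theorem caloronForm_eq_oneForm (A : LoopFormData E Q 1) (Φ : Q → Real.Angle → E) {n : ℕ}
    (p : Plot (Q × Real.Angle × G) n) (x : Euc n) :
    caloronForm A Φ n p x = oneForm ((Ad E (p.1 x).2.2⁻¹).comp
      (higgsConn A Φ ⟨fun y => (p.1 y).1, p.2.1⟩ (fun y => (p.1 y).2.1) x) +
      leftLogDeriv E (fun y => (p.1 y).2.2) x) := by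
  rw [← oneL_caloronForm, oneForm_oneL]

/-- Invariance of the caloron form under the action of the loop group. -/
theorem caloronForm_act (P : LoopBundle E G Q M) {A : LoopFormData E Q 1} {Φ : Q → Real.Angle → E}
    (hA : IsLoopConnection E G (fun q γ => q <• γ) A) (hΦ : IsHiggs E G (fun q γ => q <• γ) Φ) {n : ℕ}
    (p p' : Plot (Q × Real.Angle × G) n) (c : Plot (Loop E G) n)
    (h : ∀ x, p'.1 x = ((p.1 x).1 <• c.1 x, (p.1 x).2.1, (c.1 x (p.1 x).2.1)⁻¹ * (p.1 x).2.2))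
    (x : Euc n) : caloronForm A Φ n p' x = caloronForm A Φ n p x := by
  have hθ : (fun y => (p'.1 y).2.1) = fun y => (p.1 y).2.1 := by
    funext y
    rw [h]
  have hg : (fun y => (p'.1 y).2.2) = fun y => (c.1 y (p.1 y).2.1)⁻¹ * (p.1 y).2.2 := by
    funext y
    rw [h]
  obtain ⟨l, hl, hlx⟩ := exists_angle_lift p.2.2.1 x
  have hc : ContMDiff 𝓘(ℝ, Euc n × ℝ) 𝓘(ℝ, E) ∞ fun z : Euc n × ℝ => c.1 z.1 (z.2 : Real.Angle) :=
    c.2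
  have hd : ContMDiffAt 𝓘(ℝ, Euc n) 𝓘(ℝ, E) ∞ (fun y => c.1 y (p.1 y).2.1) x := by
    have h2 : ContDiff ℝ ∞ fun y : Euc n => (y, l y) := contDiff_id.prodMk hl
    refine (hc.comp h2.contMDiff x).congr_of_eventuallyEq ?_
    filter_upwards [hlx] with y hy
    rw [hy]
    rfl
  have hd' := hd.mdifferentiableAt (by simp)
  have hdi := hd.inv.mdifferentiableAt (by simp)
  have hgd := (Plot.contMDiff (E := E) p.2.2.2).mdifferentiable (by simp) x
  have hact := higgsConn_act P hA hΦ ⟨fun y => (p.1 y).1, p.2.1⟩ ⟨fun y => (p'.1 y).1, p'.2.1⟩ c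
    (fun y => by simp only [h]) p.2.2.1 x
  -- The product of c(θ) and its inverse is constant, so the inhomogeneous term from (A, Φ) cancels
  -- the one from the Maurer-Cartan form of c(θ)⁻¹ g.
  have h0 := leftLogDeriv_mul (E := E) hd' hdi
  simp only [mul_inv_cancel, leftLogDeriv_const, inv_inv] at h0
  rw [caloronForm_eq_oneForm, caloronForm_eq_oneForm, hg, hθ, leftLogDeriv_mul (E := E) hdi hgd, hact,
    congrFun hg x]
  congr 1
  rw [mul_inv_rev, inv_inv, Ad_mul, ContinuousLinearMap.comp_assoc, ContinuousLinearMap.comp_add,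
    ← ContinuousLinearMap.comp_assoc, ← Ad_mul, mul_inv_cancel, Ad_one, ContinuousLinearMap.id_comp,
    ContinuousLinearMap.comp_add, ← add_assoc, add_left_inj, add_assoc, ← ContinuousLinearMap.comp_add,
    ← h0, ContinuousLinearMap.comp_zero, add_zero]

end CaloronForm

/-! ### One-forms with parameters. -/

section FormPath

variable {X : Type*} [DiffeologicalSpace X] {V : Type*} [NormedAddCommGroup V] [NormedSpace ℝ V]
  {U : Type*} [NormedAddCommGroup U] [NormedSpace ℝ U]

theorem contDiffWithinAt_oneForm {W : Type*} [NormedAddCommGroup W] [NormedSpace ℝ W]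
    {L : U → W →L[ℝ] V} {s : Set U} {x : U} (h : ContDiffWithinAt ℝ ∞ L s x) :
    ContDiffWithinAt ℝ ∞ (fun y => oneForm (L y)) s x :=
  (ContinuousAlternatingMap.ofSubsingletonLIE (𝕜 := ℝ) (E := W) (F := V)
    (0 : Fin 1)).toContinuousLinearEquiv.contDiff.contDiffAt.comp_contDiffWithinAt x h

theorem contDiffWithinAt_apply_one {W : Type*} [NormedAddCommGroup W] [NormedSpace ℝ W]
    {L : U → W [⋀^Fin 1]→L[ℝ] V} {s : Set U} {x : U} (h : ContDiffWithinAt ℝ ∞ L s x) :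
    ContDiffWithinAt ℝ ∞ (fun y => (ContinuousAlternatingMap.ofSubsingleton ℝ W V (0 : Fin 1)).symm
      (L y)) s x :=
  (ContinuousAlternatingMap.ofSubsingletonLIE (𝕜 := ℝ) (E := W) (F := V)
    (0 : Fin 1)).symm.toContinuousLinearEquiv.contDiff.contDiffAt.comp_contDiffWithinAt x h

theorem contDiff_slice {F : U × ℝ → V} (h : ContDiffOn ℝ ∞ F {z | z.2 ∈ Set.Icc (0 : ℝ) 1}) {t : ℝ}
    (ht : t ∈ Set.Icc (0 : ℝ) 1) : ContDiff ℝ ∞ fun x => F (x, t) := by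
  have h1 : ContDiffOn ℝ ∞ (fun x : U => (x, t)) Set.univ := ContDiff.contDiffOn (by fun_prop)
  have hm : Set.MapsTo (fun x : U => (x, t)) Set.univ {z : U × ℝ | z.2 ∈ Set.Icc (0 : ℝ) 1} :=
    fun x _ => ht
  exact contDiffOn_univ.1 (h.comp h1 hm)

theorem oneForm_compContinuousLinearMap {W W' : Type*} [NormedAddCommGroup W] [NormedSpace ℝ W]
    [NormedAddCommGroup W'] [NormedSpace ℝ W'] (L : W →L[ℝ] V) (h : W' →L[ℝ] W) :
    (oneForm L).compContinuousLinearMap h = oneForm (L.comp h) := rfl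

theorem IsForm.oneL_reparam {a : FormData X V 1} (h : IsForm a) {n k : ℕ} (p : Plot X k)
    (g : Euc n → Euc k) (hg : ContDiff ℝ ∞ g) (x : Euc n) :
    oneL a (p.reparam g hg) x = (oneL a p (g x)).comp (fderiv ℝ g x) := by
  ext v
  rw [oneL_apply, h.reparam]
  rfl

theorem dAngle_comp {n k : ℕ} {θ : Euc k → Real.Angle} (hθ : IsPlot θ) {g : Euc n → Euc k} {x : Euc n}
    (hg : DifferentiableAt ℝ g x) :
    dAngle (fun y => θ (g y)) x = (dAngle θ (g x)).comp (fderiv ℝ g x) := by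
  obtain ⟨l, hl, h⟩ := exists_angle_lift hθ (g x)
  rw [dAngle_eq hl.continuous.continuousAt h, dAngle_eq (l := fun y => l (g y))
    (hl.continuous.continuousAt.comp hg.continuousAt) (hg.continuousAt.eventually h)]
  exact fderiv_comp x (hl.differentiable (by simp) _) hg

end FormPath

/-! ### Smoothness of the path of caloron forms. -/

section CaloronPath

variable {E : Type*} [NormedAddCommGroup E] [NormedSpace ℝ E] [FiniteDimensional ℝ E]
  {G : Type*} [TopologicalSpace G] [ChartedSpace E G] [Group G] [LieGroup 𝓘(ℝ, E) ∞ G]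
  [DiffeologicalSpace G] [IsManifoldDiffeology E G]
  {Q : Type*} [DiffeologicalSpace Q] [MulAction (Loop E G)ᵐᵒᵖ Q]

theorem higgsConn_reparam {A : LoopFormData E Q 1} (hA : ∀ θ, IsForm (A θ)) (Φ : Q → Real.Angle → E)
    {n k : ℕ} (q : Plot Q k) {θ : Euc k → Real.Angle} (hθ : IsPlot θ) (g : Euc n → Euc k)
    (hg : ContDiff ℝ ∞ g) (x : Euc n) : higgsConn A Φ (q.reparam g hg) (fun y => θ (g y)) x =
      (higgsConn A Φ q θ (g x)).comp (fderiv ℝ g x) := by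
  rw [higgsConn, (hA _).oneL_reparam, dAngle_comp hθ (hg.differentiable (by simp) x)]
  rfl

/-- A local lift of the angle turns the caloron form into an expression in the lifted coefficients
of A and Φ, whose smoothness in loop parameter and time is part of the hypotheses. -/
theorem isFormPath_caloronForm {A : ℝ → LoopFormData E Q 1} {Φ : ℝ → Q → Real.Angle → E}
    (hA : IsLoopConnectionPath E G (fun q γ => q <• γ) A)
    (hΦ : IsHiggsPath E G (fun q γ => q <• γ) Φ) :
    IsFormPath fun t => (caloronForm (A t) (Φ t) : FormData (Q × Real.Angle × G) E 1) := by
  have hs : ∀ (n : ℕ) (p : Plot (Q × Real.Angle × G) n),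
      ContDiffOn ℝ ∞ (fun z : Euc n × ℝ => caloronForm (A z.2) (Φ z.2) n p z.1)
        {z | z.2 ∈ Set.Icc (0 : ℝ) 1} := by
    intro n p z₀ hz₀
    obtain ⟨l, hl, hlx⟩ := exists_angle_lift p.2.2.1 z₀.1
    have hg := Plot.contMDiff (E := E) p.2.2.2
    let q : Plot Q n := ⟨fun y => (p.1 y).1, p.2.1⟩
    have hι : ContDiffOn ℝ ∞ (fun z : Euc n × ℝ => (z.1, l z.1, z.2))
        {z | z.2 ∈ Set.Icc (0 : ℝ) 1} := ContDiff.contDiffOn (by fun_prop)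
    have hm : Set.MapsTo (fun z : Euc n × ℝ => (z.1, l z.1, z.2)) {z | z.2 ∈ Set.Icc (0 : ℝ) 1}
        {z : Euc n × ℝ × ℝ | z.2.2 ∈ Set.Icc (0 : ℝ) 1} := fun z hz => hz
    have h1 : ContDiffWithinAt ℝ ∞ (fun z : Euc n × ℝ => oneL (A z.2 (l z.1 : Real.Angle)) q z.1)
        {z | z.2 ∈ Set.Icc (0 : ℝ) 1} z₀ :=
      contDiffWithinAt_apply_one (((hA.smooth n q).comp hι hm) z₀ hz₀)
    have h2 : ContDiffWithinAt ℝ ∞ (fun z : Euc n × ℝ => Φ z.2 (q.1 z.1) (l z.1 : Real.Angle))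
        {z | z.2 ∈ Set.Icc (0 : ℝ) 1} z₀ := ((hΦ.smooth n q).comp hι hm) z₀ hz₀
    have h3 : ContDiff ℝ ∞ fun z : Euc n × ℝ => fderiv ℝ l z.1 :=
      (hl.fderiv_right (m := ∞) (by simp)).comp contDiff_fst
    have h4 : ContDiff ℝ ∞ fun z : Euc n × ℝ => Ad E (p.1 z.1).2.2⁻¹ :=
      (contDiff_Ad_inv hg).comp contDiff_fst
    have h5 : ContDiff ℝ ∞ fun z : Euc n × ℝ => leftLogDeriv E (fun y => (p.1 y).2.2) z.1 :=
      (contDiff_leftLogDeriv hg).comp contDiff_fst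
    have h6 := contDiffWithinAt_oneForm ((h4.contDiffAt.contDiffWithinAt.clm_comp
      (h1.add (h3.contDiffAt.contDiffWithinAt.smulRight h2))).add h5.contDiffAt.contDiffWithinAt)
    have h7 : ∀ z : Euc n × ℝ, (∀ᶠ y in 𝓝 z.1, (p.1 y).2.1 = (l y : Real.Angle)) →
        caloronForm (A z.2) (Φ z.2) n p z.1 = oneForm ((Ad E (p.1 z.1).2.2⁻¹).comp
          (oneL (A z.2 (l z.1 : Real.Angle)) q z.1 +
            (fderiv ℝ l z.1).smulRight (Φ z.2 (q.1 z.1) (l z.1 : Real.Angle))) +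
          leftLogDeriv E (fun y => (p.1 y).2.2) z.1) := by
      intro z hz
      rw [caloronForm_eq_oneForm, higgsConn, dAngle_eq hl.continuous.continuousAt hz,
        hz.self_of_nhds]
    refine h6.congr_of_eventuallyEq ?_ (h7 z₀ hlx)
    have h8 : ∀ᶠ z : Euc n × ℝ in 𝓝 z₀, ∀ᶠ y in 𝓝 z.1, (p.1 y).2.1 = (l y : Real.Angle) :=
      continuous_fst.continuousAt.eventually hlx.eventually_nhds
    filter_upwards [mem_nhdsWithin_of_mem_nhds h8] with z hz
    exact h7 z hz
  refine ⟨fun t ht => ⟨fun n p => ?_, fun n k p g hg x => ?_⟩, hs⟩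
  · exact contDiff_slice (F := fun z : Euc n × ℝ => caloronForm (A z.2) (Φ z.2) n p z.1) (hs n p) ht
  · have hF := (hA.isLoopConnection t ht).isLoopForm.isForm
    have h1 := higgsConn_reparam hF (Φ t) ⟨fun y => (p.1 y).1, p.2.1⟩ p.2.2.1 g hg x
    have h2 := leftLogDeriv_comp (E := E) (h := g) (x := x)
      ((Plot.contMDiff (E := E) p.2.2.2).mdifferentiable (by simp) _)
      (hg.differentiable (by simp) x)
    rw [caloronForm_eq_oneForm, caloronForm_eq_oneForm, oneForm_compContinuousLinearMap,
      ContinuousLinearMap.add_comp, ContinuousLinearMap.comp_assoc, ← h1, ← h2]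
    rfl

end CaloronPath

/-! ### Local lifts and transition loops. -/

section BundleGeometry

variable {E : Type*} [NormedAddCommGroup E] [NormedSpace ℝ E]
  {G : Type*} [TopologicalSpace G] [ChartedSpace E G] [Group G] [LieGroup 𝓘(ℝ, E) ∞ G]
  {M : Type*} [TopologicalSpace M] [DiffeologicalSpace M]
  {Q : Type*} [DiffeologicalSpace Q] [MulAction (Loop E G)ᵐᵒᵖ Q] (P : LoopBundle E G Q M)

variable (M) in
/-- The plots of `M` are continuous. -/
def ContinuousPlots : Prop := ∀ (n : ℕ) (p : Plot M n), Continuous p.1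

theorem continuousPlots_of_isManifoldDiffeology {EM : Type*} [NormedAddCommGroup EM]
    [NormedSpace ℝ EM] [ChartedSpace EM M] [IsManifoldDiffeology EM M] : ContinuousPlots M :=
  fun _ p => ((IsManifoldDiffeology.isPlot_iff (E := EM)).1 p.2).continuous

/-- The lift is a local section composed with the plot; continuity of the plot is what allows it to
be retracted into the trivialising set. -/
theorem LoopBundle.hasLocalLifts (hM : ContinuousPlots M) : HasLocalLifts P.proj := by
  intro n p x
  obtain ⟨U, hU, hxU, s, φ, hs, -, -, hsm, -⟩ := P.locally_trivial (p.1 x)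
  obtain ⟨r, hr, hru, hrx⟩ := exists_smooth_retraction
    (hU.preimage (hM n p)) hxU
  refine ⟨⟨_, hsm n (p.reparam r hr) hru⟩, ?_⟩
  filter_upwards [hrx] with y hy
  change P.proj (s (p.1 (r y))) = p.1 y
  rw [hs _ (hru y), hy]

theorem LoopBundle.act_injective (P : LoopBundle E G Q M) (q : Q) {γ δ : Loop E G} (h : q <• γ = q <• δ) : γ = δ := by
  obtain ⟨U, -, hxU, s, φ, -, hφ, hq, -, -⟩ := P.locally_trivial (P.proj q)
  rw [← hq q hxU, op_smul_op_smul, op_smul_op_smul] at h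
  have h1 := congrArg φ h
  rw [hφ _ hxU, hφ _ hxU] at h1
  exact mul_left_cancel h1

/-- Two plots of the total space with the same image in the base differ locally by a plot of the loop
group. -/
theorem LoopBundle.exists_act (hM : ContinuousPlots M) {n : ℕ} (q q' : Plot Q n) {u : Set (Euc n)} (hu : IsOpen u) {x : Euc n}
    (hx : x ∈ u) (h : ∀ y ∈ u, P.proj (q.1 y) = P.proj (q'.1 y)) :
    ∃ r : Euc n → Euc n, ContDiff ℝ ∞ r ∧ (∀ y, r y ∈ u) ∧ (∀ᶠ y in 𝓝 x, r y = y) ∧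
      ∃ c : Plot (Loop E G) n, ∀ y, q'.1 (r y) = q.1 (r y) <• c.1 y := by
  obtain ⟨U, hU, hxU, s, φ, -, hφ, hq, -, hφs⟩ := P.locally_trivial (P.proj (q.1 x))
  obtain ⟨r, hr, hru, hrx⟩ := exists_smooth_retraction
    (hu.inter (hU.preimage (hM n (q.map P.proj P.proj_smooth)))) ⟨hx, hxU⟩
  have h1 : ∀ y, P.proj (q.1 (r y)) ∈ U := fun y => (hru y).2
  have h2 : ∀ y, P.proj (q'.1 (r y)) ∈ U := fun y => by
    rw [← h _ (hru y).1]
    exact h1 y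
  have c1 : ContMDiff 𝓘(ℝ, Euc n × ℝ) 𝓘(ℝ, E) ∞
      fun z : Euc n × ℝ => φ (q.1 (r z.1)) (z.2 : Real.Angle) := hφs n (q.reparam r hr) h1
  have c2 : ContMDiff 𝓘(ℝ, Euc n × ℝ) 𝓘(ℝ, E) ∞
      fun z : Euc n × ℝ => φ (q'.1 (r z.1)) (z.2 : Real.Angle) := hφs n (q'.reparam r hr) h2
  refine ⟨r, hr, fun y => (hru y).1, hrx,
    ⟨fun y => (φ (q.1 (r y)))⁻¹ * φ (q'.1 (r y)), c1.inv.mul c2⟩, fun y => ?_⟩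
  have h3 := hq _ (h1 y)
  have h4 := hq _ (h2 y)
  rw [← h _ (hru y).1] at h4
  change _ = _ <• ((φ (q.1 (r y)))⁻¹ * φ (q'.1 (r y)))
  have h5 : ∀ (b : Q) (γ δ : Loop E G), b <• δ = (b <• γ) <• (γ⁻¹ * δ) := fun b γ δ => by
    rw [op_smul_op_smul, mul_inv_cancel_left]
  have h6 := h5 (s (P.proj (q.1 (r y)))) (φ (q.1 (r y))) (φ (q'.1 (r y)))
  rw [h3, h4] at h6
  exact h6

variable (E) in
-- The relation comes from a group action and so is already an equivalence relation: points with the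
-- same class differ by a single loop.
theorem caloronMk_eq {a b : Q × Real.Angle × G} (h : caloronMk E G Q a = caloronMk E G Q b) :
    ∃ γ : Loop E G, b = (a.1 <• γ, a.2.1, (γ a.2.1)⁻¹ * a.2.2) := by
  have h1 := Quot.eqvGen_exact h
  clear h
  induction h1 with
  | rel a b h => exact h
  | refl a => exact ⟨1, by simp [Loop.one_apply]⟩
  | symm a b _ ih =>
    obtain ⟨γ, rfl⟩ := ih
    exact ⟨γ⁻¹, by simp [Loop.inv_apply]⟩
  | trans a b c _ _ ih1 ih2 =>
    obtain ⟨γ, rfl⟩ := ih1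
    obtain ⟨δ, rfl⟩ := ih2
    exact ⟨γ * δ, by simp [Loop.mul_apply, op_smul_op_smul, mul_assoc]⟩

variable [DiffeologicalSpace G]

theorem hasLocalLifts_caloronMk : HasLocalLifts (caloronMk E G Q) := by
  intro n p x
  obtain ⟨q, hq, h⟩ := p.2 x
  exact ⟨⟨q, hq⟩, h.mono fun y hy => hy.symm⟩

theorem LoopBundle.hasLocalLifts_caloronProj (hM : ContinuousPlots M) : HasLocalLifts P.caloronProj := by
  intro n p x
  obtain ⟨q, hq⟩ := P.hasLocalLifts hM n ⟨fun y => (p.1 y).1, p.2.1⟩ x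
  refine ⟨⟨fun y => caloronMk E G Q (q.1 y, (p.1 y).2, 1),
    caloronMk_smooth E G Q n _ ⟨q.2, p.2.2, isPlot_const⟩⟩, ?_⟩
  filter_upwards [hq] with y hy
  exact Prod.ext hy rfl

variable [IsManifoldDiffeology E G]

/-- Two plots with the same image differ pointwise by loops. The action being free, these loops are
those of the plot of LG found by comparison in a trivialisation, and the form is invariant under
such plots. -/
theorem LoopBundle.isBasic_caloronForm (P : LoopBundle E G Q M) (hM : ContinuousPlots M) {A : LoopFormData E Q 1} {Φ : Q → Real.Angle → E}
    (hA : IsLoopConnection E G (fun q γ => q <• γ) A) (hΦ : IsHiggs E G (fun q γ => q <• γ) Φ)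
    (hF : IsForm (caloronForm A Φ : FormData (Q × Real.Angle × G) E 1)) :
    IsBasic (caloronMk E G Q) (caloronForm A Φ) := by
  intro n p p' x h
  obtain ⟨u, hu, huo, hxu⟩ := eventually_nhds_iff.1 h
  obtain ⟨r, hr, hru, hrx, c, hc⟩ := P.exists_act hM ⟨fun y => (p.1 y).1, p.2.1⟩
    ⟨fun y => (p'.1 y).1, p'.2.1⟩ huo hxu fun y hy => by
      obtain ⟨γ, h1⟩ := caloronMk_eq E (hu y hy)
      change P.proj (p.1 y).1 = P.proj (p'.1 y).1
      rw [h1, P.proj_act]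
  have h1 := caloronForm_act P hA hΦ (p.reparam r hr) (p'.reparam r hr) c (fun y => by
    obtain ⟨γ, h1⟩ := caloronMk_eq E (hu _ (hru y))
    have h2 : γ = c.1 y := P.act_injective (p.1 (r y)).1 ((congrArg Prod.fst h1).symm.trans (hc y))
    rw [← h2]
    exact h1) x
  have e1 : (p.reparam r hr).1 =ᶠ[𝓝 x] p.1 := hrx.mono fun y hy => congrArg p.1 hy
  have e2 : (p'.reparam r hr).1 =ᶠ[𝓝 x] p'.1 := hrx.mono fun y hy => congrArg p'.1 hy
  rw [hF.apply_congr e1, hF.apply_congr e2] at h1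
  exact h1.symm

end BundleGeometry

/-! ### Gauge invariance of Chern-Weil and Chern-Simons forms. -/

section Gauge

variable {E : Type*} [NormedAddCommGroup E] [NormedSpace ℝ E] [FiniteDimensional ℝ E]
  {G : Type*} [TopologicalSpace G] [ChartedSpace E G] [Group G] [LieGroup 𝓘(ℝ, E) ∞ G]
  {X Y : Type*} [DiffeologicalSpace X] [DiffeologicalSpace Y]

/-- Chern-Weil forms are gauge invariant. -/
theorem chernWeil_gauge {m : ℕ} (f : InvariantPolynomial E G (m + 1)) {a : FormData X E 1}
    {b : FormData Y E 1} (ha : IsForm a) (hb : IsForm b) {n : ℕ} (p : Plot X n) (p' : Plot Y n)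
    {g : Euc n → G} (hg : ContMDiff 𝓘(ℝ, Euc n) 𝓘(ℝ, E) ∞ g)
    (h : ∀ y, oneL b p' y = (Ad E (g y)⁻¹).comp (oneL a p y) + leftLogDeriv E g y) :
    chernWeil G f b n p' = chernWeil G f a n p := by
  funext x
  ext v
  rw [chernWeil_apply f hb, chernWeil_apply f ha]
  congr 1
  refine altF_congr (fun z => ?_) v
  rw [← f.inv (g x)⁻¹ (pairs (curv G (oneL a p) x) z)]
  congr 1
  ext1 i
  have h1 : oneL b p' = fun y => (Ad E (g y)⁻¹).comp (oneL a p y) + leftLogDeriv E g y := funext h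
  rw [h1]
  exact curv_gauge ((ha.contDiff_oneL p).differentiable (by simp) x) (hg x) _ _

/-- Since g does not depend on time, (x, s) ↦ g(x) is a gauge transformation between the total
one-forms, and the Chern-Simons form is an integral of the Chern-Weil form of the total one-form. -/
theorem chernSimons_gauge {m : ℕ} (f : InvariantPolynomial E G (m + 1)) {a : ℝ → FormData X E 1}
    {b : ℝ → FormData Y E 1} (ha : IsFormPath a) (hb : IsFormPath b) {n : ℕ} (p : Plot X n)
    (p' : Plot Y n) {g : Euc n → G} (hg : ContMDiff 𝓘(ℝ, Euc n) 𝓘(ℝ, E) ∞ g)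
    (h : ∀ t ∈ Set.Icc (0 : ℝ) 1, ∀ y, oneL (b t) p' y =
      (Ad E (g y)⁻¹).comp (oneL (a t) p y) + leftLogDeriv E g y) :
    chernSimons G f b n p' = chernSimons G f a n p := by
  have h1 : chernWeil G f (pathTotal b) (n + 1) p'.timesLine =
      chernWeil G f (pathTotal a) (n + 1) p.timesLine := by
    refine chernWeil_gauge f (isForm_pathTotal ha) (isForm_pathTotal hb) _ _
      (g := fun y => g (initL n y)) (hg.comp (initL n).contDiff.contMDiff) fun y => ?_
    have h2 := leftLogDeriv_comp (E := E) (h := initL n) (x := y) (hg.mdifferentiable (by simp) _)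
      (initL n).differentiableAt
    rw [oneL_pathTotal hb, oneL_pathTotal ha, h _ (smoothTransition_mem_Icc _), h2, (initL n).fderiv]
    rfl
  rw [chernSimons_eq_lineInt f ha, chernSimons_eq_lineInt f hb]
  funext x
  simp only [lineInt, h1]

theorem isFormPath_descend {V : Type*} [NormedAddCommGroup V] [NormedSpace ℝ V] {k : ℕ} {π : X → Y}
    (hl : HasLocalLifts π) {a : ℝ → FormData X V k} (h : IsFormPath a)
    (hb : ∀ t ∈ Set.Icc (0 : ℝ) 1, IsBasic π (a t)) : IsFormPath fun t => descend hl (a t) where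
  isForm t ht := isForm_descend hl (h.isForm t ht) (hb t ht)
  smooth n p z₀ hz₀ := by
    obtain ⟨q, hq⟩ := hl n p z₀.1
    refine (h.smooth n q z₀ hz₀).congr_of_eventuallyEq ?_ (descend_apply hl (hb _ hz₀) hq)
    have h8 : ∀ᶠ z : Euc n × ℝ in 𝓝 z₀, ∀ᶠ y in 𝓝 z.1, π (q.1 y) = p.1 y :=
      continuous_fst.continuousAt.eventually hq.eventually_nhds
    filter_upwards [mem_nhdsWithin_of_mem_nhds h8, self_mem_nhdsWithin] with z hz hz'
    exact descend_apply hl (hb _ hz') hz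

end Gauge

/-! ### The caloron connection and descent to M × S¹. -/

section CaloronConnection

variable {E : Type*} [NormedAddCommGroup E] [NormedSpace ℝ E] [FiniteDimensional ℝ E]
  {G : Type*} [TopologicalSpace G] [ChartedSpace E G] [Group G] [LieGroup 𝓘(ℝ, E) ∞ G]
  [DiffeologicalSpace G] [IsManifoldDiffeology E G]
  {M : Type*} [TopologicalSpace M] [DiffeologicalSpace M]
  {Q : Type*} [DiffeologicalSpace Q] [MulAction (Loop E G)ᵐᵒᵖ Q] (P : LoopBundle E G Q M)

theorem isPlot_of_contMDiff {n : ℕ} {g : Euc n → G} (h : ContMDiff 𝓘(ℝ, Euc n) 𝓘(ℝ, E) ∞ g) :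
    IsPlot g :=
  (IsManifoldDiffeology.isPlot_iff (E := E)).2 h

/-- Right translation by h acts on a lift through its G-coordinate alone. On a fibre the lift has
constant q and θ, so only the Maurer-Cartan term survives. -/
theorem isCaloronConnection_descend {A : LoopFormData E Q 1} {Φ : Q → Real.Angle → E}
    (hA : IsLoopConnection E G (fun q γ => q <• γ) A)
    (hF : IsForm (caloronForm A Φ : FormData (Q × Real.Angle × G) E 1))
    (hb : IsBasic (caloronMk E G Q) (caloronForm A Φ)) :
    IsCaloronConnection A Φ (descend (hasLocalLifts_caloronMk (E := E) (G := G) (Q := Q))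
      (caloronForm A Φ)) := by
  refine ⟨⟨isForm_descend _ hF hb, fun g n p p' h x => ?_, fun y n c hc p h x => ?_⟩,
    pullback_descend _ _ hb⟩
  · obtain ⟨q, hq⟩ := hasLocalLifts_caloronMk n p x
    have hg := Plot.contMDiff (E := E) q.2.2.2
    let q' : Plot (Q × Real.Angle × G) n := ⟨fun y => ((q.1 y).1, (q.1 y).2.1, (q.1 y).2.2 * g),
      q.2.1, q.2.2.1, isPlot_of_contMDiff (E := E) (hg.mul contMDiff_const)⟩
    have hq' : ∀ᶠ y in 𝓝 x, caloronMk E G Q (q'.1 y) = p'.1 y := by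
      filter_upwards [hq] with y hy
      rw [h, ← hy]
      rfl
    have h1 := leftLogDeriv_mul (E := E) (g := fun _ => g) (hg.mdifferentiable (by simp) x)
      mdifferentiableAt_const
    rw [descend_apply _ hb hq, descend_apply _ hb hq', caloronForm_eq_oneForm, caloronForm_eq_oneForm]
    change oneForm ((Ad E ((q.1 x).2.2 * g)⁻¹).comp (higgsConn A Φ ⟨fun y => (q.1 y).1, q.2.1⟩ _ x) +
      leftLogDeriv E (fun y => (q.1 y).2.2 * g) x) = _
    rw [h1, leftLogDeriv_const, add_zero, mul_inv_rev, Ad_mul, ContinuousLinearMap.comp_assoc,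
      ← ContinuousLinearMap.comp_add]
    rfl
  · obtain ⟨b, rfl⟩ := Quot.exists_rep y
    let q : Plot (Q × Real.Angle × G) n := ⟨fun x => (b.1, b.2.1, b.2.2 * c x),
      isPlot_const, isPlot_const, isPlot_of_contMDiff (E := E) (contMDiff_const.mul hc)⟩
    have hq : ∀ᶠ x' in 𝓝 x, caloronMk E G Q (q.1 x') = p.1 x' :=
      Filter.Eventually.of_forall fun x' => (h x').symm
    have h0 : higgsConn A Φ ⟨fun y => (q.1 y).1, q.2.1⟩ (fun y => (q.1 y).2.1) x = 0 := by
      have h1 : dAngle (fun y => (q.1 y).2.1) x = 0 := by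
        change fderiv ℝ (fun _ : Euc n => (b.2.1 - b.2.1).toReal) x = 0
        exact fderiv_const_apply _
      have h2 : oneL (A (q.1 x).2.1) ⟨fun y => (q.1 y).1, q.2.1⟩ x = 0 := by
        ext v
        rw [oneL_apply, (hA.isLoopForm.isForm _).oneForm_const (c := b.1) fun _ => rfl]
        rfl
      rw [higgsConn, h1, h2]
      ext v
      simp
    rw [descend_apply _ hb hq, caloronForm_eq_oneForm, h0, ContinuousLinearMap.comp_zero, zero_add]
    exact congrArg oneForm (leftLogDeriv_const_mul _ _ _)

theorem IsCaloronConnection.eq {A : LoopFormData E Q 1} {Φ : Q → Real.Angle → E}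
    {a b : FormData (Caloron E G Q) E 1} (ha : IsCaloronConnection A Φ a)
    (hb : IsCaloronConnection A Φ b) : a = b :=
  pullback_injective _ hasLocalLifts_caloronMk ha.isConnection.isForm hb.isConnection.isForm
    (ha.pullback_eq.trans hb.pullback_eq.symm)

variable {P} in
-- The gauge map depends on the two plots only, not on (A, Φ). Hence the same one works for all
-- times of a path, as the invariance of Chern-Simons forms requires.
theorem exists_gauge (hM : ContinuousPlots M) {n : ℕ} (p p' : Plot (Caloron E G Q) n) (x : Euc n)
    (h : ∀ᶠ y in 𝓝 x, P.caloronProj (p.1 y) = P.caloronProj (p'.1 y)) :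
    ∃ (r : Euc n → Euc n) (hr : ContDiff ℝ ∞ r) (g : Euc n → G), (∀ᶠ y in 𝓝 x, r y = y) ∧
      ContMDiff 𝓘(ℝ, Euc n) 𝓘(ℝ, E) ∞ g ∧
      ∀ (A : LoopFormData E Q 1) (Φ : Q → Real.Angle → E) (a : FormData (Caloron E G Q) E 1),
        IsLoopConnection E G (fun q γ => q <• γ) A → IsHiggs E G (fun q γ => q <• γ) Φ →
        IsCaloronConnection A Φ a → ∀ y, oneL a (p'.reparam r hr) y =
          (Ad E (g y)⁻¹).comp (oneL a (p.reparam r hr) y) + leftLogDeriv E g y := by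
  obtain ⟨q, hq⟩ := hasLocalLifts_caloronMk n p x
  obtain ⟨q', hq'⟩ := hasLocalLifts_caloronMk n p' x
  obtain ⟨u, hu, huo, hxu⟩ := eventually_nhds_iff.1 (h.and (hq.and hq'))
  have hproj : ∀ y ∈ u, (P.proj (q.1 y).1, (q.1 y).2.1) = (P.proj (q'.1 y).1, (q'.1 y).2.1) := by
    intro y hy
    obtain ⟨h1, h2, h3⟩ := hu y hy
    rw [← h2, ← h3] at h1
    exact h1
  obtain ⟨r, hr, hru, hrx, c, hc⟩ := P.exists_act hM ⟨fun y => (q.1 y).1, q.2.1⟩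
    ⟨fun y => (q'.1 y).1, q'.2.1⟩ huo hxu fun y hy => congrArg Prod.fst (hproj y hy)
  let s := q.reparam r hr
  let s' := q'.reparam r hr
  have hs : s.map _ (caloronMk_smooth E G Q) = p.reparam r hr :=
    Subtype.ext (funext fun y => (hu _ (hru y)).2.1)
  have hs' : s'.map _ (caloronMk_smooth E G Q) = p'.reparam r hr :=
    Subtype.ext (funext fun y => (hu _ (hru y)).2.2)
  have hθ : (fun y => (s'.1 y).2.1) = fun y => (s.1 y).2.1 :=
    funext fun y => (congrArg Prod.snd (hproj _ (hru y))).symm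
  let k : Euc n → G := fun y => c.1 y (s.1 y).2.1
  have hk : ContMDiff 𝓘(ℝ, Euc n) 𝓘(ℝ, E) ∞ k := by
    intro x
    obtain ⟨l, hl, hlx⟩ := exists_angle_lift s.2.2.1 x
    have hc : ContMDiff 𝓘(ℝ, Euc n × ℝ) 𝓘(ℝ, E) ∞
      fun z : Euc n × ℝ => c.1 z.1 (z.2 : Real.Angle) := c.2
    have h2 : ContDiff ℝ ∞ fun y : Euc n => (y, l y) := contDiff_id.prodMk hl
    refine (hc.comp h2.contMDiff x).congr_of_eventuallyEq ?_
    filter_upwards [hlx] with y hy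
    exact congrArg (c.1 y) hy
  have hg := Plot.contMDiff (E := E) s.2.2.2
  have hg' := Plot.contMDiff (E := E) s'.2.2.2
  -- With k = c(θ) one has [q c, θ, g′] = [q, θ, k g′] = [q, θ, g] · g⁻¹ k g′, which dictates the
  -- gauge map.
  have hh : ContMDiff 𝓘(ℝ, Euc n) 𝓘(ℝ, E) ∞
      fun y => (s.1 y).2.2⁻¹ * (k y * (s'.1 y).2.2) := hg.inv.mul (hk.mul hg')
  refine ⟨r, hr, fun y => (s.1 y).2.2⁻¹ * (k y * (s'.1 y).2.2), hrx, hh,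
    fun A Φ a hA hΦ ha y => ?_⟩
  have hv : ∀ t : Plot (Q × Real.Angle × G) n,
      oneL a (t.map _ (caloronMk_smooth E G Q)) y = oneL (caloronForm A Φ) t y := by
    intro t
    rw [← ha.pullback_eq]
    rfl
  have hact := higgsConn_act P hA hΦ ⟨fun y => (s.1 y).1, s.2.1⟩ ⟨fun y => (s'.1 y).1, s'.2.1⟩ c
    hc s.2.2.1 y
  have h1 := leftLogDeriv_mul (E := E) (hk.mdifferentiable (by simp) y)
    (hg'.mdifferentiable (by simp) y)
  have h2 := leftLogDeriv_mul (E := E) (hg.mdifferentiable (by simp) y)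
    (hh.mdifferentiable (by simp) y)
  simp only [mul_inv_cancel_left] at h2
  rw [← hs, ← hs', hv, hv, oneL_caloronForm, oneL_caloronForm, hθ, hact, ContinuousLinearMap.comp_add,
    ContinuousLinearMap.comp_add, add_assoc, add_assoc, ← h2, ← ContinuousLinearMap.comp_assoc,
    ← ContinuousLinearMap.comp_assoc, ← Ad_mul, ← Ad_mul, h1]
  simp only [mul_inv_rev, inv_inv, mul_assoc, mul_inv_cancel, mul_one]
  rfl

variable {P} in
theorem isBasic_chernWeil (hM : ContinuousPlots M) {m : ℕ} (f : InvariantPolynomial E G (m + 1))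
    {A : LoopFormData E Q 1} {Φ : Q → Real.Angle → E}
    (hA : IsLoopConnection E G (fun q γ => q <• γ) A) (hΦ : IsHiggs E G (fun q γ => q <• γ) Φ)
    {a : FormData (Caloron E G Q) E 1} (ha : IsCaloronConnection A Φ a) :
    IsBasic P.caloronProj (chernWeil G f a) := by
  intro n p p' x h
  obtain ⟨r, hr, g, hrx, hg, h1⟩ := exists_gauge hM p p' x h
  have haf := ha.isConnection.isForm
  have h2 := chernWeil_gauge f haf haf (p.reparam r hr) (p'.reparam r hr) hg (h1 A Φ a hA hΦ ha)
  have e1 : (p.reparam r hr).1 =ᶠ[𝓝 x] p.1 := hrx.mono fun y hy => congrArg p.1 hy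
  have e2 : (p'.reparam r hr).1 =ᶠ[𝓝 x] p'.1 := hrx.mono fun y hy => congrArg p'.1 hy
  have hF := isForm_chernWeil f haf
  rw [← hF.apply_congr e1, ← hF.apply_congr e2, h2]

variable {P} in
theorem isBasic_chernSimons (hM : ContinuousPlots M) {m : ℕ} (f : InvariantPolynomial E G (m + 1))
    {A : ℝ → LoopFormData E Q 1} {Φ : ℝ → Q → Real.Angle → E}
    (hA : IsLoopConnectionPath E G (fun q γ => q <• γ) A)
    (hΦ : IsHiggsPath E G (fun q γ => q <• γ) Φ)
    {a : ℝ → FormData (Caloron E G Q) E 1} (hp : IsFormPath a)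
    (ha : ∀ t ∈ Set.Icc (0 : ℝ) 1, IsCaloronConnection (A t) (Φ t) (a t)) :
    IsBasic P.caloronProj (chernSimons G f a) := by
  intro n p p' x h
  obtain ⟨r, hr, g, hrx, hg, h1⟩ := exists_gauge hM p p' x h
  have h2 := chernSimons_gauge f hp hp (p.reparam r hr) (p'.reparam r hr) hg fun t ht =>
    h1 (A t) (Φ t) (a t) (hA.isLoopConnection t ht) (hΦ.isHiggs t ht) (ha t ht)
  have e1 : (p.reparam r hr).1 =ᶠ[𝓝 x] p.1 := hrx.mono fun y hy => congrArg p.1 hy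
  have e2 : (p'.reparam r hr).1 =ᶠ[𝓝 x] p'.1 := hrx.mono fun y hy => congrArg p'.1 hy
  have hF := isForm_chernSimons f hp
  rw [← hF.apply_congr e1, ← hF.apply_congr e2, h2]

end CaloronConnection

/-! ### Rearranging the entries of f. -/

section Algebra

variable {U V W : Type*} [NormedAddCommGroup V] [NormedSpace ℝ V] [NormedAddCommGroup W]
  [NormedSpace ℝ W]

/-- Dropping slot 0 shifts the pairing by one, so the appended vector becomes the second member of
the last pair. -/
theorem pairs_tail_snoc {l : ℕ} (F : U → U → V) (y : Fin (2 * l + 1 + 1) → U) (e : U) :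
    pairs F (Fin.tail (Fin.snoc y e : Fin (2 * (l + 1) + 1) → U)) =
      (Fin.snoc (pairs F (Fin.init (Fin.tail y))) (F (y (Fin.last _)) e) : Fin (l + 1) → V) := by
  have hlt : ∀ (i : Fin (2 * (l + 1) + 1)) (h : (i : ℕ) < 2 * l + 1 + 1),
      (Fin.snoc y e : Fin (2 * (l + 1) + 1) → U) i = y ⟨i, h⟩ := by
    intro i h
    exact Fin.snoc_castSucc (α := fun _ => U) e y ⟨i, h⟩
  have hlast : ∀ (i : Fin (2 * (l + 1) + 1)) (_ : (i : ℕ) = 2 * l + 1 + 1),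
      (Fin.snoc y e : Fin (2 * (l + 1) + 1) → U) i = e := by
    intro i h
    obtain rfl : i = Fin.last _ := Fin.ext h
    exact Fin.snoc_last (α := fun _ => U) e y
  ext1 i
  refine Fin.lastCases ?_ (fun j => ?_) i
  · rw [Fin.snoc_last, pairs, Fin.tail, Fin.tail]
    refine congrArg₂ F ?_ ?_
    · rw [hlt _ (by simp)]
      congr 1
      ext
      simp [add_comm]
    · refine hlast _ ?_
      rw [Fin.val_succ, pairIdx_val]
      simp [add_comm]
  · rw [Fin.snoc_castSucc, pairs, pairs, Fin.tail, Fin.tail]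
    refine congrArg₂ F ?_ ?_
    · rw [hlt _ (by simp)]
      rfl
    · rw [hlt _ (by simp; omega)]
      rfl

theorem map_cons_eq_snoc {m : ℕ} (f : ContinuousMultilinearMap ℝ (fun _ : Fin (m + 1) => V) W)
    (hf : ∀ (σ : Equiv.Perm (Fin (m + 1))) v, f (v ∘ σ) = f v) (b : V) (u : Fin m → V) :
    f (Fin.cons b u : Fin (m + 1) → V) = f (Fin.snoc u b : Fin (m + 1) → V) := by
  rw [← hf (finRotate (m + 1)) (Fin.cons b u)]
  congr 1
  ext1 i
  refine Fin.lastCases ?_ (fun j => ?_) i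
  · simp
  · rw [Function.comp_apply, finRotate_of_lt (by simp), Fin.snoc_castSucc]
    exact Fin.cons_succ (α := fun _ => V) b u j

end Algebra

/-! ### The curvature of A + Φ dθ. -/

section Splitting

variable {E : Type*} [NormedAddCommGroup E] [NormedSpace ℝ E] [FiniteDimensional ℝ E]
  {G : Type*} [TopologicalSpace G] [ChartedSpace E G] [Group G] [LieGroup 𝓘(ℝ, E) ∞ G]
  [DiffeologicalSpace G] [IsManifoldDiffeology E G]
  {Q : Type*} [DiffeologicalSpace Q] [MulAction (Loop E G)ᵐᵒᵖ Q]

variable (G) in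
/-- For a plot `p` of `Q`, the plot `(x, s) ↦ (p x, s mod 2π, 1)` of `Q × S¹ × G`. -/
def Plot.timesCircleOne {n : ℕ} (p : Plot Q n) : Plot (Q × Real.Angle × G) (n + 1) :=
  ⟨fun y => (p.1 (initL n y), ((lastL n y : ℝ) : Real.Angle), 1), p.timesCircle.2.1,
    p.timesCircle.2.2, isPlot_const⟩

/-- With constant group coordinate 1 the adjoint factor is trivial and the Maurer-Cartan term is
zero, which leaves A + Φ dθ. -/
theorem oneL_caloronForm_timesCircleOne {A : LoopFormData E Q 1} (hA : ∀ θ, IsForm (A θ))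
    (Φ : Q → Real.Angle → E) {n : ℕ} (p : Plot Q n) (y w : Euc (n + 1)) :
    oneL (caloronForm A Φ) (p.timesCircleOne G) y w =
      oneL (A (lastL n y : ℝ)) p (initL n y) (initL n w) +
        lastL n w • Φ (p.1 (initL n y)) (lastL n y : ℝ) := by
  have h1 : dAngle (fun y => ((p.timesCircleOne G).1 y).2.1) y = lastL n := by
    have h := dAngle_eq (θ := fun y => ((p.timesCircleOne G).1 y).2.1) (l := lastL n) (x := y)
      (lastL n).continuous.continuousAt (Filter.Eventually.of_forall fun _ => rfl)
    rw [h, (lastL n).fderiv]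
  have h2 := (hA (lastL n y : ℝ)).oneL_reparam p (initL n) (initL n).contDiff y
  rw [(initL n).fderiv] at h2
  rw [oneL_caloronForm, higgsConn, h1]
  change ((Ad E (1 : G)⁻¹).comp (oneL (A (lastL n y : ℝ)) (p.reparam (initL n) (initL n).contDiff) y +
    (lastL n).smulRight (Φ (p.1 (initL n y)) (lastL n y : ℝ))) +
    leftLogDeriv E (fun _ => (1 : G)) y) w = _
  rw [inv_one, Ad_one, leftLogDeriv_const, h2, add_zero, ContinuousLinearMap.id_comp]
  rfl

theorem oneL_timesCircleOne_incl {A : LoopFormData E Q 1} (hA : ∀ θ, IsForm (A θ))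
    (Φ : Q → Real.Angle → E) {n : ℕ} (p : Plot Q n) (x : Euc n) (s : ℝ) (w : Euc n) :
    oneL (caloronForm A Φ) (p.timesCircleOne G) (inclL n x + s • lastVec n) (inclL n w) =
      oneL (A s) p x w := by
  rw [oneL_caloronForm_timesCircleOne hA, initL_add_smul, lastL_add_smul, initL_inclL, lastL_inclL,
    zero_smul, add_zero]

theorem oneL_timesCircleOne_lastVec {A : LoopFormData E Q 1} (hA : ∀ θ, IsForm (A θ))
    (Φ : Q → Real.Angle → E) {n : ℕ} (p : Plot Q n) (x : Euc n) (s : ℝ) :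
    oneL (caloronForm A Φ) (p.timesCircleOne G) (inclL n x + s • lastVec n) (lastVec n) =
      Φ (p.1 x) s := by
  rw [oneL_caloronForm_timesCircleOne hA, initL_add_smul, lastL_add_smul, initL_lastVec,
    lastL_lastVec, map_zero, one_smul, zero_add]

theorem curv_timesCircleOne_incl {A : LoopFormData E Q 1} {Φ : Q → Real.Angle → E}
    (hA : ∀ θ, IsForm (A θ)) (hF : IsForm (caloronForm A Φ : FormData (Q × Real.Angle × G) E 1))
    {n : ℕ} (p : Plot Q n) (x : Euc n) (s : ℝ) (v w : Euc n) :
    curv G (oneL (caloronForm A Φ) (p.timesCircleOne G)) (inclL n x + s • lastVec n) (inclL n v)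
      (inclL n w) = two (curvature G (A s)) p x v w := by
  rw [curv_inclL (hF.contDiff_oneL _), two_curvature (hA s)]
  congr 2
  ext x' w
  exact oneL_timesCircleOne_incl hA Φ p x' s w

/-- The dθ-component of the curvature of A + Φ dθ is dΦ - ∂A + [A, Φ]. The order (w, ∂_θ) of the
arguments makes the sign that of ∇Φ. -/
theorem curv_timesCircleOne_lastVec {A : LoopFormData E Q 1} {Φ : Q → Real.Angle → E}
    (hA : IsLoopForm E A) (hF : IsForm (caloronForm A Φ : FormData (Q × Real.Angle × G) E 1))
    {n : ℕ} (p : Plot Q n) (x : Euc n) (s : ℝ) (w : Euc n) :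
    curv G (oneL (caloronForm A Φ) (p.timesCircleOne G)) (inclL n x + s • lastVec n) (inclL n w)
      (lastVec n) = one (higgsDeriv G A Φ s) p x w := by
  have h1 : (fun x' => oneL (caloronForm A Φ) (p.timesCircleOne G) (inclL n x' + s • lastVec n)
      (lastVec n)) = fun x' => Φ (p.1 x') s :=
    funext fun x' => oneL_timesCircleOne_lastVec hA.isForm Φ p x' s
  have h2 : (fun r : ℝ => oneL (caloronForm A Φ) (p.timesCircleOne G) (inclL n x + r • lastVec n)
      (inclL n w)) = fun r : ℝ => A r n p x fun _ => w :=
    funext fun r => oneL_timesCircleOne_incl hA.isForm Φ p x r w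
  have h3 : loopDeriv A s n p x = deriv (fun r : ℝ => A r n p x) s := by
    have h4 := deriv_comp_const_add (fun r : ℝ => A r n p x) s 0
    rw [add_zero] at h4
    rw [← h4, loopDeriv]
    simp only [Real.Angle.coe_add]
  have h4 : DifferentiableAt ℝ (fun r : ℝ => A r n p x) s := by
    have h5 : ContDiff ℝ ∞ fun r : ℝ => (x, r) := contDiff_const.prodMk contDiff_id
    exact ((hA.smooth n p).comp h5).differentiable (by simp) s
  have h5 : HasDerivAt (fun r : ℝ => A r n p x fun _ => w)
      (deriv (fun r : ℝ => A r n p x) s fun _ => w) s :=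
    (ContinuousAlternatingMap.apply ℝ (Euc n) E fun _ : Fin 1 => w).hasFDerivAt.comp_hasDerivAt s
      h4.hasDerivAt
  rw [curv_swap, curv_lastVec (hF.contDiff_oneL _), oneL_timesCircleOne_incl hA.isForm, h2, h5.deriv,
    congrFun h1 x, h1, brkC_swap G (oneL (A s) p x w), ← h3]
  have h6 : one (higgsDeriv G A Φ s) p x w = (extd (zeroForm fun q => Φ q s) : FormData Q E 1) n p x
      (fun _ => w) + (bracketForm G (A s) (zeroForm fun q => Φ q s) : FormData Q E 1) n p x
      (fun _ => w) - loopDeriv A s n p x fun _ => w := rfl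
  rw [h6, extd_zeroForm_apply, bracketForm_one_zero_apply]
  abel

end Splitting

/-! ### Time derivatives of components. -/

section TimeDerivative

variable {X : Type*} [DiffeologicalSpace X] {V : Type*} [NormedAddCommGroup V] [NormedSpace ℝ V]
  {E : Type*} [NormedAddCommGroup E] [NormedSpace ℝ E]
  {G : Type*} [TopologicalSpace G] [ChartedSpace E G] [Group G] [LieGroup 𝓘(ℝ, E) ∞ G]

/-- Evaluation is linear, so time derivatives may be taken after evaluation. This allows comparing
forms on domains of different dimension. -/
theorem IsFormPath.timeDeriv_apply {k : ℕ} {a : ℝ → FormData X V k} (h : IsFormPath a) {t : ℝ}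
    (ht : t ∈ Set.Icc (0 : ℝ) 1) {n : ℕ} (p : Plot X n) (x : Euc n) (v : Fin k → Euc n) :
    timeDeriv a t n p x v = derivWithin (fun r => a r n p x v) (Set.Icc 0 1) t := by
  have hι : ContDiffOn ℝ ∞ (fun r : ℝ => (x, r)) (Set.Icc 0 1) := ContDiff.contDiffOn (by fun_prop)
  have hm : Set.MapsTo (fun r : ℝ => (x, r)) (Set.Icc 0 1)
      {z : Euc n × ℝ | z.2 ∈ Set.Icc (0 : ℝ) 1} := fun r hr => hr
  have h1 : ContDiffOn ℝ ∞ (fun r => a r n p x) (Set.Icc 0 1) := (h.smooth n p).comp hι hm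
  have h2 := (h1.differentiableOn (by simp) t ht).hasDerivWithinAt
  have h3 : HasDerivWithinAt (fun r => a r n p x v)
      (derivWithin (fun r => a r n p x) (Set.Icc 0 1) t v) (Set.Icc 0 1) t :=
    (ContinuousAlternatingMap.apply ℝ (Euc n) V v).hasFDerivAt.comp_hasDerivWithinAt t h2
  exact (h3.derivWithin (uniqueDiffOn_Icc zero_lt_one t ht)).symm

theorem IsLoopConnectionPath.isFormPath {act : X → Loop E G → X} {A : ℝ → LoopFormData E X 1}
    (hA : IsLoopConnectionPath E G act A) (s : ℝ) : IsFormPath fun t => A t s where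
  isForm t ht := (hA.isLoopConnection t ht).isLoopForm.isForm s
  smooth n p := by
    have hι : ContDiffOn ℝ ∞ (fun z : Euc n × ℝ => (z.1, s, z.2)) {z | z.2 ∈ Set.Icc (0 : ℝ) 1} :=
      ContDiff.contDiffOn (by fun_prop)
    have hm : Set.MapsTo (fun z : Euc n × ℝ => (z.1, s, z.2)) {z | z.2 ∈ Set.Icc (0 : ℝ) 1}
        {z : Euc n × ℝ × ℝ | z.2.2 ∈ Set.Icc (0 : ℝ) 1} := fun z hz => hz
    exact (hA.smooth n p).comp hι hm

end TimeDerivative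

/-! ### The integrand of the string potential as a contraction. -/

section Potential

variable {E : Type*} [NormedAddCommGroup E] [NormedSpace ℝ E] [FiniteDimensional ℝ E]
  {G : Type*} [TopologicalSpace G] [ChartedSpace E G] [Group G] [LieGroup 𝓘(ℝ, E) ∞ G]
  [DiffeologicalSpace G] [IsManifoldDiffeology E G]
  {Q : Type*} [DiffeologicalSpace Q] [MulAction (Loop E G)ᵐᵒᵖ Q]

variable (G) in
/-- The integrand of the relative string potential. -/
def stringIntegrand {m : ℕ} (f : InvariantPolynomial E G (m + 1)) (A : ℝ → LoopFormData E Q 1)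
    (Φ : ℝ → Q → Real.Angle → E) (t s : ℝ) : FormData Q ℝ (2 * m) :=
  stringIntegrandAux (timeDeriv (fun r => A r (s : Real.Angle)) t)
      (curvature G (A t (s : Real.Angle))) (higgsDeriv G (A t) (Φ t) (s : Real.Angle)) m f.toMap +
    wedge f.toMap
      (Fin.snoc (fun _ : Fin m => ⟨2, curvature G (A t (s : Real.Angle))⟩)
        ⟨0, zeroForm fun q => derivWithin (fun r => Φ r q (s : Real.Angle)) (Set.Icc 0 1) t⟩)
      (2 * m) (by simp [Fin.sum_univ_castSucc]; ring)

/-- The contraction of the relative Chern-Simons form with `∂_θ`. -/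
theorem chernSimonsIntegrand_contract {m : ℕ} (f : InvariantPolynomial E G (m + 1))
    {A : ℝ → LoopFormData E Q 1} {Φ : ℝ → Q → Real.Angle → E}
    (hA : IsLoopConnectionPath E G (fun q γ => q <• γ) A)
    (hΦ : IsHiggsPath E G (fun q γ => q <• γ) Φ) {t : ℝ} (ht : t ∈ Set.Icc (0 : ℝ) 1) (s : ℝ)
    {n : ℕ} (p : Plot Q n) (x : Euc n) :
    ((chernSimonsIntegrand G f (fun r => (caloronForm (A r) (Φ r) :
        FormData (Q × Real.Angle × G) E 1)) t (n + 1) (p.timesCircleOne G)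
        (inclL n x + s • lastVec n)).curryLeft (lastVec n)).compContinuousLinearMap (inclL n) =
      ((m + 1 : ℕ) : ℝ) • stringIntegrand G f A Φ t s n p x := by
  have hL := (hA.isLoopConnection t ht).isLoopForm
  have hK := isFormPath_caloronForm hA hΦ
  have hF := hK.isForm t ht
  have hB : ∀ w, one (timeDeriv (fun r => (caloronForm (A r) (Φ r) :
      FormData (Q × Real.Angle × G) E 1)) t) (p.timesCircleOne G) (inclL n x + s • lastVec n)
      (inclL n w) = one (timeDeriv (fun r => A r (s : Real.Angle)) t) p x w := by
    intro w
    refine (hK.timeDeriv_apply ht _ _ _).trans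
      (Eq.trans ?_ ((hA.isFormPath s).timeDeriv_apply ht p x fun _ => w).symm)
    refine derivWithin_congr (fun r hr => ?_) ?_
    · exact oneL_timesCircleOne_incl (hA.isLoopConnection r hr).isLoopForm.isForm (Φ r) p x s w
    · exact oneL_timesCircleOne_incl hL.isForm (Φ t) p x s w
  have hφ : one (timeDeriv (fun r => (caloronForm (A r) (Φ r) :
      FormData (Q × Real.Angle × G) E 1)) t) (p.timesCircleOne G) (inclL n x + s • lastVec n)
      (lastVec n) = derivWithin (fun r => Φ r (p.1 x) (s : Real.Angle)) (Set.Icc 0 1) t := by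
    refine (hK.timeDeriv_apply ht _ _ _).trans (derivWithin_congr (fun r hr => ?_) ?_)
    · exact oneL_timesCircleOne_lastVec (hA.isLoopConnection r hr).isLoopForm.isForm (Φ r) p x s
    · exact oneL_timesCircleOne_lastVec hL.isForm (Φ t) p x s
  have hFF : ∀ v w, two (curvature G (caloronForm (A t) (Φ t) : FormData (Q × Real.Angle × G) E 1))
      (p.timesCircleOne G) (inclL n x + s • lastVec n) (inclL n v) (inclL n w) =
      two (curvature G (A t s)) p x v w := fun v w => by
    rw [two_curvature hF, curv_timesCircleOne_incl hL.isForm hF]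
  have hFe : ∀ w, two (curvature G (caloronForm (A t) (Φ t) : FormData (Q × Real.Angle × G) E 1))
      (p.timesCircleOne G) (inclL n x + s • lastVec n) (inclL n w) (lastVec n) =
      one (higgsDeriv G (A t) (Φ t) s) p x w := fun w => by
    rw [two_curvature hF, curv_timesCircleOne_lastVec hL hF]
  ext v
  have h1 := wedge_cons_apply f.toMap (timeDeriv (fun r => (caloronForm (A r) (Φ r) :
      FormData (Q × Real.Angle × G) E 1)) t) (curvature G (caloronForm (A t) (Φ t)))
      (by simp [Fin.sum_univ_succ]; ring) (p.timesCircleOne G) (inclL n x + s • lastVec n)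
      (Fin.cons (lastVec n) fun j => inclL n (v j))
  -- ∂_θ falls either on the first entry, which yields φ, or on one of the 2m curvature slots, each
  -- of which yields ∇Φ.
  have h2 := altF_cons_pairs_contract f.toMap f.symm
    (one (timeDeriv (fun r => (caloronForm (A r) (Φ r) : FormData (Q × Real.Angle × G) E 1)) t)
      (p.timesCircleOne G) (inclL n x + s • lastVec n))
    (F := two (curvature G (caloronForm (A t) (Φ t) : FormData (Q × Real.Angle × G) E 1))
      (p.timesCircleOne G) (inclL n x + s • lastVec n)) (two_swap _ _ _)
    (lastVec n) (fun j => inclL n (v j))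
  refine (congrArg (((m + 1 : ℕ) : ℝ) • ·) (h1.trans (congrArg _ h2))).trans ?_
  refine congrArg (((m + 1 : ℕ) : ℝ) • ·) ?_
  rw [smul_add]
  change _ = stringIntegrandAux _ _ _ m f.toMap n p x v + wedge _ _ _ _ n p x v
  rw [add_comm, wedge_snoc_zero_apply]
  refine congrArg₂ (· + ·) ?_
    (congrArg _ ((altF_map _ (inclL n) v).trans (altF_congr (fun z => ?_) v)))
  · cases m with
    | zero => simp [stringIntegrandAux]
    | succ l =>
      change _ = (((l + 1 : ℕ) : ℝ) • wedge _ _ _ _ n p x) v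
      rw [ContinuousAlternatingMap.smul_apply, wedge_cons_snoc_apply, smul_smul, smul_smul]
      refine congrArg₂ (· • ·) ?_ ((altF_map _ (inclL n) v).trans (altF_congr (fun z => ?_) v))
      -- The 2(l + 1) slots against the normalisation 2^(l+1) leave (l + 1) / 2^l, which is where
      -- the factor k - 1 comes from.
      · push_cast
        field_simp
        ring
      · rw [pairs_tail_snoc, hFe]
        have h3 : (Fin.snoc (fun j => inclL n (z j)) (lastVec n) :
            Fin (2 * (l + 1) + 1) → Euc (n + 1)) 0 = inclL n (z 0) :=
          Fin.snoc_castSucc (α := fun _ => Euc (n + 1)) (lastVec n) (fun j => inclL n (z j)) 0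
        rw [h3, hB]
        congr 3
        ext1 i
        exact hFF _ _
  -- Symmetry of f moves φ from the first entry to the last.
  · rw [hφ, map_cons_eq_snoc f.toMap f.symm]
    congr 2
    ext1 i
    exact hFF _ _

end Potential

/-! ### The fibre integral of the Chern-Simons form. -/

section FibreIntegral

variable {X : Type*} [DiffeologicalSpace X] {V : Type*} [NormedAddCommGroup V] [NormedSpace ℝ V]

theorem intervalIntegral_swap_of_continuous {F : ℝ → ℝ → V} (hF : Continuous fun z : ℝ × ℝ => F z.1 z.2)
    (a b c d : ℝ) : ∫ s in a..b, ∫ t in c..d, F s t = ∫ t in c..d, ∫ s in a..b, F s t := by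
  refine MeasureTheory.intervalIntegral_intervalIntegral_swap ?_
  exact (hF.continuousOn.integrableOn_compact
    (isCompact_uIcc.prod isCompact_uIcc)).mono_set
      (Set.prod_mono Set.uIoc_subset_uIcc Set.uIoc_subset_uIcc)

theorem IsForm.continuous_contract_comp {k : ℕ} {η : FormData X V (k + 1)} (hη : IsForm η) {n : ℕ}
    (p : Plot X (n + 1)) {S : Type*} [TopologicalSpace S] {u : S → Euc n} {τ : S → ℝ}
    (hu : Continuous u) (hτ : Continuous τ) :
    Continuous fun s => ((η (n + 1) p (inclL n (u s) + τ s • lastVec n)).curryLeft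
      (lastVec n)).compContinuousLinearMap (inclL n) :=
  (compCLM (V := V) (k := k) (inclL n)).continuous.comp
    ((curryLeftCLM (V := V) (k := k) (lastVec n)).continuous.comp
      ((hη.smooth _ p).continuous.comp (((inclL n).continuous.comp hu).add
        (hτ.smul continuous_const))))

theorem fibreInt_sub {k : ℕ} {η ζ : FormData (X × Real.Angle) V (k + 1)} (hη : IsForm η)
    (hζ : IsForm ζ) : fibreInt (η - ζ) = fibreInt η - fibreInt ζ := by
  funext n p x
  refine Eq.trans ?_ (intervalIntegral.integral_sub
    (((hη.continuous_contract p.timesCircle x).const_smul ((-1 : ℝ) ^ k)).intervalIntegrable _ _)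
    (((hζ.continuous_contract p.timesCircle x).const_smul ((-1 : ℝ) ^ k)).intervalIntegrable _ _))
  refine intervalIntegral.integral_congr fun s _ => ?_
  rw [← smul_sub]
  rfl

variable {E : Type*} [NormedAddCommGroup E] [NormedSpace ℝ E] [FiniteDimensional ℝ E]
  {G : Type*} [TopologicalSpace G] [ChartedSpace E G] [Group G] [LieGroup 𝓘(ℝ, E) ∞ G]
  [DiffeologicalSpace G] [IsManifoldDiffeology E G]
  {M : Type*} [TopologicalSpace M] [DiffeologicalSpace M]
  {Q : Type*} [DiffeologicalSpace Q] [MulAction (Loop E G)ᵐᵒᵖ Q] (P : LoopBundle E G Q M)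

/-- The integrals over the circle and over time are exchanged in the smooth reparametrised time τ,
where the integrand is a contracted Chern-Weil form and hence jointly continuous. The substitution t
= χ(τ) is undone afterwards. -/
theorem fibreInt_chernSimons_caloronForm {m : ℕ} (f : InvariantPolynomial E G (m + 1))
    {A : ℝ → LoopFormData E Q 1} {Φ : ℝ → Q → Real.Angle → E}
    (hA : IsLoopConnectionPath E G (fun q γ => q <• γ) A)
    (hΦ : IsHiggsPath E G (fun q γ => q <• γ) Φ) {n : ℕ} (p : Plot Q n) (x : Euc n) :
    ∫ s in (0 : ℝ)..(2 * Real.pi), ((chernSimons G f (fun t => (caloronForm (A t) (Φ t) :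
        FormData (Q × Real.Angle × G) E 1)) (n + 1) (p.timesCircleOne G)
        (inclL n x + s • lastVec n)).curryLeft (lastVec n)).compContinuousLinearMap (inclL n) =
      stringPotential G f A Φ n p x := by
  have hK := isFormPath_caloronForm hA hΦ
  have hCW := isForm_chernWeil f (isForm_pathTotal hK)
  let T := p.timesCircleOne G
  obtain ⟨C, hC⟩ : ∃ C : (Euc (n + 1) [⋀^Fin (2 * m + 1)]→L[ℝ] ℝ) →L[ℝ]
      Euc n [⋀^Fin (2 * m)]→L[ℝ] ℝ,
      ∀ η, (η.curryLeft (lastVec n)).compContinuousLinearMap (inclL n) = C η :=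
    ⟨(compCLM (V := ℝ) (k := 2 * m) (inclL n)).comp
      (curryLeftCLM (V := ℝ) (k := 2 * m) (lastVec n)), fun _ => rfl⟩
  let I : ℝ → ℝ → Euc n [⋀^Fin (2 * m)]→L[ℝ] ℝ := fun t s =>
    ((m + 1 : ℕ) : ℝ) • stringIntegrand G f A Φ t s n p x
  obtain ⟨J, hJ, hCJ, hJs⟩ : ∃ J : ℝ × ℝ → Euc (n + 1) [⋀^Fin (2 * m + 1)]→L[ℝ] ℝ,
      Continuous J ∧
      (∀ s τ, C (J (s, τ)) = deriv Real.smoothTransition τ • I (Real.smoothTransition τ) s) ∧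
      ∀ s : ℝ, chernSimons G f (fun t => (caloronForm (A t) (Φ t) :
        FormData (Q × Real.Angle × G) E 1)) (n + 1) (p.timesCircleOne G)
        (inclL n x + s • lastVec n) = ∫ τ in (0 : ℝ)..1, J (s, τ) := by
    refine ⟨fun z => ((chernWeil G f (pathTotal fun t => (caloronForm (A t) (Φ t) :
      FormData (Q × Real.Angle × G) E 1)) (n + 1 + 1) T.timesLine
      (inclL (n + 1) (inclL n x + z.1 • lastVec n) + z.2 • lastVec (n + 1))).curryLeft
      (lastVec (n + 1))).compContinuousLinearMap (inclL (n + 1)), ?_, fun s τ => ?_, fun s => ?_⟩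
    · have h1 : Continuous fun z : ℝ × ℝ => inclL n x + z.1 • lastVec n := by fun_prop
      exact hCW.continuous_contract_comp T.timesLine h1 continuous_snd
    · beta_reduce
      rw [← smul_chernSimonsIntegrand f hK T (inclL n x + s • lastVec n) τ, map_smul, ← hC]
      congr 1
      exact chernSimonsIntegrand_contract f hA hΦ (smoothTransition_mem_Icc τ) s p x
    · rw [chernSimons_eq_lineInt f hK]
      rfl
  have h1 : ∀ s : ℝ, C (∫ τ in (0 : ℝ)..1, J (s, τ)) = ∫ τ in (0 : ℝ)..1, C (J (s, τ)) := by
    intro s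
    have h2 : Continuous fun τ : ℝ => J (s, τ) := hJ.comp (by fun_prop)
    exact (ContinuousLinearMap.intervalIntegral_comp_comm (𝕜 := ℝ) (μ := MeasureTheory.volume)
      (E := Euc (n + 1) [⋀^Fin (2 * m + 1)]→L[ℝ] ℝ) (F := Euc n [⋀^Fin (2 * m)]→L[ℝ] ℝ) C
      (h2.intervalIntegrable 0 1)).symm
  simp only [hJs, hC, h1]
  rw [intervalIntegral_swap_of_continuous (F := fun s τ => C (J (s, τ))) (C.continuous.comp hJ)]
  simp only [hCJ, intervalIntegral.integral_smul]
  rw [← intervalIntegral_smoothTransition fun t => ∫ s in (0 : ℝ)..(2 * Real.pi), I t s]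
  simp only [I, intervalIntegral.integral_smul]
  rfl

/-- The two paths are known to agree only for times in [0,1]; gauge invariance with g = 1 asks for
no more. -/
theorem chernSimons_pullback_caloronMk {m : ℕ} (f : InvariantPolynomial E G (m + 1))
    {A : ℝ → LoopFormData E Q 1} {Φ : ℝ → Q → Real.Angle → E}
    (hA : IsLoopConnectionPath E G (fun q γ => q <• γ) A)
    (hΦ : IsHiggsPath E G (fun q γ => q <• γ) Φ)
    {a : ℝ → FormData (Caloron E G Q) E 1} (hp : IsFormPath a)
    (ha : ∀ t ∈ Set.Icc (0 : ℝ) 1, IsCaloronConnection (A t) (Φ t) (a t)) :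
    pullback (caloronMk E G Q) (caloronMk_smooth E G Q) (chernSimons G f a) =
      chernSimons G f fun t => caloronForm (A t) (Φ t) := by
  funext n p
  refine chernSimons_gauge f (isFormPath_caloronForm hA hΦ) hp p (p.map _ (caloronMk_smooth E G Q))
    (g := fun _ => 1) contMDiff_const fun t ht y => ?_
  rw [inv_one, Ad_one, leftLogDeriv_const, ContinuousLinearMap.id_comp, add_zero,
    ← (ha t ht).pullback_eq]
  rfl

variable {P} in
/-- The string potential is the fibre integral of the relative Chern-Simons form. -/
theorem pullback_fibreInt_chernSimons {m : ℕ} (f : InvariantPolynomial E G (m + 1))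
    {A : ℝ → LoopFormData E Q 1} {Φ : ℝ → Q → Real.Angle → E}
    (hA : IsLoopConnectionPath E G (fun q γ => q <• γ) A)
    (hΦ : IsHiggsPath E G (fun q γ => q <• γ) Φ)
    {w : FormData (M × Real.Angle) ℝ (2 * m + 1)} (hw : IsCaloronChernSimons P f A Φ w) :
    pullback P.proj P.proj_smooth (fibreInt w) = stringPotential G f A Φ := by
  obtain ⟨a, hp, ha, hwf, hwp⟩ := hw
  have hpath : IsFormPath a := ⟨fun t ht => (hp.isConnection t ht).isForm, hp.smooth⟩
  funext n p x
  rw [← fibreInt_chernSimons_caloronForm f hA hΦ p x,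
    ← chernSimons_pullback_caloronMk f hA hΦ hpath ha, ← hwp]
  refine intervalIntegral.integral_congr fun s _ => ?_
  change (-1 : ℝ) ^ (2 * m) • _ = _
  -- The fibre integral has even degree 2m, so its sign is trivial. What remains is definitional:
  -- the plot (q, s) ↦ [q, s, 1] lies over the circle thickening of the projected plot.
  rw [pow_mul, neg_one_sq, one_pow, one_smul]
  rfl

end FibreIntegral

/-! ### Existence of the forms on the base, and the differential of the potential. -/

section Main

variable {E : Type*} [NormedAddCommGroup E] [NormedSpace ℝ E] [FiniteDimensional ℝ E]
  {G : Type*} [TopologicalSpace G] [ChartedSpace E G] [Group G] [LieGroup 𝓘(ℝ, E) ∞ G]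
  [DiffeologicalSpace G] [IsManifoldDiffeology E G]
  {M : Type*} [TopologicalSpace M] [DiffeologicalSpace M]
  {Q : Type*} [DiffeologicalSpace Q] [MulAction (Loop E G)ᵐᵒᵖ Q] {P : LoopBundle E G Q M}

theorem exists_isStringForm (hM : ContinuousPlots M) {m : ℕ} (f : InvariantPolynomial E G (m + 1))
    {A : LoopFormData E Q 1} {Φ : Q → Real.Angle → E}
    (hA : IsLoopConnection E G (fun q γ => q <• γ) A) (hΦ : IsHiggs E G (fun q γ => q <• γ) Φ)
    {a : FormData (Caloron E G Q) E 1} (ha : IsCaloronConnection A Φ a) :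
    ∃ s, IsStringForm P f A Φ s := by
  have hb := isBasic_chernWeil (P := P) hM f hA hΦ ha
  exact ⟨_, a, _, ha,
    isForm_descend (P.hasLocalLifts_caloronProj hM) (isForm_chernWeil f ha.isConnection.isForm) hb,
    pullback_descend _ _ hb, rfl⟩

theorem exists_caloronConnectionPath (hM : ContinuousPlots M) (P : LoopBundle E G Q M)
    {A : ℝ → LoopFormData E Q 1} {Φ : ℝ → Q → Real.Angle → E}
    (hA : IsLoopConnectionPath E G (fun q γ => q <• γ) A)
    (hΦ : IsHiggsPath E G (fun q γ => q <• γ) Φ) :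
    ∃ a : ℝ → FormData (Caloron E G Q) E 1, IsConnectionPath E G (caloronAct E G Q) a ∧
      ∀ t ∈ Set.Icc (0 : ℝ) 1, IsCaloronConnection (A t) (Φ t) (a t) := by
  have hK := isFormPath_caloronForm hA hΦ
  have hb : ∀ t ∈ Set.Icc (0 : ℝ) 1, IsBasic (caloronMk E G Q) (caloronForm (A t) (Φ t)) :=
    fun t ht => P.isBasic_caloronForm hM (hA.isLoopConnection t ht) (hΦ.isHiggs t ht) (hK.isForm t ht)
  have ha := fun t ht => isCaloronConnection_descend (hA.isLoopConnection t ht) (hK.isForm t ht)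
    (hb t ht)
  exact ⟨_, ⟨fun t ht => (ha t ht).isConnection,
    (isFormPath_descend hasLocalLifts_caloronMk hK hb).smooth⟩, ha⟩

theorem exists_isCaloronChernSimons (hM : ContinuousPlots M) {m : ℕ}
    (f : InvariantPolynomial E G (m + 1)) {A : ℝ → LoopFormData E Q 1} {Φ : ℝ → Q → Real.Angle → E}
    (hA : IsLoopConnectionPath E G (fun q γ => q <• γ) A)
    (hΦ : IsHiggsPath E G (fun q γ => q <• γ) Φ) : ∃ w, IsCaloronChernSimons P f A Φ w := by
  obtain ⟨a, hp, ha⟩ := exists_caloronConnectionPath hM P hA hΦ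
  have hpath : IsFormPath a := ⟨fun t ht => (hp.isConnection t ht).isForm, hp.smooth⟩
  have hb := isBasic_chernSimons (P := P) hM f hA hΦ hpath ha
  exact ⟨_, a, hp, ha,
    isForm_descend (P.hasLocalLifts_caloronProj hM) (isForm_chernSimons f hpath) hb,
    pullback_descend _ _ hb⟩

/-- The transgression formula on the caloron transform descends to M × S¹ because pullback along the
projection is injective, and integration over the fibre commutes with d. -/
theorem extd_fibreInt_chernSimons (hM : ContinuousPlots M) {m : ℕ}
    (f : InvariantPolynomial E G (m + 1)) {A : ℝ → LoopFormData E Q 1} {Φ : ℝ → Q → Real.Angle → E}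
    {w : FormData (M × Real.Angle) ℝ (2 * m + 1)} (hw : IsCaloronChernSimons P f A Φ w)
    {s₀ s₁ : FormData M ℝ (2 * m + 1)} (h₀ : IsStringForm P f (A 0) (Φ 0) s₀)
    (h₁ : IsStringForm P f (A 1) (Φ 1) s₁) : extd (fibreInt w) = s₁ - s₀ := by
  obtain ⟨a, hp, ha, hwf, hwp⟩ := hw
  obtain ⟨a₀, w₀, ha₀, hw₀, hp₀, rfl⟩ := h₀
  obtain ⟨a₁, w₁, ha₁, hw₁, hp₁, rfl⟩ := h₁
  have hpath : IsFormPath a := ⟨fun t ht => (hp.isConnection t ht).isForm, hp.smooth⟩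
  -- A caloron connection is determined by its pullback to Q × S¹ × G, so the connections behind the
  -- string forms are the ends of the path.
  obtain rfl := ha₀.eq (ha 0 (by simp))
  obtain rfl := ha₁.eq (ha 1 (by simp))
  have hsub : IsForm (w₁ - w₀) := by
    have h := hw₁.add (hw₀.smul (-1))
    rwa [neg_one_smul, ← sub_eq_add_neg] at h
  have h : extd w = w₁ - w₀ := by
    refine pullback_injective P.caloronProj_smooth (P.hasLocalLifts_caloronProj hM) hwf.extd hsub ?_
    have h1 : pullback P.caloronProj P.caloronProj_smooth (extd w) =
      extd (pullback P.caloronProj P.caloronProj_smooth w) := rfl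
    rw [h1, hwp, extd_chernSimons f hpath, ← hp₀, ← hp₁]
    rfl
  rw [extd_fibreInt hwf, h, fibreInt_sub hw₁ hw₀]

end Main

end LoopBundles
end

theorem mainTheorem6
    {E : Type*} [NormedAddCommGroup E] [NormedSpace ℝ E] [FiniteDimensional ℝ E]
    {G : Type*} [TopologicalSpace G] [ChartedSpace E G] [Group G] [LieGroup 𝓘(ℝ, E) ∞ G]
    [DiffeologicalSpace G] [IsManifoldDiffeology E G]
    {EM : Type*} [NormedAddCommGroup EM] [NormedSpace ℝ EM] [FiniteDimensional ℝ EM]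
    {M : Type*} [TopologicalSpace M] [ChartedSpace EM M] [IsManifold 𝓘(ℝ, EM) ∞ M]
    [DiffeologicalSpace M] [IsManifoldDiffeology EM M]
    {Q : Type*} [DiffeologicalSpace Q] [MulAction (Loop E G)ᵐᵒᵖ Q] (P : LoopBundle E G Q M)
    {m : ℕ} (f : InvariantPolynomial E G (m + 1))
    (A : ℝ → LoopFormData E Q 1) (Φ : ℝ → Q → Real.Angle → E)
    (hA : IsLoopConnectionPath E G (fun q γ => q <• γ) A)
    (hΦ : IsHiggsPath E G (fun q γ => q <• γ) Φ) :
    ∃ S : FormData M ℝ (2 * m),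
      (IsForm S ∧ pullback P.proj P.proj_smooth S = stringPotential G f A Φ) ∧
      (∀ S' : FormData M ℝ (2 * m),
        IsForm S' → pullback P.proj P.proj_smooth S' = stringPotential G f A Φ → S' = S) ∧
      ((∃ s₀, IsStringForm P f (A 0) (Φ 0) s₀) ∧ (∃ s₁, IsStringForm P f (A 1) (Φ 1) s₁) ∧
        ∀ s₀ s₁ : FormData M ℝ (2 * m + 1),
          IsStringForm P f (A 0) (Φ 0) s₀ → IsStringForm P f (A 1) (Φ 1) s₁ → extd S = s₁ - s₀) ∧
      ((∃ w, IsCaloronChernSimons P f A Φ w) ∧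
        ∀ w : FormData (M × Real.Angle) ℝ (2 * m + 1),
          IsCaloronChernSimons P f A Φ w → S = fibreInt w) := by
  have hM : ContinuousPlots M := continuousPlots_of_isManifoldDiffeology (EM := EM)
  obtain ⟨w, hw⟩ := exists_isCaloronChernSimons (P := P) hM f hA hΦ
  have huniq : ∀ S S' : FormData M ℝ (2 * m), IsForm S → IsForm S' →
      pullback P.proj P.proj_smooth S = stringPotential G f A Φ →
      pullback P.proj P.proj_smooth S' = stringPotential G f A Φ → S = S' :=
    fun S S' hS hS' h h' => pullback_injective _ (P.hasLocalLifts hM) hS hS' (h.trans h'.symm)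
  have hform : ∀ w, IsCaloronChernSimons P f A Φ w → IsForm (fibreInt w) := by
    rintro w ⟨-, -, -, hwf, -⟩
    exact isForm_fibreInt hwf
  have hS := pullback_fibreInt_chernSimons f hA hΦ hw
  obtain ⟨a, -, ha⟩ := exists_caloronConnectionPath hM P hA hΦ
  have hs : ∀ t ∈ Set.Icc (0 : ℝ) 1, ∃ s, IsStringForm P f (A t) (Φ t) s := fun t ht =>
    exists_isStringForm hM f (hA.isLoopConnection t ht) (hΦ.isHiggs t ht) (ha t ht)
  -- The fibre integral of one Chern-Simons form serves as S. Every other one pulls back to the same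
  -- form on Q, so uniqueness identifies its fibre integral with S.
  refine ⟨fibreInt w, ⟨hform w hw, hS⟩, fun S' hS' h => huniq _ _ hS' (hform w hw) h hS,
    ⟨hs 0 (by simp), hs 1 (by simp), fun s₀ s₁ h₀ h₁ => extd_fibreInt_chernSimons hM f hw h₀ h₁⟩,
    ⟨w, hw⟩, fun w' hw' => huniq _ _ (hform w hw) (hform w' hw') hS
      (pullback_fibreInt_chernSimons f hA hΦ hw')⟩
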